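/- Let $n$ be an even integer, and let $(X_{i,j})_{i\ne j}$, $i,j\in[n]$, be i.i.d. uniform random variables on $[0,1]$; person $i$ prefers $a$ to $b$ if $X_{i,a}<X_{i,b}$. A perfect matching $\Pi$ of $[n]$, with $\Pi(i)$ denoting the partner of $i$, is stable if for every pair $i\neq j$ with $\{i,j\}\notin\Pi$ we have $X_{i,\Pi(i)}<X_{i,j}$ or $X_{j,\Pi(j)}<X_{j,i}$. Write $x_i=X_{i,\Pi(i)}$ and let $\mathcal G_\Pi$ be the event that $$\Big|\sum_i x_i-\sqrt n\Big|\le 10\log n,\quad x_i\le \frac{\log^2 n}{\sqrt n}\ \text{ for all } i,\quad \Big|\sum_{\{i,j\}\in\Pi}x_ix_j-\tfrac12\Big|\le n^{-1/3},\quad \Big|\sum_i x_i^2-2\Big|\le n^{-1/3}.$$ **Lemma.** There are absolute constants $C$, $K$, $N$ such that for every even $n\ge N$ the following holds. Let $\Pi,\Pi_1$ be perfect matchings of $[n]$, viewed as sets of edges, with $|\Pi\triangle\Pi_1|\le n^{1/4}$, and let $\mu$ be the number of cycles of the graph with edge set $\Pi\triangle\Pi_1$ (a vertex-disjoint union of cycles).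 Then $$\Big|\,\mathbb P\big(\Pi_1\text{ is stable and }\mathcal G_\Pi\text{ holds}\ \big|\ \Pi\text{ is stable}\big)-2^\mu n^{-|\Pi\setminus\Pi_1|}\Big|\le C(\log n)^K n^{-1/3}\cdot 2^\mu n^{-|\Pi\setminus\Pi_1|},$$ that is, $\mathbb P(\Pi_1,\mathcal G_\Pi\mid\Pi)=(1\pm\widetilde O(n^{-1/3}))\,2^\mu n^{-|\Pi\setminus\Pi_1|}$, uniformly in $\Pi$ and $\Pi_1$. -/

import Mathlib

open MeasureTheory ProbabilityTheory
open scoped symmDiff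

namespace StableRoommates

/-- Perfect matchings of `n` people are perfect matchings of the complete graph on `Fin n`. -/
abbrev KSubgraph (n : ℕ) : Type := (⊤ : SimpleGraph (Fin n)).Subgraph

/-- The index set of the array `(X_{i,j})` with `i ≠ j`. -/
abbrev OffDiag (n : ℕ) : Type := {p : Fin n × Fin n // p.1 ≠ p.2}

/-- The law of the array `(X_{i,j})_{i ≠ j}` of i.i.d. uniform random variables in `[0,1]`;
`i` prefers `a` to `b` when `X_{i,a} < X_{i,b}`. -/
noncomputable def prefLaw (n : ℕ) : Measure (OffDiag n → ℝ) :=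
  Measure.pi fun _ => (volume : Measure ℝ).restrict (Set.Icc 0 1)

section Matching

variable {n : ℕ} {M : KSubgraph n}

/-- The partner of `i` in the perfect matching `M`. -/
noncomputable def partner (hM : M.IsPerfectMatching) (i : Fin n) : Fin n :=
  (hM.1 (hM.2 i)).choose

theorem adj_partner (hM : M.IsPerfectMatching) (i : Fin n) : M.Adj i (partner hM i) :=
  (hM.1 (hM.2 i)).choose_spec.1

theorem ne_partner (hM : M.IsPerfectMatching) (i : Fin n) : i ≠ partner hM i :=
  (adj_partner hM i).ne

/-- `x_i = X_{i,M(i)}`. -/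
noncomputable def partnerValue (hM : M.IsPerfectMatching) (X : OffDiag n → ℝ) (i : Fin n) : ℝ :=
  X ⟨(i, partner hM i), ne_partner hM i⟩

/-- The event that `M` is stable: for every pair `i ≠ j` not matched by `M`, `i` prefers its
partner to `j` or `j` prefers its partner to `i`. -/
def stableEvent (hM : M.IsPerfectMatching) : Set (OffDiag n → ℝ) :=
  {X | ∀ (i j : Fin n) (hij : i ≠ j), ¬ M.Adj i j →
    partnerValue hM X i < X ⟨(i, j), hij⟩ ∨ partnerValue hM X j < X ⟨(j, i), hij.symm⟩}

/-- The quasirandomness event on the values `x_i = X_{i,M(i)}`.  In the sum of products over the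
edges of `M`, each edge is counted once. -/
def quasirandomEvent (hM : M.IsPerfectMatching) : Set (OffDiag n → ℝ) :=
  {X | |(∑ i, partnerValue hM X i) - Real.sqrt n| ≤ 10 * Real.log n ∧
    (∀ i, partnerValue hM X i ≤ Real.log n ^ 2 / Real.sqrt n) ∧
    |(∑ i with i < partner hM i, partnerValue hM X i * partnerValue hM X (partner hM i)) - 1 / 2|
      ≤ (n : ℝ) ^ (-(1 / 3) : ℝ) ∧
    |(∑ i, partnerValue hM X i ^ 2) - 2| ≤ (n : ℝ) ^ (-(1 / 3) : ℝ)}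

end Matching

/-- The number of cycles of the symmetric difference of two perfect matchings.  Every vertex has
degree `0` or `2` there, so the cycles are the connected components with more than one vertex. -/
noncomputable def numCycles {n : ℕ} (M M₁ : KSubgraph n) : ℕ :=
  {c : (M.spanningCoe ∆ M₁.spanningCoe).ConnectedComponent | c.supp.Nontrivial}.ncard

end StableRoommates

/-! Condition on the values `x i` of the partners in Π and, at the vertices where the two partners
differ, on the new values `y t`, the values of the partners in Π₁. Joint stability then splits into
two parts. Each pair matched by neither matching must avoid two corner rectangles, independently of
the other pairs. Each edge of Π outside Π₁ must have an end preferring Π₁, and each edge of Π₁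
outside Π an end preferring Π. Counting shows that every such edge then has exactly one such end, so
the set `S` of vertices preferring Π₁ alternates along every cycle of the symmetric difference.
There are `2 ^ μ` such sets (`card_alternatingSets`), each of size `k`, the number of edges of Π
outside Π₁. The resulting integral is `prefLaw_stable_inter`.

Fix `S` and let `s` be the sum of the `x i`. For `t ∈ S` the value `y t` falls below `x t`, which
contributes `x t`. For each of the other `k` moved vertices the excess `y t - x t` costs a factor of
about `exp (-s (y t - x t))` in the free pairs, and integrating it out contributes `1 / s`. What is
left is the product of the `1 - x i * x j` over the pairs not in Π. On the quasirandom set it equals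
`exp (1/2 - s²/2)` up to a factor `1 + O(δ)`, where `δ = n^(-1/3)` (`stabilityWeight_quasirandom`).
So each `S` contributes `exp (1/2)` times the integral of `gaussWeight S`.

By Dirichlet's integral, the mass of `gaussWeight S` on the positive orthant is exactly `(n-1)! /
(n-1+k)!` times the mass for `S = ∅`, and this ratio is `n^(-k) (1 + O(k²/n))`. The probability that
Π is stable is the same computation with Π₁ = Π, so `exp (1/2)` and `gaussMass n` cancel in the
quotient.

It remains to see that the complement of the quasirandom set carries a fraction `O(δ)` of the
weight. Completing the square turns `gaussWeight S` into the density of independent Erlang variables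
of rate `√n`, of shape 2 on `S` and shape 1 elsewhere, times a factor controlled by `s`. Union and
Chebyshev bounds then suffice (`lintegral_gaussWeight_compl_quasirandomSet_le`). In the denominator
the complement also needs the bound `stabilityWeight_le_global`, which holds at every point of the
cube. -/

namespace StableRoommates

/-! ### Alternating sets of two fixed-point-free involutions, and their number. -/

section Involutions

set_option linter.unusedSectionVars false

variable {V : Type*} [Fintype V] [DecidableEq V] {f g : V → V}

/-- The points at which two maps differ. -/
def moved (f g : V → V) : Finset V := Finset.univ.filter fun i => f i ≠ g i

/-- The sets of moved points that contain exactly one end of every pair matched by `f` or `g`. -/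
def alternatingSets (f g : V → V) : Finset (Finset V) :=
  (moved f g).powerset.filter fun S =>
    ∀ t ∈ moved f g, (f t ∈ S ↔ t ∉ S) ∧ (g t ∈ S ↔ t ∉ S)

theorem mem_moved {i : V} : i ∈ moved f g ↔ f i ≠ g i := by simp [moved]

theorem mem_alternatingSets {S : Finset V} : S ∈ alternatingSets f g ↔
    S ⊆ moved f g ∧ ∀ t ∈ moved f g, (f t ∈ S ↔ t ∉ S) ∧ (g t ∈ S ↔ t ∉ S) := by
  simp [alternatingSets]

theorem left_mem_moved (hf : f.Involutive) (hg : g.Involutive) {t : V} (ht : t ∈ moved f g) :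
    f t ∈ moved f g := by
  rw [mem_moved] at *
  intro h
  rw [hf t] at h
  exact ht (by conv_rhs => rw [h, hg])

theorem moved_comm : moved f g = moved g f := by
  ext; simp [moved, eq_comm]

theorem right_mem_moved (hf : f.Involutive) (hg : g.Involutive) {t : V} (ht : t ∈ moved f g) :
    g t ∈ moved f g := by
  rw [moved_comm] at *
  exact left_mem_moved hg hf ht

theorem image_eq_sdiff_of_mem_alternatingSets (hf : f.Involutive) (hg : g.Involutive)
    {S : Finset V} (hS : S ∈ alternatingSets f g) : S.image f = moved f g \ S := by
  rw [mem_alternatingSets] at hS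
  ext t
  simp only [Finset.mem_image, Finset.mem_sdiff]
  constructor
  · rintro ⟨u, hu, rfl⟩
    have hu' := hS.1 hu
    exact ⟨left_mem_moved hf hg hu', fun h => ((hS.2 u hu').1.1 h) hu⟩
  · rintro ⟨ht, htS⟩
    exact ⟨f t, (hS.2 t ht).1.2 htS, hf t⟩

/-- `f` exchanges `S` with its complement among the moved points, so an alternating set is exactly
half of them. -/
theorem card_moved_sdiff (hf : f.Involutive) (hg : g.Involutive)
    {S : Finset V} (hS : S ∈ alternatingSets f g) : (moved f g \ S).card = S.card := by
  rw [← image_eq_sdiff_of_mem_alternatingSets hf hg hS,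
    Finset.card_image_of_injective _ hf.injective]

/-- A set meeting every `f`-pair contains at least half of the moved points, and so does a set
meeting every `g`-pair. Disjointness leaves no room for more, so both inequalities are equalities
and every pair is met exactly once. -/
theorem mem_alternatingSets_of_covers (hf : f.Involutive) (hg : g.Involutive) {A B : Finset V}
    (hA : A ⊆ moved f g) (hB : B ⊆ moved f g) (hAB : Disjoint A B)
    (hfA : ∀ t ∈ moved f g, t ∈ A ∨ f t ∈ A) (hgB : ∀ t ∈ moved f g, t ∈ B ∨ g t ∈ B) :
    A ∈ alternatingSets f g ∧ B = moved f g \ A := by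
  have key : ∀ (h : V → V) (U : Finset V), h.Involutive → U ⊆ moved f g →
      (∀ t ∈ moved f g, t ∈ U ∨ h t ∈ U) → moved f g \ U ⊆ U.image h := by
    intro h U hh _ hc t ht
    rw [Finset.mem_sdiff] at ht
    exact Finset.mem_image.2 ⟨h t, (hc t ht.1).resolve_left ht.2, hh t⟩
  have kA := key f A hf hA hfA
  have kB := key g B hg hB hgB
  have cA := Finset.card_le_card kA
  have cB := Finset.card_le_card kB
  rw [Finset.card_image_of_injective _ hf.injective] at cA
  rw [Finset.card_image_of_injective _ hg.injective] at cB
  have dA := Finset.card_sdiff_add_card_eq_card hA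
  have dB := Finset.card_sdiff_add_card_eq_card hB
  have hu := Finset.card_le_card (Finset.union_subset hA hB)
  rw [Finset.card_union_of_disjoint hAB] at hu
  have hBe : B = moved f g \ A := by
    refine Finset.eq_of_subset_of_card_le ?_ (by omega)
    intro t ht
    exact Finset.mem_sdiff.2 ⟨hB ht, fun h => Finset.disjoint_left.1 hAB h ht⟩
  have eA : moved f g \ A = A.image f := Finset.eq_of_subset_of_card_le kA (by
    rw [Finset.card_image_of_injective _ hf.injective]; omega)
  have eB : moved f g \ B = B.image g := Finset.eq_of_subset_of_card_le kB (by
    rw [Finset.card_image_of_injective _ hg.injective]; omega)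
  refine ⟨mem_alternatingSets.2 ⟨hA, fun t ht => ⟨⟨fun h1 h2 => ?_, fun h => ?_⟩,
    ⟨fun h1 h2 => ?_, fun h => ?_⟩⟩⟩, hBe⟩
  · have : f t ∈ moved f g \ A := by rw [eA]; exact Finset.mem_image_of_mem _ h2
    exact (Finset.mem_sdiff.1 this).2 h1
  · exact (hfA t ht).resolve_left h
  · have h3 : g t ∉ B := fun h => Finset.disjoint_left.1 hAB h1 h
    have h4 := (hgB t ht).resolve_right h3
    exact Finset.disjoint_left.1 hAB h2 h4
  · have h4 : t ∈ B := by rw [hBe]; exact Finset.mem_sdiff.2 ⟨ht, h⟩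
    have : g t ∈ moved f g \ B := by rw [eB]; exact Finset.mem_image_of_mem _ h4
    rw [hBe, Finset.mem_sdiff] at this
    by_contra h5
    exact this.2 (Finset.mem_sdiff.2 ⟨right_mem_moved hf hg ht, h5⟩)

/-- The composition of two involutions. -/
def compPerm (hf : f.Involutive) (hg : g.Involutive) : Equiv.Perm V := hg.toPerm * hf.toPerm

/-- The dihedral relation: conjugation by `f` inverts `g ∘ f`. -/
theorem apply_compPerm_zpow (hf : f.Involutive) (hg : g.Involutive) (i : ℤ) (x : V) :
    f ((compPerm hf hg ^ i) x) = (compPerm hf hg ^ (-i)) (f x) := by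
  have hF : hf.toPerm * hf.toPerm = 1 := by ext x; exact hf x
  have hG : hg.toPerm * hg.toPerm = 1 := by ext x; exact hg x
  have hFi : hf.toPerm⁻¹ = hf.toPerm := inv_eq_of_mul_eq_one_left hF
  have hGi : hg.toPerm⁻¹ = hg.toPerm := inv_eq_of_mul_eq_one_left hG
  have h1 : hf.toPerm * compPerm hf hg * hf.toPerm⁻¹ = (compPerm hf hg)⁻¹ := by
    simp only [compPerm, mul_inv_rev, hFi, hGi, mul_assoc, hF, mul_one]
  have h2 : hf.toPerm * compPerm hf hg ^ i = compPerm hf hg ^ (-i) * hf.toPerm := by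
    rw [zpow_neg, ← inv_zpow, ← h1, conj_zpow]; simp
  exact DFunLike.congr_fun h2 x

/-- If a power of `g ∘ f` sent `t` to `f t`, halving the exponent would produce a fixed point of `f`
(even exponent) or of `g` (odd exponent). Hence a cycle of the union of the two matchings splits
into two orbits of `g ∘ f`, which are its two alternating halves. -/
theorem not_sameCycle_compPerm (hf : f.Involutive) (hg : g.Involutive)
    (hf0 : ∀ i, f i ≠ i) (hg0 : ∀ i, g i ≠ i) (t : V) :
    ¬ (compPerm hf hg).SameCycle t (f t) := by
  rintro ⟨i, hi⟩
  rcases Int.even_or_odd' i with ⟨l, rfl | rfl⟩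
  · apply hf0 ((compPerm hf hg ^ l) t)
    rw [apply_compPerm_zpow hf hg, ← hi, ← Equiv.Perm.mul_apply, ← zpow_add]
    congr 2; ring
  · apply hg0 (f ((compPerm hf hg ^ l) t))
    have : g (f ((compPerm hf hg ^ l) t)) = (compPerm hf hg ^ (1 + l)) t := by
      rw [zpow_add, zpow_one]; rfl
    rw [this, apply_compPerm_zpow hf hg, ← hi, ← Equiv.Perm.mul_apply, ← zpow_add]
    congr 2; ring

/-- On a nontrivial component an alternating set is one of the two orbits of `g ∘ f`, so it is
determined by whether it contains a chosen representative, and these choices are independent over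
the components. -/
theorem card_alternatingSets (hf : f.Involutive) (hg : g.Involutive)
    (hf0 : ∀ i, f i ≠ i) (hg0 : ∀ i, g i ≠ i) (G : SimpleGraph V)
    (hG : ∀ a b, G.Adj a b ↔ f a ≠ g a ∧ (b = f a ∨ b = g a)) :
    (alternatingSets f g).card = 2 ^ {c : G.ConnectedComponent | c.supp.Nontrivial}.ncard := by
  classical
  set σ := compPerm hf hg with hσ
  have hmoved : ∀ t, t ∈ moved f g ↔ (G.connectedComponentMk t).supp.Nontrivial := by
    intro t
    rw [mem_moved]
    constructor
    · intro h
      refine ⟨t, rfl, f t, ?_, (hf0 t).symm⟩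
      have : G.Adj (f t) t := ((hG t (f t)).2 ⟨h, Or.inl rfl⟩).symm
      exact SimpleGraph.ConnectedComponent.sound this.reachable
    · rintro ⟨a, ha, b, hb, hab⟩
      have : ∃ u, u ≠ t ∧ G.Reachable t u := by
        by_cases h : a = t
        · exact ⟨b, fun h' => hab (h.trans h'.symm), (SimpleGraph.ConnectedComponent.exact hb).symm⟩
        · exact ⟨a, h, (SimpleGraph.ConnectedComponent.exact ha).symm⟩
      obtain ⟨u, hu, ⟨w⟩⟩ := this
      cases w with
      | nil => exact absurd rfl hu
      | cons h _ => exact ((hG _ _).1 h).1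
  -- Each edge of the walk switches between the two orbits, so two orbits exhaust a component.
  have hwalk : ∀ {a b : V}, G.Reachable a b → (σ.SameCycle a b ∨ σ.SameCycle a (f b)) := by
    intro a b hab
    obtain ⟨w⟩ := hab.symm
    induction w with
    | nil => exact Or.inl (Equiv.Perm.SameCycle.refl _ _)
    | @cons u v w h p ih =>
      rcases ((hG _ _).1 h.symm).2 with h1 | h1
      · rw [h1, hf]; exact (ih p.reachable.symm).symm
      · have e : u = σ (f v) := by
          rw [h1]; change _ = g (f (f v)); rw [hf]
        rcases ih p.reachable.symm with h2 | h2
        · right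
          have : f u = σ⁻¹ v := by
            have := apply_compPerm_zpow hf hg 1 (f v)
            rw [hf] at this
            rw [e]; simpa using this
          rw [this]; simpa using h2
        · left; rw [e]; simpa using h2
  let rep : G.ConnectedComponent → V := fun c => c.out
  have hrep : ∀ c, G.connectedComponentMk (rep c) = c := fun c => Quot.out_eq c
  let Φ : {S // S ∈ alternatingSets f g} →
      Set {c : G.ConnectedComponent // c.supp.Nontrivial} := fun S => {c | rep c.1 ∈ S.1}
  have hadj : ∀ t ∈ moved f g, ∀ v, v = f t ∨ v = g t →
      G.connectedComponentMk v = G.connectedComponentMk t := by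
    intro t ht v hv
    exact SimpleGraph.ConnectedComponent.sound ((hG t v).2 ⟨mem_moved.1 ht, hv⟩).symm.reachable
  have hΦ : Function.Bijective Φ := by
    constructor
    · rintro ⟨S, hS⟩ ⟨S', hS'⟩ h
      rw [mem_alternatingSets] at hS hS'
      -- Membership flips along every edge in both sets, so agreement at one vertex propagates
      -- through its component.
      have agree : ∀ {a b : V}, G.Reachable a b → (a ∈ S ↔ a ∈ S') → (b ∈ S ↔ b ∈ S') := by
        intro a b hab h0
        obtain ⟨w⟩ := hab
        induction w with
        | nil => exact h0
        | @cons u v w h p ih =>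
          apply ih
          obtain ⟨hu, rfl | rfl⟩ := (hG _ _).1 h
          · rw [(hS.2 u (mem_moved.2 hu)).1, (hS'.2 u (mem_moved.2 hu)).1, h0]
          · rw [(hS.2 u (mem_moved.2 hu)).2, (hS'.2 u (mem_moved.2 hu)).2, h0]
      have main : ∀ t ∈ moved f g, (t ∈ S ↔ t ∈ S') := by
        intro t ht
        have hr := hrep (G.connectedComponentMk t)
        refine agree (SimpleGraph.ConnectedComponent.exact hr) ?_
        have := Set.ext_iff.1 h ⟨_, (hmoved t).1 ht⟩
        exact this
      ext t
      by_cases ht : t ∈ moved f g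
      · exact main t ht
      · exact ⟨fun h => absurd (hS.1 h) ht, fun h => absurd (hS'.1 h) ht⟩
    · intro A
      let A' : Set G.ConnectedComponent := Subtype.val '' A
      -- The preimage of `A`: the orbit of the representative in the components belonging to `A`,
      -- the opposite orbit in the others.
      let S : Finset V := (moved f g).filter fun t =>
        (σ.SameCycle (rep (G.connectedComponentMk t)) t ↔ G.connectedComponentMk t ∈ A')
      have hS : S ∈ alternatingSets f g := by
        refine mem_alternatingSets.2 ⟨Finset.filter_subset _ _, fun t ht => ?_⟩
        have c1 := hadj t ht (f t) (Or.inl rfl)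
        have c2 := hadj t ht (g t) (Or.inr rfl)
        have hr := hrep (G.connectedComponentMk t)
        set r := rep (G.connectedComponentMk t) with hrdef
        have hB := hwalk (SimpleGraph.ConnectedComponent.exact hr)
        have hA' : σ.SameCycle r t → ¬ σ.SameCycle r (f t) := fun h1 h2 =>
          not_sameCycle_compPerm hf hg hf0 hg0 t (h1.symm.trans h2)
        have hgf : σ.SameCycle r (g t) ↔ σ.SameCycle r (f t) := by
          have : g t = σ (f t) := by
            change g t = g (f (f t)); rw [hf]
          rw [this]; simp
        have m1 := left_mem_moved hf hg ht
        have m2 := right_mem_moved hf hg ht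
        simp only [S, Finset.mem_filter, ht, m1, m2, c1, c2, true_and, ← hrdef, hgf]
        tauto
      refine ⟨⟨S, hS⟩, ?_⟩
      ext c
      have hc := c.2
      have hm : rep c.1 ∈ moved f g := by rw [hmoved, hrep]; exact hc
      change rep c.1 ∈ S ↔ c ∈ A
      simp only [S, Finset.mem_filter, hm, true_and, hrep, Equiv.Perm.SameCycle.refl, true_iff, A']
      simp [hc]
  have := Nat.card_congr (Equiv.ofBijective Φ hΦ)
  rw [← Nat.card_coe_set_eq, ← Fintype.card_coe, ← Nat.card_eq_fintype_card, this]
  have e2 : Nat.card (Set {c : G.ConnectedComponent // c.supp.Nontrivial}) =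
    2 ^ Nat.card {c : G.ConnectedComponent // c.supp.Nontrivial} := by
    rw [Nat.card_eq_fintype_card, Fintype.card_set, Nat.card_eq_fintype_card]
  exact e2

end Involutions

/-! ### The partner maps of two perfect matchings as involutions. -/

section Partner

variable {n : ℕ} {M M₁ : KSubgraph n}

theorem adj_iff_eq_partner (hM : M.IsPerfectMatching) {i j : Fin n} :
    M.Adj i j ↔ j = partner hM i := by
  constructor
  · intro h
    exact (hM.1 (hM.2 i)).unique h (adj_partner hM i)
  · rintro rfl
    exact adj_partner hM i

theorem partner_involutive (hM : M.IsPerfectMatching) : (partner hM).Involutive := fun i =>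
  ((adj_iff_eq_partner hM).1 (adj_partner hM i).symm).symm

theorem card_alternatingSets_partner (hM : M.IsPerfectMatching) (hM₁ : M₁.IsPerfectMatching) :
    (alternatingSets (partner hM) (partner hM₁)).card = 2 ^ numCycles M M₁ := by
  refine card_alternatingSets (partner_involutive hM) (partner_involutive hM₁)
    (fun i => (ne_partner hM i).symm) (fun i => (ne_partner hM₁ i).symm) _ fun a b => ?_
  rw [symmDiff_def, SimpleGraph.sup_adj, SimpleGraph.sdiff_adj, SimpleGraph.sdiff_adj]
  simp only [SimpleGraph.Subgraph.spanningCoe_adj, adj_iff_eq_partner hM, adj_iff_eq_partner hM₁]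
  constructor
  · rintro (⟨rfl, h⟩ | ⟨rfl, h⟩)
    · exact ⟨h, Or.inl rfl⟩
    · exact ⟨Ne.symm h, Or.inr rfl⟩
  · rintro ⟨h, rfl | rfl⟩
    · exact Or.inl ⟨rfl, h⟩
    · exact Or.inr ⟨rfl, h.symm⟩

/-- Every edge of `M` outside `M₁` has exactly one end in `S`, so sending a vertex to its edge in
`M` is a bijection from `S` onto these edges. -/
theorem card_of_mem_alternatingSets (hM : M.IsPerfectMatching) (hM₁ : M₁.IsPerfectMatching)
    {S : Finset (Fin n)} (hS : S ∈ alternatingSets (partner hM) (partner hM₁)) :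
    S.card = (M.edgeSet \ M₁.edgeSet).ncard := by
  have hS' := mem_alternatingSets.1 hS
  have : (M.edgeSet \ M₁.edgeSet) = (fun t => s(t, partner hM t)) '' (S : Set (Fin n)) := by
    ext e
    induction e using Sym2.ind with
    | _ a b =>
      simp only [Set.mem_sdiff, SimpleGraph.Subgraph.mem_edgeSet,
        adj_iff_eq_partner hM, adj_iff_eq_partner hM₁, Set.mem_image, Finset.mem_coe]
      constructor
      · rintro ⟨rfl, h⟩
        have ha : a ∈ moved (partner hM) (partner hM₁) := mem_moved.2 h
        by_cases haS : a ∈ S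
        · exact ⟨a, haS, rfl⟩
        · exact ⟨_, (hS'.2 a ha).1.2 haS, by rw [partner_involutive hM, Sym2.eq_swap]⟩
      · rintro ⟨t, ht, h⟩
        have := mem_moved.1 (hS'.1 ht)
        rcases Sym2.eq_iff.1 h with ⟨rfl, rfl⟩ | ⟨rfl, rfl⟩
        · exact ⟨rfl, this⟩
        · refine ⟨(partner_involutive hM _).symm, fun h => this ?_⟩
          conv_rhs => rw [h]
          rw [partner_involutive hM₁]
  rw [this, Set.InjOn.ncard_image, Set.ncard_coe_finset]
  intro a ha b hb h
  rcases Sym2.eq_iff.1 h with ⟨h, _⟩ | ⟨h, h2⟩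
  · exact h
  · exact absurd ha (by
      have hb' : b ∈ S := hb
      rw [h]
      intro h3
      exact (hS'.2 b (hS'.1 hb')).1.1 h3 hb')

end Partner

/-! ### Tonelli for finite products: reindexing, splitting and factorising. -/

section PiIntegrals

open scoped ENNReal

theorem lintegral_fin_prod_eq_prod {n : ℕ} (μ : Fin n → Measure ℝ) [∀ i, SigmaFinite (μ i)]
    (f : Fin n → ℝ → ℝ≥0∞) (hf : ∀ i, Measurable (f i)) :
    ∫⁻ x, ∏ i, f i (x i) ∂Measure.pi μ = ∏ i, ∫⁻ x, f i x ∂μ i := by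
  induction n with
  | zero => simp
  | succ n ih =>
    rw [← ((measurePreserving_piFinSuccAbove μ 0).symm).lintegral_comp_emb
      (MeasurableEquiv.measurableEmbedding _)]
    simp_rw [MeasurableEquiv.piFinSuccAbove_symm_apply, Fin.insertNthEquiv,
      Fin.prod_univ_succ, Fin.insertNth_zero, Equiv.coe_fn_mk, Fin.cons_succ,
      Fin.zero_succAbove, cast_eq, Fin.cons_zero]
    rw [← ih _ _ fun i => hf i.succ]
    refine lintegral_prod_mul (f := f 0)
      (g := fun x : Fin n → ℝ => ∏ i, f (Fin.succ i) (x i)) (hf 0).aemeasurable ?_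
    exact (Finset.measurable_prod _ fun i _ => (hf i.succ).comp (measurable_pi_apply i)).aemeasurable

variable {α β : Type*} [Fintype α] [Fintype β]

theorem lintegral_pi_equiv (μ : β → Measure ℝ) [∀ i, SigmaFinite (μ i)] (e : α ≃ β)
    (F : (β → ℝ) → ℝ≥0∞) :
    ∫⁻ x, F x ∂Measure.pi μ =
      ∫⁻ x, F (fun b => x (e.symm b)) ∂Measure.pi fun a => μ (e a) := by
  rw [← (measurePreserving_piCongrLeft μ e).lintegral_comp_emb
    (MeasurableEquiv.measurableEmbedding _)]
  refine lintegral_congr fun x => congrArg F ?_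
  funext b
  obtain ⟨a, rfl⟩ := e.surjective b
  rw [MeasurableEquiv.coe_piCongrLeft, Equiv.piCongrLeft_apply_apply, Equiv.symm_apply_apply]

theorem lintegral_pi_sum (μ : α ⊕ β → Measure ℝ) [∀ i, SigmaFinite (μ i)]
    (F : (α ⊕ β → ℝ) → ℝ≥0∞) (hF : Measurable F) :
    ∫⁻ x, F x ∂Measure.pi μ =
      ∫⁻ a, ∫⁻ b, F (Sum.elim a b) ∂(Measure.pi fun j => μ (Sum.inr j))
        ∂(Measure.pi fun i => μ (Sum.inl i)) := by
  have key := (measurePreserving_sumPiEquivProdPi_symm μ).lintegral_comp_emb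
    (MeasurableEquiv.measurableEmbedding _) F
  rw [← key, lintegral_prod]
  · refine lintegral_congr fun a => lintegral_congr fun b => congrArg F ?_
    funext i
    cases i <;> rfl
  · exact (hF.comp (MeasurableEquiv.measurable _)).aemeasurable

theorem lintegral_pi_prod_eq_prod (μ : α → Measure ℝ) [∀ i, SigmaFinite (μ i)]
    (f : α → ℝ → ℝ≥0∞) (hf : ∀ i, Measurable (f i)) :
    ∫⁻ x, ∏ i, f i (x i) ∂Measure.pi μ = ∏ i, ∫⁻ x, f i x ∂μ i := by
  let e := (Fintype.equivFin α).symm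
  rw [lintegral_pi_equiv μ e]
  simp_rw [← e.prod_comp, Equiv.symm_apply_apply]
  exact lintegral_fin_prod_eq_prod _ _ fun i => hf _

theorem lintegral_lintegral_pi_prod_eq_prod (μ ν : α → Measure ℝ) [∀ i, SigmaFinite (μ i)]
    [∀ i, SigmaFinite (ν i)] (f : α → ℝ → ℝ → ℝ≥0∞)
    (hf : ∀ i, Measurable (Function.uncurry (f i))) :
    ∫⁻ x, ∫⁻ y, ∏ i, f i (x i) (y i) ∂Measure.pi ν ∂Measure.pi μ =
      ∏ i, ∫⁻ x, ∫⁻ y, f i x y ∂ν i ∂μ i := by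
  rw [← lintegral_pi_prod_eq_prod μ (fun i x => ∫⁻ y, f i x y ∂ν i)
    fun i => (hf i).lintegral_prod_right']
  refine lintegral_congr fun x => ?_
  exact lintegral_pi_prod_eq_prod ν (fun i y => f i (x i) y) fun i =>
    (hf i).comp (measurable_const.prodMk measurable_id)

end PiIntegrals

/-! ### The uniform law on the unit interval. -/

section Unit

open scoped ENNReal

/-- The uniform law on `[0,1]`. -/
noncomputable def unitLaw : Measure ℝ := (volume : Measure ℝ).restrict (Set.Icc 0 1)

instance : IsProbabilityMeasure unitLaw := ⟨by simp [unitLaw]⟩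

theorem unitLaw_Iic {u : ℝ} (h1 : u ≤ 1) : unitLaw (Set.Iic u) = ENNReal.ofReal u := by
  rw [unitLaw, Measure.restrict_apply measurableSet_Iic]
  have : Set.Iic u ∩ Set.Icc 0 1 = Set.Icc 0 u := by
    ext x; simp only [Set.mem_inter_iff, Set.mem_Iic, Set.mem_Icc]
    constructor
    · rintro ⟨a, b, c⟩; exact ⟨b, a⟩
    · rintro ⟨a, b⟩; exact ⟨b, a, b.trans h1⟩
  rw [this, Real.volume_Icc, sub_zero]

theorem lintegral_unitLaw_corner {u v : ℝ} (hu0 : 0 ≤ u) (hu1 : u ≤ 1)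
    (hv0 : 0 ≤ v) (hv1 : v ≤ 1) :
    ∫⁻ a, ∫⁻ b, {p : ℝ × ℝ | u < p.1 ∨ v < p.2}.indicator 1 (a, b) ∂unitLaw ∂unitLaw =
      ENNReal.ofReal (1 - u * v) := by
  have hm : MeasurableSet {p : ℝ × ℝ | u < p.1 ∨ v < p.2} :=
    (measurableSet_lt measurable_const measurable_fst).union
      (measurableSet_lt measurable_const measurable_snd)
  have h1 : ∫⁻ a, ∫⁻ b, {p : ℝ × ℝ | u < p.1 ∨ v < p.2}.indicator 1 (a, b) ∂unitLaw ∂unitLaw =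
      (unitLaw.prod unitLaw) {p : ℝ × ℝ | u < p.1 ∨ v < p.2} := by
    rw [← lintegral_indicator_one hm, lintegral_prod]
    exact (measurable_one.indicator hm).aemeasurable
  have h2 : {p : ℝ × ℝ | u < p.1 ∨ v < p.2} = (Set.Iic u ×ˢ Set.Iic v)ᶜ := by
    ext p; simp only [Set.mem_ofPred_eq, Set.mem_compl_iff, Set.mem_prod, Set.mem_Iic]
    rw [not_and_or, not_le, not_le]
  rw [h1, h2, prob_compl_eq_one_sub (measurableSet_Iic.prod measurableSet_Iic),
    Measure.prod_prod, unitLaw_Iic hu1, unitLaw_Iic hv1, ← ENNReal.ofReal_mul hu0,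
    ENNReal.ofReal_sub _ (mul_nonneg hu0 hv0), ENNReal.ofReal_one]

end Unit

/-! ### Sorting the preference array and decomposing joint stability. -/

section Representation

open scoped ENNReal

variable {n : ℕ} {M M₁ : KSubgraph n}

/-- The pairs matched by neither of two maps. -/
abbrev FreePair (f g : Fin n → Fin n) : Type :=
  {p : Fin n × Fin n // p.1 < p.2 ∧ f p.1 ≠ p.2 ∧ g p.1 ≠ p.2}

/-- The points at which two maps differ, as a type. -/
abbrev Moved (f g : Fin n → Fin n) : Type := {i : Fin n // i ∈ moved f g}

/-- The indices of the array, sorted into the values of the partners in the first matching, the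
values of the new partners in the second one, and the two orders of the remaining pairs. -/
noncomputable def indexMap (hM : M.IsPerfectMatching) (hM₁ : M₁.IsPerfectMatching) :
    Fin n ⊕ (Moved (partner hM) (partner hM₁) ⊕
      (FreePair (partner hM) (partner hM₁) ⊕ FreePair (partner hM) (partner hM₁))) → OffDiag n
  | .inl i => ⟨(i, partner hM i), ne_partner hM i⟩
  | .inr (.inl t) => ⟨(t.1, partner hM₁ t.1), ne_partner hM₁ t.1⟩
  | .inr (.inr (.inl p)) => ⟨(p.1.1, p.1.2), p.2.1.ne⟩
  | .inr (.inr (.inr p)) => ⟨(p.1.2, p.1.1), p.2.1.ne'⟩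

theorem eq_partner_symm (hM : M.IsPerfectMatching) {i j : Fin n} :
    partner hM i = j ↔ partner hM j = i := by
  constructor
  · rintro rfl; exact partner_involutive hM i
  · rintro rfl; exact partner_involutive hM j

theorem indexMap_bijective (hM : M.IsPerfectMatching) (hM₁ : M₁.IsPerfectMatching) :
    Function.Bijective (indexMap hM hM₁) := by
  constructor
  · rintro (i | t | ⟨⟨p1, p2⟩, hp⟩ | ⟨⟨p1, p2⟩, hp⟩) (j | u | ⟨⟨q1, q2⟩, hq⟩ | ⟨⟨q1, q2⟩, hq⟩) h <;>
    simp only [indexMap, Subtype.mk.injEq, Prod.mk.injEq] at h <;> obtain ⟨h1, h2⟩ := h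
    · rw [h1]
    · exact absurd (h1 ▸ h2) (mem_moved.1 (h1 ▸ u.2))
    · subst h1; exact absurd h2 hq.2.1
    · subst h1; exact absurd ((eq_partner_symm hM).1 h2) hq.2.1
    · exact absurd (h1 ▸ h2.symm) (mem_moved.1 (h1 ▸ t.2))
    · rw [Subtype.ext h1]
    · subst h1; exact absurd h2 hq.2.2
    · subst h1; exact absurd ((eq_partner_symm hM₁).1 h2) hq.2.2
    · subst h1; exact absurd h2.symm hp.2.1
    · rw [h1] at hp; exact absurd h2.symm hp.2.2
    · subst h1 h2; rfl
    · subst h1 h2; exact absurd hp.1 hq.1.not_gt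
    · subst h1; exact absurd ((eq_partner_symm hM).1 h2.symm) hp.2.1
    · rw [h1] at hp; exact absurd ((eq_partner_symm hM₁).1 h2.symm) hp.2.2
    · subst h1 h2; exact absurd hp.1 hq.1.not_gt
    · subst h1 h2; rfl
  · rintro ⟨⟨i, j⟩, hij⟩
    by_cases h1 : partner hM i = j
    · subst h1; exact ⟨.inl i, rfl⟩
    by_cases h2 : partner hM₁ i = j
    · subst h2; exact ⟨.inr (.inl ⟨i, mem_moved.2 h1⟩), rfl⟩
    rcases lt_or_gt_of_ne (show i ≠ j from hij) with h | h
    · exact ⟨.inr (.inr (.inl ⟨(i, j), h, h1, h2⟩)), rfl⟩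
    · exact ⟨.inr (.inr (.inr ⟨(j, i), h, fun h' => h1 ((eq_partner_symm hM).1 h'),
        fun h' => h2 ((eq_partner_symm hM₁).1 h')⟩)), rfl⟩

/-- The values of the partners in the second matching, from those in the first matching and the
new ones. -/
noncomputable def extend {f g : Fin n → Fin n} (x : Fin n → ℝ) (y : Moved f g → ℝ) (i : Fin n) :
    ℝ :=
  if h : i ∈ moved f g then y ⟨i, h⟩ else x i

/-- On each edge of the symmetric difference some end prefers its partner in the other matching. -/
def Oriented (f g : Fin n → Fin n) (x Y : Fin n → ℝ) : Prop :=
  ∀ t ∈ moved f g, (Y t < x t ∨ Y (f t) < x (f t)) ∧ (x t < Y t ∨ x (g t) < Y (g t))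

/-- An edge of one matching can only block the other one, and a common edge blocks neither. The
edges of the symmetric difference therefore constrain only the partner values, and the fresh array
entries enter only through pairs matched by neither. -/
theorem mem_stableEvent_inter_iff (hM : M.IsPerfectMatching) (hM₁ : M₁.IsPerfectMatching)
    (X : OffDiag n → ℝ) :
    X ∈ stableEvent hM₁ ∩ stableEvent hM ↔
      Oriented (partner hM) (partner hM₁) (partnerValue hM X) (partnerValue hM₁ X) ∧
      ∀ p : FreePair (partner hM) (partner hM₁),
        (partnerValue hM X p.1.1 < X ⟨(p.1.1, p.1.2), p.2.1.ne⟩ ∨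
          partnerValue hM X p.1.2 < X ⟨(p.1.2, p.1.1), p.2.1.ne'⟩) ∧
        (partnerValue hM₁ X p.1.1 < X ⟨(p.1.1, p.1.2), p.2.1.ne⟩ ∨
          partnerValue hM₁ X p.1.2 < X ⟨(p.1.2, p.1.1), p.2.1.ne'⟩) := by
  have val : ∀ (N : KSubgraph n) (hN : N.IsPerfectMatching) (i j : Fin n) (hij : i ≠ j),
      partner hN i = j → X ⟨(i, j), hij⟩ = partnerValue hN X i := by
    rintro N hN i j hij rfl; rfl
  constructor
  · rintro ⟨h1, h0⟩
    refine ⟨fun t ht => ⟨?_, ?_⟩, fun p => ⟨?_, ?_⟩⟩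
    · have := h1 t (partner hM t) (ne_partner hM t) (fun h =>
        mem_moved.1 ht ((adj_iff_eq_partner hM₁).1 h))
      rwa [val M hM _ _ _ rfl, val M hM _ _ _ (partner_involutive hM t)] at this
    · have := h0 t (partner hM₁ t) (ne_partner hM₁ t) (fun h =>
        mem_moved.1 ht ((adj_iff_eq_partner hM).1 h).symm)
      rwa [val M₁ hM₁ _ _ _ rfl, val M₁ hM₁ _ _ _ (partner_involutive hM₁ t)] at this
    · exact h0 _ _ p.2.1.ne fun h => p.2.2.1 ((adj_iff_eq_partner hM).1 h).symm
    · exact h1 _ _ p.2.1.ne fun h => p.2.2.2 ((adj_iff_eq_partner hM₁).1 h).symm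
  · rintro ⟨hO, hP⟩
    constructor
    · intro i j hij hadj
      rw [adj_iff_eq_partner hM₁] at hadj
      by_cases h : partner hM i = j
      · have hi : i ∈ moved (partner hM) (partner hM₁) := mem_moved.2 fun h' => hadj (h ▸ h')
        have := (hO i hi).1
        rwa [val M hM i j hij h, val M hM j i hij.symm ((eq_partner_symm hM).1 h), ← h]
      · rcases lt_or_gt_of_ne hij with hlt | hlt
        · exact (hP ⟨(i, j), hlt, h, Ne.symm hadj⟩).2
        · exact ((hP ⟨(j, i), hlt, fun h' => h ((eq_partner_symm hM).1 h'),
            fun h' => hadj ((eq_partner_symm hM₁).1 h').symm⟩).2).symm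
    · intro i j hij hadj
      rw [adj_iff_eq_partner hM] at hadj
      by_cases h : partner hM₁ i = j
      · have hi : i ∈ moved (partner hM) (partner hM₁) :=
          mem_moved.2 fun h' => hadj (h'.trans h).symm
        have := (hO i hi).2
        rwa [val M₁ hM₁ i j hij h, val M₁ hM₁ j i hij.symm ((eq_partner_symm hM₁).1 h), ← h]
      · rcases lt_or_gt_of_ne hij with hlt | hlt
        · exact (hP ⟨(i, j), hlt, Ne.symm hadj, h⟩).1
        · exact ((hP ⟨(j, i), hlt, fun h' => hadj ((eq_partner_symm hM).1 h').symm,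
            fun h' => h ((eq_partner_symm hM₁).1 h')⟩).1).symm

/-- The orientation of the symmetric difference in which exactly the elements of `S` prefer their
partner in the second matching. -/
noncomputable def patternWeight (f g : Fin n → Fin n) (S : Finset (Fin n)) (x : Fin n → ℝ)
    (t : Moved f g) (y : ℝ) : ℝ≥0∞ :=
  if t.1 ∈ S then (Set.Iio (x t)).indicator 1 y else (Set.Ioi (x t)).indicator 1 y

open Classical in
-- The sum has at most one nonzero term, since `S` must be the set where `Y < x`. That this set
-- alternates, with the strict reverse inequality elsewhere on the moved points, is the counting of
-- `mem_alternatingSets_of_covers`. Ties need no almost-sure argument because the counting excludes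
-- them.
theorem indicator_oriented (f g : Fin n → Fin n) (hf : f.Involutive) (hg : g.Involutive)
    (x : Fin n → ℝ) (y : Moved f g → ℝ) :
    (if Oriented f g x (extend x y) then (1 : ℝ≥0∞) else 0) =
      ∑ S ∈ alternatingSets f g, ∏ t : Moved f g, patternWeight f g S x t (y t) := by
  set Y := extend x y with hY
  have hYt : ∀ t : Moved f g, Y t = y t := fun t => by simp [hY, extend, t.2]
  have hw : ∀ S : Finset (Fin n), ∏ t : Moved f g, patternWeight f g S x t (y t) =
      if ∀ t ∈ moved f g, (t ∈ S → Y t < x t) ∧ (t ∉ S → x t < Y t) then 1 else 0 := by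
    intro S
    split_ifs with h
    · refine Finset.prod_eq_one fun t _ => ?_
      have := h t t.2
      rw [hYt] at this
      unfold patternWeight
      split_ifs with hS
      · simp [this.1 hS]
      · simp [this.2 hS]
    · push Not at h
      obtain ⟨t, ht, h⟩ := h
      refine Finset.prod_eq_zero (Finset.mem_univ ⟨t, ht⟩) ?_
      have e := hYt ⟨t, ht⟩
      unfold patternWeight
      by_cases hS : t ∈ S
      · have : ¬ Y t < x t := fun h' => by
          obtain ⟨h1, _⟩ := h fun _ => h'
          exact h1 hS
        simp only [hS, if_true]
        rw [Set.indicator_of_notMem]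
        rw [← e]; exact this
      · obtain ⟨_, h2⟩ := h fun h' => absurd h' hS
        simp only [hS, if_false]
        rw [Set.indicator_of_notMem]
        rw [← e]; exact not_lt.2 h2
  simp_rw [hw]
  by_cases hO : Oriented f g x Y
  · rw [if_pos hO]
    set A := (moved f g).filter fun t => Y t < x t with hA
    set B := (moved f g).filter fun t => x t < Y t with hB
    obtain ⟨hAalt, hBA⟩ := mem_alternatingSets_of_covers hf hg (A := A) (B := B)
      (Finset.filter_subset _ _) (Finset.filter_subset _ _)
      (Finset.disjoint_left.2 fun t h1 h2 =>
        (Finset.mem_filter.1 h1).2.not_gt (Finset.mem_filter.1 h2).2)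
      (fun t ht => by
        have := (hO t ht).1
        simpa [hA, ht, left_mem_moved hf hg ht] using this)
      (fun t ht => by
        have := (hO t ht).2
        simpa [hB, ht, right_mem_moved hf hg ht] using this)
    rw [Finset.sum_eq_single_of_mem A hAalt, if_pos]
    · intro t ht
      refine ⟨fun h => (Finset.mem_filter.1 h).2, fun h => ?_⟩
      have : t ∈ B := by rw [hBA]; exact Finset.mem_sdiff.2 ⟨ht, h⟩
      exact (Finset.mem_filter.1 this).2
    · intro S hS hne
      rw [if_neg]
      intro h
      apply hne
      ext t
      have hSub := (mem_alternatingSets.1 hS).1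
      constructor
      · intro ht; exact Finset.mem_filter.2 ⟨hSub ht, (h t (hSub ht)).1 ht⟩
      · intro ht
        by_contra h'
        exact ((h t (Finset.mem_filter.1 ht).1).2 h').not_gt (Finset.mem_filter.1 ht).2
  · rw [if_neg hO]
    symm
    refine Finset.sum_eq_zero fun S hS => if_neg fun h => hO ?_
    have hS' := mem_alternatingSets.1 hS
    intro t ht
    have h1 := left_mem_moved hf hg ht
    have h2 := right_mem_moved hf hg ht
    by_cases htS : t ∈ S
    · exact ⟨Or.inl ((h t ht).1 htS), Or.inr ((h _ h2).2 fun h' => (hS'.2 t ht).2.1 h' htS)⟩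
    · exact ⟨Or.inr ((h _ h1).1 ((hS'.2 t ht).1.2 htS)), Or.inl ((h t ht).2 htS)⟩

end Representation

/-! ### The integral formula for the probability that both matchings are stable. -/

section StableIntersection

open scoped ENNReal

variable {n : ℕ} {M M₁ : KSubgraph n}

/-- The probability that a pair with uniform mutual values blocks neither of two matchings in which
its members have the given values. -/
noncomputable def freeProb (u v u' v' : ℝ) : ℝ≥0∞ :=
  ∫⁻ a, ∫⁻ b, {q : ℝ × ℝ | (u < q.1 ∨ v < q.2) ∧ (u' < q.1 ∨ v' < q.2)}.indicator 1 (a, b)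
    ∂unitLaw ∂unitLaw

theorem measurableSet_corner (u v : ℝ) : MeasurableSet {q : ℝ × ℝ | u < q.1 ∨ v < q.2} :=
  (measurableSet_lt measurable_const measurable_fst).union
    (measurableSet_lt measurable_const measurable_snd)

/-- The two corner rectangles to be avoided have a union at least as large as the bigger one. -/
theorem freeProb_le {u v u' v' : ℝ} (hu : u ∈ Set.Icc (0 : ℝ) 1) (hv : v ∈ Set.Icc (0 : ℝ) 1)
    (hu' : u' ∈ Set.Icc (0 : ℝ) 1) (hv' : v' ∈ Set.Icc (0 : ℝ) 1) :
    freeProb u v u' v' ≤ ENNReal.ofReal (1 - max (u * v) (u' * v')) := by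
  rcases max_choice (u * v) (u' * v') with h | h <;> rw [h]
  · rw [← lintegral_unitLaw_corner hu.1 hu.2 hv.1 hv.2]
    exact lintegral_mono fun a => lintegral_mono fun b =>
      Set.indicator_le_indicator_of_subset (fun q hq => hq.1) (fun _ => zero_le) _
  · rw [← lintegral_unitLaw_corner hu'.1 hu'.2 hv'.1 hv'.2]
    exact lintegral_mono fun a => lintegral_mono fun b =>
      Set.indicator_le_indicator_of_subset (fun q hq => hq.2) (fun _ => zero_le) _

/-- Both corner rectangles lie inside the one whose sides are the maxima. -/
theorem le_freeProb {u v u' v' : ℝ} (hu : u ∈ Set.Icc (0 : ℝ) 1) (hv : v ∈ Set.Icc (0 : ℝ) 1)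
    (hu' : u' ∈ Set.Icc (0 : ℝ) 1) (hv' : v' ∈ Set.Icc (0 : ℝ) 1) :
    ENNReal.ofReal (1 - max u u' * max v v') ≤ freeProb u v u' v' := by
  rw [← lintegral_unitLaw_corner (le_max_of_le_left hu.1) (max_le hu.2 hu'.2)
    (le_max_of_le_left hv.1) (max_le hv.2 hv'.2)]
  refine lintegral_mono fun a => lintegral_mono fun b =>
      Set.indicator_le_indicator_of_subset (fun q hq => ?_) (fun _ => zero_le) _
  rcases hq with h | h
  · exact ⟨Or.inl ((le_max_left _ _).trans_lt h), Or.inl ((le_max_right _ _).trans_lt h)⟩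
  · exact ⟨Or.inr ((le_max_left _ _).trans_lt h), Or.inr ((le_max_right _ _).trans_lt h)⟩

theorem measurable_partnerValue (hM : M.IsPerfectMatching) (i : Fin n) :
    Measurable fun X => partnerValue hM X i := measurable_pi_apply _

theorem measurableSet_stableEvent (hM : M.IsPerfectMatching) : MeasurableSet (stableEvent hM) := by
  have : stableEvent hM = ⋂ (i : Fin n) (j : Fin n) (hij : i ≠ j) (_ : ¬ M.Adj i j),
      ({X | partnerValue hM X i < X ⟨(i, j), hij⟩} ∪
        {X | partnerValue hM X j < X ⟨(j, i), hij.symm⟩}) := by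
    ext X; simp [stableEvent]
  rw [this]
  refine MeasurableSet.iInter fun i => MeasurableSet.iInter fun j => MeasurableSet.iInter fun hij =>
    MeasurableSet.iInter fun _ => ?_
  exact (measurableSet_lt (measurable_partnerValue hM i) (measurable_pi_apply _)).union
    (measurableSet_lt (measurable_partnerValue hM j) (measurable_pi_apply _))

theorem measurable_patternWeight (f g : Fin n → Fin n) (S : Finset (Fin n)) (x : Fin n → ℝ)
    (t : Moved f g) : Measurable (patternWeight f g S x t) := by
  unfold patternWeight
  split_ifs
  · exact measurable_one.indicator measurableSet_Iio
  · exact measurable_one.indicator measurableSet_Ioi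

open Classical in
-- Given `x` and `y`, the two mutual values of each free pair are fresh and independent over pairs,
-- so their conditions integrate to a product of `freeProb`. The set `B` is arbitrary because the
-- formula is used both on the quasirandom set and, with `M₁ = M`, on its complement.
theorem prefLaw_stable_inter (hM : M.IsPerfectMatching) (hM₁ : M₁.IsPerfectMatching)
    {B : Set (Fin n → ℝ)} (hB : MeasurableSet B) :
    prefLaw n (stableEvent hM₁ ∩ stableEvent hM ∩ {X | partnerValue hM X ∈ B}) =
      ∫⁻ x in B, ∫⁻ y, (∑ S ∈ alternatingSets (partner hM) (partner hM₁),
        ∏ t, patternWeight (partner hM) (partner hM₁) S x t (y t)) *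
        ∏ p : FreePair (partner hM) (partner hM₁),
          freeProb (x p.1.1) (x p.1.2) (extend x y p.1.1) (extend x y p.1.2)
        ∂(Measure.pi fun _ => unitLaw) ∂(Measure.pi fun _ => unitLaw) := by
  set f := partner hM with hf
  set g := partner hM₁ with hg
  set E := stableEvent hM₁ ∩ stableEvent hM ∩ {X | partnerValue hM X ∈ B} with hE
  have hBm : MeasurableSet {X : OffDiag n → ℝ | partnerValue hM X ∈ B} :=
    (measurable_pi_lambda _ (measurable_partnerValue hM)) hB
  have hEm : MeasurableSet E :=
    ((measurableSet_stableEvent hM₁).inter (measurableSet_stableEvent hM)).inter hBm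
  let e := Equiv.ofBijective _ (indexMap_bijective hM hM₁)
  have he : ∀ (j : Fin n ⊕ (Moved f g ⊕ (FreePair f g ⊕ FreePair f g))) (w : _ → ℝ),
      (fun b => w (e.symm b) : OffDiag n → ℝ) (indexMap hM hM₁ j) = w j := by
    intro j w
    change w (e.symm (e j)) = w j
    rw [e.symm_apply_apply]
  have hme : Measurable fun (w : _ → ℝ) (b : OffDiag n) => w (e.symm b) :=
    measurable_pi_lambda _ fun b => measurable_pi_apply _
  have hF : Measurable (E.indicator (1 : (OffDiag n → ℝ) → ℝ≥0∞)) := measurable_one.indicator hEm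
  have hF1 := hF.comp hme
  have h0 : prefLaw n E = ∫⁻ X, E.indicator 1 X ∂Measure.pi fun _ => unitLaw := by
    rw [lintegral_indicator_one hEm]; rfl
  rw [h0, lintegral_pi_equiv _ e, ← lintegral_indicator hB]
  refine (lintegral_pi_sum (fun _ => unitLaw) _ hF1).trans ?_
  refine lintegral_congr fun x => ?_
  have hs : ∀ x : Fin n → ℝ, Measurable fun w : (Moved f g ⊕ (FreePair f g ⊕ FreePair f g)) → ℝ =>
      (Sum.elim x w : _ → ℝ) := fun x => by
    refine measurable_pi_lambda _ fun j => ?_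
    cases j
    · exact measurable_const
    · exact measurable_pi_apply _
  by_cases hx : x ∈ B
  swap
  · rw [Set.indicator_of_notMem hx]
    refine (lintegral_congr (g := fun _ => 0) fun w => ?_).trans lintegral_zero
    change E.indicator 1 (fun b => (Sum.elim x w : _ → ℝ) (e.symm b)) = 0
    rw [Set.indicator_of_notMem]
    intro h
    apply hx
    have h2 := h.2
    have : partnerValue hM (fun b => (Sum.elim x w : _ → ℝ) (e.symm b)) = x := by
      funext i
      exact he (.inl i) _
    change partnerValue hM (fun b => (Sum.elim x w : _ → ℝ) (e.symm b)) ∈ B at h2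
    rwa [this] at h2
  refine (lintegral_pi_sum (fun _ => unitLaw) _ (hF1.comp (hs x))).trans ?_
  rw [Set.indicator_of_mem hx]
  refine lintegral_congr fun y => ?_
  have hs2 : Measurable fun w : (FreePair f g ⊕ FreePair f g) → ℝ =>
      (Sum.elim y w : _ → ℝ) := by
    refine measurable_pi_lambda _ fun j => ?_
    cases j
    · exact measurable_const
    · exact measurable_pi_apply _
  refine (lintegral_pi_sum (fun _ => unitLaw) _ ((hF1.comp (hs x)).comp hs2)).trans ?_
  have hind : ∀ (a b : FreePair f g → ℝ),
      E.indicator (1 : (OffDiag n → ℝ) → ℝ≥0∞)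
        (fun c => (Sum.elim x (Sum.elim y (Sum.elim a b)) : _ → ℝ) (e.symm c)) =
      (if Oriented f g x (extend x y) then (1 : ℝ≥0∞) else 0) *
        ∏ p : FreePair f g, {q : ℝ × ℝ | (x p.1.1 < q.1 ∨ x p.1.2 < q.2) ∧
          (extend x y p.1.1 < q.1 ∨ extend x y p.1.2 < q.2)}.indicator 1 (a p, b p) := by
    intro a b
    set X : OffDiag n → ℝ :=
      fun c => (Sum.elim x (Sum.elim y (Sum.elim a b)) : _ → ℝ) (e.symm c) with hX
    have e1 : partnerValue hM X = x := by funext i; exact he (.inl i) _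
    have e2 : partnerValue hM₁ X = extend x y := by
      funext i
      unfold extend
      split_ifs with h
      · exact he (.inr (.inl ⟨i, h⟩)) _
      · have hi : f i = g i := by by_contra h'; exact h (mem_moved.2 h')
        have : partnerValue hM₁ X i = partnerValue hM X i := by
          unfold partnerValue
          congr 3
          exact hi.symm
        rw [this, e1]
    have e3 : ∀ p : FreePair f g, X ⟨(p.1.1, p.1.2), p.2.1.ne⟩ = a p := fun p =>
      he (.inr (.inr (.inl p))) _
    have e4 : ∀ p : FreePair f g, X ⟨(p.1.2, p.1.1), p.2.1.ne'⟩ = b p := fun p =>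
      he (.inr (.inr (.inr p))) _
    have hiff := mem_stableEvent_inter_iff hM hM₁ X
    rw [e1, e2] at hiff
    have hmem : X ∈ E ↔ Oriented f g x (extend x y) ∧ ∀ p : FreePair f g,
        (x p.1.1 < a p ∨ x p.1.2 < b p) ∧ (extend x y p.1.1 < a p ∨ extend x y p.1.2 < b p) := by
      rw [hE, Set.mem_inter_iff, hiff]
      have : X ∈ {X | partnerValue hM X ∈ B} := by
        change partnerValue hM X ∈ B; rwa [e1]
      simp only [this, and_true]
      refine and_congr_right fun _ => forall_congr' fun p => ?_
      rw [e3, e4]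
    by_cases hO : Oriented f g x (extend x y)
    · rw [if_pos hO, one_mul]
      by_cases hp : ∀ p : FreePair f g,
        (x p.1.1 < a p ∨ x p.1.2 < b p) ∧ (extend x y p.1.1 < a p ∨ extend x y p.1.2 < b p)
      · rw [Set.indicator_of_mem (hmem.2 ⟨hO, hp⟩)]
        symm
        refine Finset.prod_eq_one fun p _ => ?_
        rw [Set.indicator_of_mem]
        · rfl
        · exact hp p
      · rw [Set.indicator_of_notMem fun h => hp (hmem.1 h).2]
        obtain ⟨p, hp⟩ := not_forall.1 hp
        symm
        refine Finset.prod_eq_zero (Finset.mem_univ p) ?_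
        rw [Set.indicator_of_notMem]
        exact hp
    · rw [if_neg hO, zero_mul, Set.indicator_of_notMem fun h => hO (hmem.1 h).1]
  have hcm : ∀ p : FreePair f g, MeasurableSet {q : ℝ × ℝ | (x p.1.1 < q.1 ∨ x p.1.2 < q.2) ∧
          (extend x y p.1.1 < q.1 ∨ extend x y p.1.2 < q.2)} := fun p =>
    (measurableSet_corner _ _).inter (measurableSet_corner _ _)
  have hpm : Measurable fun q : (FreePair f g → ℝ) × (FreePair f g → ℝ) =>
      ∏ p : FreePair f g, {q : ℝ × ℝ | (x p.1.1 < q.1 ∨ x p.1.2 < q.2) ∧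
          (extend x y p.1.1 < q.1 ∨ extend x y p.1.2 < q.2)}.indicator (1 : ℝ × ℝ → ℝ≥0∞)
          (q.1 p, q.2 p) := by
    refine Finset.measurable_prod _ fun p _ => ?_
    refine (measurable_one.indicator (hcm p)).comp ?_
    exact ((measurable_pi_apply p).comp measurable_fst).prodMk
      ((measurable_pi_apply p).comp measurable_snd)
  refine (lintegral_congr fun a => lintegral_congr fun b => hind a b).trans ?_
  rw [← indicator_oriented f g (partner_involutive hM) (partner_involutive hM₁)]
  have hin : ∀ a : FreePair f g → ℝ, Measurable fun b : FreePair f g → ℝ =>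
      ∏ p : FreePair f g, {q : ℝ × ℝ | (x p.1.1 < q.1 ∨ x p.1.2 < q.2) ∧
          (extend x y p.1.1 < q.1 ∨ extend x y p.1.2 < q.2)}.indicator (1 : ℝ × ℝ → ℝ≥0∞)
          (a p, b p) := fun a => hpm.comp (measurable_const.prodMk measurable_id)
  simp_rw [lintegral_const_mul _ (hin _)]
  rw [lintegral_const_mul _ hpm.lintegral_prod_right']
  congr 1
  exact lintegral_lintegral_pi_prod_eq_prod (fun _ => unitLaw) (fun _ => unitLaw)
    (fun (p : FreePair f g) a b => {q : ℝ × ℝ | (x p.1.1 < q.1 ∨ x p.1.2 < q.2) ∧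
          (extend x y p.1.1 < q.1 ∨ extend x y p.1.2 < q.2)}.indicator 1 (a, b))
    (fun p => measurable_one.indicator (hcm p))

end StableIntersection

/-! ### Dirichlet's integral on the positive orthant. -/

section HalfLine

open scoped ENNReal Nat

/-- Lebesgue measure on the nonnegative half-line. -/
noncomputable def halfLine : Measure ℝ := (volume : Measure ℝ).restrict (Set.Ici 0)

instance : SigmaFinite halfLine := by unfold halfLine; infer_instance

theorem ae_halfLine_nonneg : ∀ᵐ x ∂halfLine, 0 ≤ x :=
  ae_restrict_mem measurableSet_Ici

theorem ae_halfLine_pos : ∀ᵐ x ∂halfLine, 0 < x := by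
  have h : halfLine = (volume : Measure ℝ).restrict (Set.Ioi 0) :=
    Measure.restrict_congr_set Ioi_ae_eq_Ici.symm
  rw [h]
  exact ae_restrict_mem measurableSet_Ioi

theorem integral_halfLine_pow_mul_exp (m : ℕ) {b : ℝ} (hb : 0 < b) :
    ∫ x, x ^ m * Real.exp (-(b * x)) ∂halfLine = m ! / b ^ (m + 1) := by
  have h := Real.integral_rpow_mul_exp_neg_mul_Ioi (a := (m : ℝ) + 1) (by positivity) hb
  rw [Real.Gamma_nat_eq_factorial] at h
  have e : ((m : ℝ) + 1) = ((m + 1 : ℕ) : ℝ) := by push_cast; ring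
  rw [halfLine, integral_Ici_eq_integral_Ioi]
  simp only [add_sub_cancel_right, Real.rpow_natCast] at h
  rw [h, e, Real.rpow_natCast, div_pow, one_pow]
  ring

theorem integrable_halfLine_pow_mul_exp (m : ℕ) {b : ℝ} (hb : 0 < b) :
    Integrable (fun x => x ^ m * Real.exp (-(b * x))) halfLine := by
  -- A non-integrable function has Bochner integral 0, which contradicts the positive value just
  -- computed.
  by_contra h
  have := integral_halfLine_pow_mul_exp m hb
  rw [integral_undef h] at this
  have h2 : (0 : ℝ) < m ! / b ^ (m + 1) := by positivity
  exact h2.ne this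

theorem lintegral_halfLine_pow_mul_exp (m : ℕ) {b : ℝ} (hb : 0 < b) :
    ∫⁻ x, ENNReal.ofReal (x ^ m * Real.exp (-(b * x))) ∂halfLine =
      ENNReal.ofReal (m ! / b ^ (m + 1)) := by
  rw [← integral_halfLine_pow_mul_exp m hb, ofReal_integral_eq_lintegral_ofReal
    (integrable_halfLine_pow_mul_exp m hb)]
  filter_upwards [ae_halfLine_nonneg] with x hx
  change 0 ≤ _
  positivity

/-- The Beta integral. Only `j ≤ 1` is needed, since the weights are multilinear in the `x i`; then
`j ! = 1` and no such factor appears. -/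
theorem intervalIntegral_pow_mul_sub_pow (j m : ℕ) (hj : j ≤ 1) (u : ℝ) :
    ∫ x in (0 : ℝ)..u, x ^ j * (u - x) ^ m = m ! / (m + j + 1)! * u ^ (m + j + 1) := by
  have h1 : ∫ x in (0 : ℝ)..u, x ^ j * (u - x) ^ m = ∫ x in (0 : ℝ)..u, (u - x) ^ j * x ^ m := by
    have := intervalIntegral.integral_comp_sub_left (a := 0) (b := u)
      (fun x => (u - x) ^ j * x ^ m) u
    simpa using this
  rw [h1]
  interval_cases j
  · simp only [pow_zero, one_mul, integral_pow, add_zero, Nat.factorial_succ]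
    push_cast
    have : (m ! : ℝ) ≠ 0 := by positivity
    field_simp
    simp
  · have : ∀ x : ℝ, (u - x) ^ 1 * x ^ m = u * x ^ m - x ^ (m + 1) := fun x => by ring
    simp_rw [this]
    rw [intervalIntegral.integral_sub
      (by apply Continuous.intervalIntegrable; fun_prop)
      (by apply Continuous.intervalIntegrable; fun_prop),
      intervalIntegral.integral_const_mul, integral_pow, integral_pow]
    rw [Nat.factorial_succ, Nat.factorial_succ]
    have : (m ! : ℝ) ≠ 0 := by positivity
    push_cast
    field_simp
    simp
    ring

/-- Substitute `u = x + s` and exchange the order of integration: the inner integral over `0 ≤ x ≤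
u` is the Beta integral. This is the induction step of Dirichlet's formula. -/
theorem lintegral_halfLine_pow_mul_shift (j m : ℕ) (hj : j ≤ 1) {F : ℝ → ℝ≥0∞}
    (hF : Measurable F) :
    ∫⁻ x, ENNReal.ofReal (x ^ j) * ∫⁻ s, ENNReal.ofReal (s ^ m) * F (x + s) ∂halfLine ∂halfLine =
      ENNReal.ofReal (m ! / (m + j + 1)!) *
        ∫⁻ u, ENNReal.ofReal (u ^ (m + j + 1)) * F u ∂halfLine := by
  have hshift : ∀ x : ℝ, ∫⁻ s, ENNReal.ofReal (s ^ m) * F (x + s) ∂halfLine =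
      ∫⁻ u, (Set.Ici x).indicator (fun u => ENNReal.ofReal ((u - x) ^ m) * F u) u := by
    intro x
    rw [halfLine, ← lintegral_indicator measurableSet_Ici,
      ← lintegral_add_left_eq_self
        (fun u => (Set.Ici x).indicator (fun u => ENNReal.ofReal ((u - x) ^ m) * F u) u) x]
    refine lintegral_congr fun s => ?_
    by_cases hs : 0 ≤ s
    · rw [Set.indicator_of_mem (show s ∈ Set.Ici 0 from hs),
        Set.indicator_of_mem (show x + s ∈ Set.Ici x by simpa using hs)]
      simp
    · rw [Set.indicator_of_notMem (show s ∉ Set.Ici 0 from hs),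
        Set.indicator_of_notMem (show x + s ∉ Set.Ici x by simpa using hs)]
  simp_rw [hshift]
  set Φ : ℝ → ℝ → ℝ≥0∞ := fun x u =>
    ({p : ℝ × ℝ | 0 ≤ p.1 ∧ p.1 ≤ p.2}.indicator
      (fun p => ENNReal.ofReal (p.1 ^ j * (p.2 - p.1) ^ m) * F p.2)) (x, u) with hΦ
  have hΦm : Measurable (Function.uncurry Φ) := by
    refine Measurable.indicator ?_ ?_
    · refine Measurable.mul ?_ (hF.comp measurable_snd)
      exact ENNReal.measurable_ofReal.comp (by fun_prop)
    · exact (measurableSet_le measurable_const measurable_fst).inter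
        (measurableSet_le measurable_fst measurable_snd)
  have hL : ∫⁻ x, ENNReal.ofReal (x ^ j) * (∫⁻ u, (Set.Ici x).indicator
      (fun u => ENNReal.ofReal ((u - x) ^ m) * F u) u) ∂halfLine = ∫⁻ x, ∫⁻ u, Φ x u := by
    rw [halfLine, ← lintegral_indicator measurableSet_Ici]
    refine lintegral_congr fun x => ?_
    by_cases hx : 0 ≤ x
    · rw [Set.indicator_of_mem (show x ∈ Set.Ici 0 from hx), ← lintegral_const_mul']
      · refine lintegral_congr fun u => ?_
        by_cases hu : x ≤ u
        · rw [Set.indicator_of_mem (show u ∈ Set.Ici x from hu), hΦ]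
          simp only
          rw [Set.indicator_of_mem (show (x, u) ∈ {p : ℝ × ℝ | 0 ≤ p.1 ∧ p.1 ≤ p.2} from ⟨hx, hu⟩),
            ENNReal.ofReal_mul (by positivity), mul_assoc]
        · rw [Set.indicator_of_notMem (show u ∉ Set.Ici x from hu), hΦ]
          simp only
          rw [Set.indicator_of_notMem, mul_zero]
          exact fun h => hu h.2
      · exact ENNReal.ofReal_ne_top
    · rw [Set.indicator_of_notMem (show x ∉ Set.Ici 0 from hx)]
      symm
      refine (lintegral_congr (g := fun _ => 0) fun u => ?_).trans lintegral_zero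
      rw [hΦ]
      exact Set.indicator_of_notMem (fun h => hx h.1) _
  rw [hL, lintegral_lintegral_swap hΦm.aemeasurable, ← lintegral_const_mul' _ _
    ENNReal.ofReal_ne_top, halfLine, ← lintegral_indicator measurableSet_Ici]
  refine lintegral_congr fun u => ?_
  by_cases hu : 0 ≤ u
  · rw [Set.indicator_of_mem (show u ∈ Set.Ici 0 from hu)]
    have h1 : ∀ x, Φ x u = (Set.Icc 0 u).indicator
        (fun x => ENNReal.ofReal (x ^ j * (u - x) ^ m)) x * F u := by
      intro x
      by_cases hx : x ∈ Set.Icc 0 u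
      · rw [Set.indicator_of_mem hx, hΦ]
        exact Set.indicator_of_mem (show (x, u) ∈ {p : ℝ × ℝ | 0 ≤ p.1 ∧ p.1 ≤ p.2} from hx) _
      · rw [Set.indicator_of_notMem hx, hΦ, zero_mul]
        exact Set.indicator_of_notMem
          (show (x, u) ∉ {p : ℝ × ℝ | 0 ≤ p.1 ∧ p.1 ≤ p.2} from hx) _
    simp_rw [h1]
    have hm : Measurable fun x : ℝ => ENNReal.ofReal (x ^ j * (u - x) ^ m) := by fun_prop
    rw [lintegral_mul_const _ (hm.indicator measurableSet_Icc),
      lintegral_indicator measurableSet_Icc, ← ofReal_integral_eq_lintegral_ofReal,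
      integral_Icc_eq_integral_Ioc, ← intervalIntegral.integral_of_le hu,
      intervalIntegral_pow_mul_sub_pow j m hj, ENNReal.ofReal_mul (by positivity), mul_assoc]
    · exact (Continuous.integrableOn_Icc (by fun_prop))
    · filter_upwards [ae_restrict_mem measurableSet_Icc] with x hx
      exact mul_nonneg (pow_nonneg hx.1 _) (pow_nonneg (sub_nonneg.2 hx.2) _)
  · rw [Set.indicator_of_notMem (show u ∉ Set.Ici 0 from hu)]
    refine (lintegral_congr (g := fun _ => 0) fun x => ?_).trans lintegral_zero
    rw [hΦ]
    exact Set.indicator_of_notMem (fun h => hu (h.1.trans h.2)) _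

theorem lintegral_pi_pow_mul_comp_sum (n : ℕ) (j : Fin (n + 1) → ℕ) (hj : ∀ i, j i ≤ 1)
    {F : ℝ → ℝ≥0∞} (hF : Measurable F) :
    ∫⁻ x, (∏ i, ENNReal.ofReal (x i ^ j i)) * F (∑ i, x i) ∂(Measure.pi fun _ => halfLine) =
      ENNReal.ofReal (1 / (n + ∑ i, j i)!) *
        ∫⁻ u, ENNReal.ofReal (u ^ (n + ∑ i, j i)) * F u ∂halfLine := by
  induction n generalizing F with
  | zero =>
    rw [← ((measurePreserving_piFinSuccAbove (fun _ : Fin 1 => halfLine) 0).symm).lintegral_comp_emb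
      (MeasurableEquiv.measurableEmbedding _), lintegral_prod]
    · rw [Measure.pi_of_empty (x := fun i : Fin 0 => i.elim0)]
      simp only [lintegral_dirac, MeasurableEquiv.piFinSuccAbove_symm_apply, Fin.insertNthEquiv,
        Fin.insertNth_zero, Equiv.coe_fn_mk, Fin.prod_univ_succ, Fin.sum_univ_succ, Fin.cons_zero]
      have : (j 0)! = 1 := Nat.factorial_eq_one.2 (hj 0)
      simp [this]
    · refine Measurable.aemeasurable ?_
      refine Measurable.comp (g := fun x : Fin 1 → ℝ =>
        (∏ i, ENNReal.ofReal (x i ^ j i)) * F (∑ i, x i)) ?_ (MeasurableEquiv.measurable _)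
      fun_prop
  | succ n ih =>
    rw [← ((measurePreserving_piFinSuccAbove (fun _ : Fin (n + 2) => halfLine)
      0).symm).lintegral_comp_emb (MeasurableEquiv.measurableEmbedding _), lintegral_prod]
    · simp only [MeasurableEquiv.piFinSuccAbove_symm_apply, Fin.insertNthEquiv,
        Fin.insertNth_zero, Equiv.coe_fn_mk, Fin.prod_univ_succ (n := n + 1),
        Fin.sum_univ_succ (n := n + 1), Fin.cons_zero, Fin.cons_succ, mul_assoc]
      have hin : ∀ x : ℝ, Measurable fun y : Fin (n + 1) → ℝ =>
          (∏ i : Fin (n + 1), ENNReal.ofReal (y i ^ j i.succ)) * F (x + ∑ i, y i) := by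
        intro x; fun_prop
      have h1 := fun x : ℝ => ih (fun i => j i.succ) (fun i => hj _)
        (F := fun s => F (x + s)) (by fun_prop)
      have h2 : ∀ x : ℝ, ∫⁻ y, ENNReal.ofReal (x ^ j 0) *
          ((∏ i : Fin (n + 1), ENNReal.ofReal (y i ^ j i.succ)) * F (x + ∑ i, y i))
          ∂(Measure.pi fun _ => halfLine) = ENNReal.ofReal (1 / (n + ∑ i : Fin (n + 1), j (Fin.succ i))!) *
          (ENNReal.ofReal (x ^ j 0) * ∫⁻ u, ENNReal.ofReal (u ^ (n + ∑ i : Fin (n + 1), j (Fin.succ i))) *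
            F (x + u) ∂halfLine) := by
        intro x
        rw [lintegral_const_mul _ (hin x), h1 x]
        ring
      refine (lintegral_congr h2).trans ?_
      rw [lintegral_const_mul' _ _ ENNReal.ofReal_ne_top,
        lintegral_halfLine_pow_mul_shift _ _ (hj 0) hF, ← mul_assoc,
        ← ENNReal.ofReal_mul (by positivity)]
      have e1 : n + ∑ i : Fin (n + 1), j (Fin.succ i) + j 0 + 1 =
          n + 1 + (j 0 + ∑ i : Fin (n + 1), j (Fin.succ i)) := by ring
      rw [e1]
      congr 2
      have : ((n + ∑ i : Fin (n + 1), j (Fin.succ i))! : ℝ) ≠ 0 := by positivity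
      field_simp
    · refine Measurable.aemeasurable ?_
      refine Measurable.comp (g := fun x : Fin (n + 2) → ℝ =>
        (∏ i, ENNReal.ofReal (x i ^ j i)) * F (∑ i, x i)) ?_ (MeasurableEquiv.measurable _)
      fun_prop

/-- The factor `s ^ (-|S|)` makes the extra weight homogeneous of degree 0, so it depends only on
the direction of `x`, while `F` depends only on the sum. Dirichlet's formula, with and without the
weight, reduces both sides to the same one-dimensional integral, and the ratio of the constants does
not depend on `F`. -/
theorem lintegral_pi_prod_mul_inv_pow_sum {n : ℕ} (hn : 0 < n) (S : Finset (Fin n))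
    {F : ℝ → ℝ≥0∞} (hF : Measurable F) :
    ∫⁻ x : Fin n → ℝ, (∏ i ∈ S, ENNReal.ofReal (x i)) * ENNReal.ofReal (((∑ i, x i) ^ S.card)⁻¹) *
        F (∑ i, x i) ∂(Measure.pi fun _ => halfLine) =
      ENNReal.ofReal ((n - 1)! / (n - 1 + S.card)!) *
        ∫⁻ x : Fin n → ℝ, F (∑ i, x i) ∂(Measure.pi fun _ => halfLine) := by
  obtain ⟨m, rfl⟩ : ∃ m, n = m + 1 := ⟨n - 1, by omega⟩
  have h0 := lintegral_pi_pow_mul_comp_sum m (fun _ => 0) (fun _ => zero_le_one) hF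
  have hm : Measurable fun s : ℝ => ENNReal.ofReal ((s ^ S.card)⁻¹) := by fun_prop
  have h1 := lintegral_pi_pow_mul_comp_sum m (fun i => if i ∈ S then 1 else 0)
    (fun i => by split_ifs <;> simp)
    (F := fun s => ENNReal.ofReal ((s ^ S.card)⁻¹) * F s) (by fun_prop)
  simp only [pow_zero, ENNReal.ofReal_one, Finset.prod_const_one, one_mul, Finset.sum_const_zero,
    add_zero] at h0
  have hc : ∑ i : Fin (m + 1), (if i ∈ S then 1 else 0) = S.card := by simp
  rw [hc] at h1
  have hp : ∀ x : Fin (m + 1) → ℝ, ∏ i, ENNReal.ofReal (x i ^ (if i ∈ S then 1 else 0)) =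
      ∏ i ∈ S, ENNReal.ofReal (x i) := by
    intro x
    rw [← Finset.prod_subset (Finset.subset_univ S)]
    · exact Finset.prod_congr rfl fun i hi => by simp [hi]
    · intro i _ hi; simp [hi]
  simp only [hp, ← mul_assoc] at h1
  rw [h1, h0, ← mul_assoc, Nat.add_sub_cancel, ← ENNReal.ofReal_mul (by positivity)]
  have h2 : ∫⁻ u, ENNReal.ofReal (u ^ (m + S.card)) * ENNReal.ofReal ((u ^ S.card)⁻¹) * F u
      ∂halfLine = ∫⁻ u, ENNReal.ofReal (u ^ m) * F u ∂halfLine := by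
    refine lintegral_congr_ae ?_
    filter_upwards [ae_halfLine_pos] with u hu
    rw [← ENNReal.ofReal_mul (by positivity), pow_add, mul_assoc,
      mul_inv_cancel₀ (by positivity), mul_one]
  rw [h2]
  congr 2
  have : (m ! : ℝ) ≠ 0 := by positivity
  field_simp

end HalfLine

/-! ### Erlang laws: moments, tails and concentration of the quasirandom statistics. -/

section Erlang

open scoped ENNReal Nat

/-- The density of the Erlang law with shape `j + 1` and rate `r`. -/
noncomputable def erlangDensity (j : ℕ) (r x : ℝ) : ℝ :=
  r ^ (j + 1) / j ! * (x ^ j * Real.exp (-(r * x)))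

theorem measurable_erlangDensity (j : ℕ) (r : ℝ) : Measurable (erlangDensity j r) := by
  unfold erlangDensity; fun_prop

/-- The Erlang law with shape `j + 1` and rate `r`. -/
noncomputable def erlang (j : ℕ) (r : ℝ) : Measure ℝ :=
  halfLine.withDensity fun x => ENNReal.ofReal (erlangDensity j r x)

theorem erlangDensity_nonneg (j : ℕ) {r x : ℝ} (hr : 0 < r) (hx : 0 ≤ x) :
    0 ≤ erlangDensity j r x := by
  unfold erlangDensity; positivity

theorem isProbabilityMeasure_erlang (j : ℕ) {r : ℝ} (hr : 0 < r) :
    IsProbabilityMeasure (erlang j r) := by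
  constructor
  rw [erlang, withDensity_apply _ MeasurableSet.univ, Measure.restrict_univ]
  unfold erlangDensity
  simp_rw [ENNReal.ofReal_mul (show 0 ≤ r ^ (j + 1) / (j ! : ℝ) by positivity)]
  rw [lintegral_const_mul' _ _ ENNReal.ofReal_ne_top, lintegral_halfLine_pow_mul_exp j hr,
    ← ENNReal.ofReal_mul (by positivity), ← ENNReal.ofReal_one]
  congr 1
  have : (j ! : ℝ) ≠ 0 := by positivity
  field_simp

theorem integral_erlang_pow (j m : ℕ) {r : ℝ} (hr : 0 < r) :
    ∫ x, x ^ m ∂erlang j r = (m + j)! / (j ! * r ^ m) := by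
  rw [erlang, integral_withDensity_eq_integral_toReal_smul
    (show Measurable fun x => ENNReal.ofReal (erlangDensity j r x) from
      ENNReal.measurable_ofReal.comp (measurable_erlangDensity j r))
    (Filter.Eventually.of_forall fun _ => ENNReal.ofReal_lt_top)]
  have : ∫ x, (ENNReal.ofReal (erlangDensity j r x)).toReal • x ^ m ∂halfLine =
      ∫ x, r ^ (j + 1) / j ! * (x ^ (m + j) * Real.exp (-(r * x))) ∂halfLine := by
    refine integral_congr_ae ?_
    filter_upwards [ae_halfLine_nonneg] with x hx
    rw [ENNReal.toReal_ofReal (erlangDensity_nonneg j hr hx), erlangDensity, smul_eq_mul, pow_add]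
    ring
  rw [this, integral_const_mul, integral_halfLine_pow_mul_exp _ hr]
  have : (j ! : ℝ) ≠ 0 := by positivity
  rw [show m + j + 1 = m + (j + 1) by ring, pow_add r m]
  field_simp

theorem integrable_erlang_pow (j m : ℕ) {r : ℝ} (hr : 0 < r) :
    Integrable (fun x => x ^ m) (erlang j r) := by
  by_contra h
  have := integral_erlang_pow j m hr
  rw [integral_undef h] at this
  have h2 : (0 : ℝ) < (m + j)! / (j ! * r ^ m) := by positivity
  exact h2.ne this

theorem memLp_erlang_pow (j m : ℕ) {r : ℝ} (hr : 0 < r) :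
    MemLp (fun x => x ^ m) 2 (erlang j r) := by
  rw [memLp_two_iff_integrable_sq (by fun_prop)]
  simp_rw [← pow_mul]
  exact integrable_erlang_pow j _ hr

/-- Half of the exponential rate is spent on the tail factor `exp (-(r * a / 2))`; integrating
against the remaining rate `r / 2` costs `2 ^ (j + 1)`. -/
theorem erlang_Ioi_le (j : ℕ) {r : ℝ} (hr : 0 < r) (a : ℝ) :
    erlang j r (Set.Ioi a) ≤ ENNReal.ofReal (2 ^ (j + 1) * Real.exp (-(r * a / 2))) := by
  have h1 : ∫⁻ x, ENNReal.ofReal (r ^ (j + 1) / j ! * Real.exp (-(r * a / 2)) *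
      (x ^ j * Real.exp (-(r / 2 * x)))) ∂halfLine =
      ENNReal.ofReal (2 ^ (j + 1) * Real.exp (-(r * a / 2))) := by
    simp_rw [ENNReal.ofReal_mul
      (show 0 ≤ r ^ (j + 1) / (j ! : ℝ) * Real.exp (-(r * a / 2)) by positivity)]
    rw [lintegral_const_mul' _ _ ENNReal.ofReal_ne_top,
      lintegral_halfLine_pow_mul_exp j (half_pos hr), ← ENNReal.ofReal_mul (by positivity)]
    congr 1
    have : (j ! : ℝ) ≠ 0 := by positivity
    rw [div_pow]
    field_simp
  rw [← h1, erlang, withDensity_apply _ measurableSet_Ioi, ← lintegral_indicator measurableSet_Ioi]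
  refine lintegral_mono_ae ?_
  filter_upwards [ae_halfLine_nonneg] with x hx
  by_cases h : x ∈ Set.Ioi a
  · rw [Set.indicator_of_mem h]
    refine ENNReal.ofReal_le_ofReal ?_
    have h3 : Real.exp (-(r * x)) ≤ Real.exp (-(r * a / 2)) * Real.exp (-(r / 2 * x)) := by
      rw [← Real.exp_add]
      have : r * a ≤ r * x := mul_le_mul_of_nonneg_left (le_of_lt h) hr.le
      exact Real.exp_le_exp.2 (by linarith)
    calc erlangDensity j r x = r ^ (j + 1) / j ! * x ^ j * Real.exp (-(r * x)) := by
          unfold erlangDensity; ring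
      _ ≤ r ^ (j + 1) / j ! * x ^ j * (Real.exp (-(r * a / 2)) * Real.exp (-(r / 2 * x))) :=
          mul_le_mul_of_nonneg_left h3 (by positivity)
      _ = _ := by ring
  · rw [Set.indicator_of_notMem h]; exact zero_le

theorem pi_erlang {n : ℕ} (j : Fin n → ℕ) {r : ℝ} (hr : 0 < r) :
    Measure.pi (fun i => erlang (j i) r) = (Measure.pi fun _ => halfLine).withDensity
      fun x => ∏ i, ENNReal.ofReal (erlangDensity (j i) r (x i)) := by
  have := fun i => isProbabilityMeasure_erlang (j i) hr
  refine Measure.pi_eq fun s hs => ?_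
  rw [withDensity_apply _ (MeasurableSet.univ_pi hs), Measure.restrict_pi_pi,
    lintegral_pi_prod_eq_prod (fun i => halfLine.restrict (s i))
      (fun i x => ENNReal.ofReal (erlangDensity (j i) r x))
      (fun i => ENNReal.measurable_ofReal.comp (measurable_erlangDensity _ _))]
  exact Finset.prod_congr rfl fun i _ => (withDensity_apply _ (hs i)).symm

theorem ae_pi_nonneg {n : ℕ} (μ : Fin n → Measure ℝ) [∀ i, SigmaFinite (μ i)]
    (h : ∀ i, ∀ᵐ x ∂μ i, 0 ≤ x) : ∀ᵐ x ∂Measure.pi μ, ∀ i, 0 ≤ x i := by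
  rw [Filter.eventually_all]
  intro i
  exact Measure.tendsto_eval_ae_ae.eventually (h i)

theorem sum_lt_involution {n : ℕ} {f : Fin n → Fin n} (hf : f.Involutive) (hf0 : ∀ i, f i ≠ i)
    (h : Fin n → ℝ) : ∑ i with i < f i, (h i + h (f i)) = ∑ i, h i := by
  rw [Finset.sum_add_distrib, ← Finset.sum_filter_add_sum_filter_not Finset.univ (fun i => i < f i)]
  congr 1
  refine Finset.sum_bij' (fun i _ => f i) (fun i _ => f i) ?_ ?_ ?_ ?_ ?_
  · intro i hi
    simp only [Finset.mem_filter, Finset.mem_univ, true_and] at *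
    rw [hf]; exact hi.not_gt
  · intro i hi
    simp only [Finset.mem_filter, Finset.mem_univ, true_and] at *
    rw [hf]; exact lt_of_le_of_ne (not_lt.1 hi) (hf0 i)
  · intro i _; exact hf i
  · intro i _; exact hf i
  · intro i _; rfl

variable {n : ℕ} (j : Fin n → ℕ) {r : ℝ}

theorem pi_erlang_max_le (hj : ∀ i, j i ≤ 1) (hr : 0 < r) (a : ℝ) :
    Measure.pi (fun i => erlang (j i) r) {x | ∃ i, a < x i} ≤
      ENNReal.ofReal (n * (4 * Real.exp (-(r * a / 2)))) := by
  have := fun i => isProbabilityMeasure_erlang (j i) hr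
  have h1 : {x : Fin n → ℝ | ∃ i, a < x i} = ⋃ i, (Function.eval i) ⁻¹' Set.Ioi a := by
    ext x; simp
  rw [h1]
  refine (measure_iUnion_fintype_le _ _).trans ?_
  have h2 : ∀ i, Measure.pi (fun i => erlang (j i) r) ((Function.eval i) ⁻¹' Set.Ioi a) ≤
      ENNReal.ofReal (4 * Real.exp (-(r * a / 2))) := by
    intro i
    rw [← Measure.map_apply (measurable_pi_apply i) measurableSet_Ioi,
      (measurePreserving_eval (fun i => erlang (j i) r) i).map_eq]
    refine (erlang_Ioi_le _ hr a).trans (ENNReal.ofReal_le_ofReal ?_)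
    refine mul_le_mul_of_nonneg_right ?_ (Real.exp_pos _).le
    have := hj i
    interval_cases j i <;> norm_num
  refine (Finset.sum_le_sum fun i _ => h2 i).trans ?_
  rw [Finset.sum_const, Finset.card_univ, Fintype.card_fin, nsmul_eq_mul,
    ENNReal.ofReal_mul (Nat.cast_nonneg n), ENNReal.ofReal_natCast]

/-- Chebyshev at distance `δ / 2`, the other half of `δ` being left for the shift `4k/n` of the mean
caused by the `k` variables of shape 2. The variance is `O(1/n) = O(δ³)`, so the probability is
`O(δ)`: deviation and probability balance at `δ = n^(-1/3)`. -/
theorem pi_erlang_sum_sq_le (hj : ∀ i, j i ≤ 1) (hr : 0 < r) (hrn : r ^ 2 = n) {δ : ℝ}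
    (hδ : 0 < δ) (hδn : δ ^ 3 * n = 1) (hk : 4 * (∑ i, j i : ℕ) / (n : ℝ) ≤ δ / 2) :
    Measure.pi (fun i => erlang (j i) r) {x | δ < |∑ i, x i ^ 2 - 2|} ≤
      ENNReal.ofReal (480 * δ) := by
  have := fun i => isProbabilityMeasure_erlang (j i) hr
  have hn : (0 : ℝ) < n := by rw [← hrn]; positivity
  set μ := Measure.pi (fun i => erlang (j i) r) with hμ
  have hmem : ∀ i, MemLp (fun x : ℝ => x ^ 2) 2 (erlang (j i) r) := fun i =>
    memLp_erlang_pow _ _ hr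
  have hmem' : ∀ i, MemLp (fun x : Fin n → ℝ => x i ^ 2) 2 μ := fun i =>
    (hmem i).comp_measurePreserving (measurePreserving_eval _ i)
  have hsum : MemLp (fun x : Fin n → ℝ => ∑ i, x i ^ 2) 2 μ :=
    memLp_finsetSum _ fun i _ => hmem' i
  have hmean : ∫ x, ∑ i, x i ^ 2 ∂μ = 2 + 4 * (∑ i, j i : ℕ) / (n : ℝ) := by
    rw [integral_finsetSum _ fun i _ => (hmem' i).integrable (by norm_num)]
    have h1 : ∀ i, ∫ x, x i ^ 2 ∂μ = (2 + 4 * j i) / n := by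
      intro i
      rw [hμ, integral_comp_eval (μ := fun i => erlang (j i) r) (i := i) (f := fun x : ℝ => x ^ 2)
        (by fun_prop), integral_erlang_pow _ _ hr, hrn]
      have := hj i
      interval_cases j i <;> norm_num [Nat.factorial]
    simp_rw [h1]
    rw [← Finset.sum_div, Finset.sum_add_distrib, ← Finset.mul_sum]
    simp only [Finset.sum_const, Finset.card_univ, Fintype.card_fin, nsmul_eq_mul]
    push_cast
    field_simp
  have hvar : variance (fun x : Fin n → ℝ => ∑ i, x i ^ 2) μ ≤ 120 / n := by
    have h1 := variance_sum_pi (μ := fun i => erlang (j i) r) (X := fun i (x : ℝ) => x ^ 2) hmem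
    have h2 : (∑ i, fun ω : Fin n → ℝ => ω i ^ 2) = fun x : Fin n → ℝ => ∑ i, x i ^ 2 := by
      ext x; simp
    rw [h2] at h1
    rw [h1]
    -- The fourth moment is `24 / n ^ 2` for shape 1 and `120 / n ^ 2` for shape 2.
    have h3 : ∀ i, variance (fun x : ℝ => x ^ 2) (erlang (j i) r) ≤ 120 / n ^ 2 := by
      intro i
      refine (variance_le_expectation_sq (by fun_prop)).trans ?_
      have : ∫ x, ((fun x : ℝ => x ^ 2) ^ 2) x ∂erlang (j i) r = ∫ x, x ^ 4 ∂erlang (j i) r := by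
        congr 1; ext x; simp only [Pi.pow_apply]; ring
      rw [this, integral_erlang_pow _ _ hr, show r ^ 4 = (r ^ 2) ^ 2 by ring, hrn]
      have := hj i
      interval_cases j i
      · norm_num [Nat.factorial]; gcongr; norm_num
      · norm_num [Nat.factorial]
    refine (Finset.sum_le_sum fun i _ => h3 i).trans ?_
    simp only [Finset.sum_const, Finset.card_univ, Fintype.card_fin, nsmul_eq_mul]
    apply le_of_eq; field_simp
  have hcheb := meas_ge_le_variance_div_sq hsum (half_pos hδ)
  refine (measure_mono ?_).trans (hcheb.trans (ENNReal.ofReal_le_ofReal ?_))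
  · intro x hx
    change δ < |∑ i, x i ^ 2 - 2| at hx
    change δ / 2 ≤ |∑ i, x i ^ 2 - ∫ x, ∑ i, x i ^ 2 ∂μ|
    rw [hmean]
    set a := 4 * (∑ i, j i : ℕ) / (n : ℝ)
    have ha : 0 ≤ a := by positivity
    have h1 : |∑ i, x i ^ 2 - 2| ≤ |∑ i, x i ^ 2 - (2 + a)| + |a| := by
      have := abs_add_le (∑ i, x i ^ 2 - (2 + a)) a
      rwa [show ∑ i, x i ^ 2 - (2 + a) + a = ∑ i, x i ^ 2 - 2 by ring] at this
    rw [abs_of_nonneg ha] at h1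
    linarith
  · refine (div_le_div_of_nonneg_right hvar (by positivity)).trans (le_of_eq ?_)
    have : (120 : ℝ) / n = 120 * δ ^ 3 := by
      rw [div_eq_iff hn.ne']; linarith
    rw [this]; field_simp; ring

/-- Chebyshev again: the `n / 2` pairs are disjoint, so their products are independent, each with
mean `1 / n` up to the effect of the shape-2 variables and second moment at most `(6 / n) ^ 2`. -/
theorem pi_erlang_sum_pairs_le (hj : ∀ i, j i ≤ 1) (hr : 0 < r) (hrn : r ^ 2 = n) {δ : ℝ}
    (hδ : 0 < δ) (hδn : δ ^ 3 * n = 1) (hk : 4 * (∑ i, j i : ℕ) / (n : ℝ) ≤ δ / 2)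
    {f : Fin n → Fin n} (hf : f.Involutive) (hf0 : ∀ i, f i ≠ i) :
    Measure.pi (fun i => erlang (j i) r) {x | δ < |∑ i with i < f i, x i * x (f i) - 1 / 2|} ≤
      ENNReal.ofReal (144 * δ) := by
  have := fun i => isProbabilityMeasure_erlang (j i) hr
  have hn : (0 : ℝ) < n := by rw [← hrn]; positivity
  set μ := Measure.pi (fun i => erlang (j i) r) with hμ
  have hind : iIndepFun (fun i (x : Fin n → ℝ) => x i) μ :=
    iIndepFun_pi (μ := fun i => erlang (j i) r) (X := fun i (x : ℝ) => x) fun i => by fun_prop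
  have hmul : ∀ (i : Fin n) (m : ℕ), ∫ x, (x i * x (f i)) ^ m ∂μ =
      (∫ x, x ^ m ∂erlang (j i) r) * ∫ x, x ^ m ∂erlang (j (f i)) r := by
    intro i m
    have h1 : IndepFun (fun x : Fin n → ℝ => x i ^ m) (fun x : Fin n → ℝ => x (f i) ^ m) μ :=
      (hind.indepFun (hf0 i).symm).comp
        (show Measurable fun x : ℝ => x ^ m by fun_prop)
        (show Measurable fun x : ℝ => x ^ m by fun_prop)
    simp_rw [mul_pow]
    rw [h1.integral_fun_mul_eq_mul_integral
      (Measurable.aestronglyMeasurable (by fun_prop))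
      (Measurable.aestronglyMeasurable (by fun_prop))]
    congr 1
    · exact integral_comp_eval (μ := fun i => erlang (j i) r) (i := i) (f := fun x : ℝ => x ^ m)
        (by fun_prop)
    · exact integral_comp_eval (μ := fun i => erlang (j i) r) (i := f i) (f := fun x : ℝ => x ^ m)
        (by fun_prop)
  have hmom2 : ∀ i, ∫ x, x ^ 2 ∂erlang (j i) r = (2 + 4 * j i) / n := by
    intro i
    rw [integral_erlang_pow _ _ hr, hrn]
    have := hj i
    interval_cases j i <;> norm_num [Nat.factorial]
  have hmom1 : ∀ i, ∫ x, x ^ 1 ∂erlang (j i) r = (1 + j i) / r := by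
    intro i
    rw [integral_erlang_pow _ _ hr]
    have := hj i
    interval_cases j i <;> norm_num [Nat.factorial]
  have hmem : ∀ i, MemLp (fun x : Fin n → ℝ => x i * x (f i)) 2 μ := by
    intro i
    rw [memLp_two_iff_integrable_sq (by fun_prop)]
    by_contra h
    have h2 := hmul i 2
    rw [integral_undef h, hmom2, hmom2] at h2
    have : (0 : ℝ) < (2 + 4 * j i) / n * ((2 + 4 * j (f i)) / n) := by positivity
    linarith
  have hsum : MemLp (fun x : Fin n → ℝ => ∑ i with i < f i, x i * x (f i)) 2 μ :=
    memLp_finsetSum _ fun i _ => hmem i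
  have hcard : ∑ i with i < f i, (1 : ℝ) = n / 2 := by
    have := sum_lt_involution hf hf0 fun _ => (1 : ℝ)
    rw [Finset.sum_add_distrib] at this
    simp only [Finset.sum_const, Finset.card_univ, Fintype.card_fin, nsmul_eq_mul, mul_one] at *
    linarith
  have hjf := sum_lt_involution hf hf0 fun i => (j i : ℝ)
  have hj1 : ∀ i, (j i : ℝ) ≤ 1 := fun i => by exact_mod_cast hj i
  have hj0 : ∀ i, (0 : ℝ) ≤ j i := fun i => by positivity
  have hmean : ∫ x, ∑ i with i < f i, x i * x (f i) ∂μ =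
      ∑ i with i < f i, (1 + j i : ℝ) * (1 + j (f i)) / n := by
    rw [integral_finsetSum _ fun i _ => (hmem i).integrable (by norm_num)]
    refine Finset.sum_congr rfl fun i _ => ?_
    have := hmul i 1
    simp only [hmom1] at this
    simp only [pow_one] at this
    rw [this, ← hrn]; field_simp
  set a := ∫ x, ∑ i with i < f i, x i * x (f i) ∂μ - 1 / 2 with ha
  have ha0 : 0 ≤ a ∧ a ≤ δ / 2 := by
    have h1 : a = (∑ i with i < f i, ((1 + j i : ℝ) * (1 + j (f i)) - 1)) / n := by
      rw [Finset.sum_sub_distrib, hcard, sub_div, Finset.sum_div, ha, hmean]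
      field_simp
    constructor
    · rw [h1]
      refine div_nonneg (Finset.sum_nonneg fun i _ => ?_) hn.le
      nlinarith [hj0 i, hj0 (f i), mul_nonneg (hj0 i) (hj0 (f i))]
    · refine le_trans ?_ hk
      rw [h1]
      refine div_le_div_of_nonneg_right ?_ hn.le
      push_cast
      rw [← hjf, Finset.mul_sum]
      refine Finset.sum_le_sum fun i _ => ?_
      nlinarith [hj0 i, hj0 (f i), hj1 i, hj1 (f i)]
  have hvar : variance (fun x : Fin n → ℝ => ∑ i with i < f i, x i * x (f i)) μ ≤ 36 / n := by
    have h1 : variance (∑ i with i < f i, fun x : Fin n → ℝ => x i * x (f i)) μ =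
        ∑ i with i < f i, variance (fun x : Fin n → ℝ => x i * x (f i)) μ := by
      refine IndepFun.variance_sum (fun i _ => hmem i) ?_
      intro i hi k hk hik
      simp only [Finset.coe_filter, Finset.mem_univ, true_and] at hi hk
      have hi' : i < f i := hi
      have hk' : k < f k := hk
      have n1 : i ≠ f k := by
        rintro rfl; rw [hf] at hi'; exact hi'.not_gt hk'
      have n2 : f i ≠ k := by
        rintro rfl; rw [hf] at hk'; exact hi'.not_gt hk'
      have n3 : f i ≠ f k := fun h => hik (hf.injective h)
      exact (hind.indepFun_prodMk_prodMk (fun i => measurable_pi_apply i) i (f i) k (f k)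
        hik n1 n2 n3).comp
        (show Measurable fun p : ℝ × ℝ => p.1 * p.2 by fun_prop)
        (show Measurable fun p : ℝ × ℝ => p.1 * p.2 by fun_prop)
    have h2 : (∑ i with i < f i, fun x : Fin n → ℝ => x i * x (f i)) =
        fun x : Fin n → ℝ => ∑ i with i < f i, x i * x (f i) := by
      ext x; simp
    rw [h2] at h1
    rw [h1]
    have h3 : ∀ i, variance (fun x : Fin n → ℝ => x i * x (f i)) μ ≤ 36 / n ^ 2 * 1 := by
      intro i
      refine (variance_le_expectation_sq (by fun_prop)).trans ?_
      have : ∫ x, ((fun x : Fin n → ℝ => x i * x (f i)) ^ 2) x ∂μ =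
        ∫ x, (x i * x (f i)) ^ 2 ∂μ := rfl
      rw [this, hmul, hmom2, hmom2, div_mul_div_comm, mul_one, ← sq]
      gcongr
      nlinarith [hj0 i, hj0 (f i), hj1 i, hj1 (f i), mul_nonneg (hj0 i) (hj0 (f i))]
    refine (Finset.sum_le_sum fun i _ => h3 i).trans ?_
    rw [← Finset.mul_sum, hcard, div_mul_div_comm, div_le_div_iff₀ (by positivity) hn]
    nlinarith [sq_nonneg (n : ℝ), pow_pos hn 2]
  have hcheb := meas_ge_le_variance_div_sq hsum (half_pos hδ)
  refine (measure_mono ?_).trans (hcheb.trans (ENNReal.ofReal_le_ofReal ?_))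
  · intro x hx
    change δ < |∑ i with i < f i, x i * x (f i) - 1 / 2| at hx
    change δ / 2 ≤ |∑ i with i < f i, x i * x (f i) - ∫ x, ∑ i with i < f i, x i * x (f i) ∂μ|
    have e : ∫ x, ∑ i with i < f i, x i * x (f i) ∂μ = 1 / 2 + a := by rw [ha]; ring
    rw [e]
    have h1 : |∑ i with i < f i, x i * x (f i) - 1 / 2| ≤
        |∑ i with i < f i, x i * x (f i) - (1 / 2 + a)| + |a| := by
      have := abs_add_le (∑ i with i < f i, x i * x (f i) - (1 / 2 + a)) a
      rwa [show ∑ i with i < f i, x i * x (f i) - (1 / 2 + a) + a =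
        ∑ i with i < f i, x i * x (f i) - 1 / 2 by ring] at this
    rw [abs_of_nonneg ha0.1] at h1
    linarith [ha0.2]
  · refine (div_le_div_of_nonneg_right hvar (by positivity)).trans (le_of_eq ?_)
    have : (36 : ℝ) / n = 36 * δ ^ 3 := by
      rw [div_eq_iff hn.ne']; linarith
    rw [this]; field_simp; ring

/-- The sum of the `n` exponentials has mean `r` and variance 1, and `exp (-u) ≥ 1 - u` with `u`
half the squared deviation. -/
theorem pi_erlang_expectation_ge (hr : 0 < r) (hrn : r ^ 2 = n) :
    1 / 2 ≤ ∫ x, Real.exp (-(∑ i, x i - r) ^ 2 / 2) ∂Measure.pi (fun _ : Fin n => erlang 0 r) := by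
  have := isProbabilityMeasure_erlang 0 hr
  have hn : (0 : ℝ) < n := by rw [← hrn]; positivity
  set μ := Measure.pi (fun _ : Fin n => erlang 0 r) with hμ
  have hmem : MemLp (fun x : ℝ => x) 2 (erlang 0 r) := by simpa using memLp_erlang_pow 0 1 hr
  have hmem' : ∀ i, MemLp (fun x : Fin n → ℝ => x i) 2 μ := fun i =>
    hmem.comp_measurePreserving (measurePreserving_eval (fun _ : Fin n => erlang 0 r) i)
  have hsum : MemLp (fun x : Fin n → ℝ => ∑ i, x i) 2 μ := memLp_finsetSum _ fun i _ => hmem' i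
  have m1 : ∫ x, x ∂erlang 0 r = 1 / r := by
    have := integral_erlang_pow 0 1 hr
    simpa using this
  have m2 : ∫ x, x ^ 2 ∂erlang 0 r = 2 / r ^ 2 := by
    have := integral_erlang_pow 0 2 hr
    simpa using this
  have hmean : ∫ x, ∑ i, x i ∂μ = r := by
    rw [integral_finsetSum _ fun i _ => (hmem' i).integrable (by norm_num)]
    have h1 : ∀ i, ∫ x, x i ∂μ = 1 / r := by
      intro i
      rw [hμ, integral_comp_eval (μ := fun _ : Fin n => erlang 0 r) (i := i) (f := fun x : ℝ => x)
        (by fun_prop), m1]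
    simp_rw [h1]
    simp only [Finset.sum_const, Finset.card_univ, Fintype.card_fin, nsmul_eq_mul]
    rw [← hrn]; field_simp
  have hvar : variance (fun x : Fin n → ℝ => ∑ i, x i) μ = 1 := by
    have h1 := variance_sum_pi (μ := fun _ : Fin n => erlang 0 r) (X := fun _ (x : ℝ) => x)
      fun _ => hmem
    have h2 : (∑ i, fun ω : Fin n → ℝ => ω i) = fun x : Fin n → ℝ => ∑ i, x i := by
      ext x; simp
    rw [h2] at h1
    rw [h1, variance_eq_sub hmem]
    have : ∫ x, ((fun x : ℝ => x) ^ 2) x ∂erlang 0 r = ∫ x, x ^ 2 ∂erlang 0 r := rfl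
    rw [this, m1, m2]
    simp only [Finset.sum_const, Finset.card_univ, Fintype.card_fin, nsmul_eq_mul]
    rw [← hrn]; field_simp; norm_num
  rw [variance_eq_integral (by fun_prop), hmean] at hvar
  have hint : Integrable (fun x : Fin n → ℝ => (∑ i, x i - r) ^ 2) μ :=
    (hsum.sub (memLp_const r)).integrable_sq
  have hle : ∫ x, (1 - (∑ i, x i - r) ^ 2 / 2) ∂μ = 1 / 2 := by
    rw [integral_sub (integrable_const _) (hint.div_const 2), integral_div, hvar]
    norm_num
  rw [← hle]
  refine integral_mono ((integrable_const _).sub (hint.div_const 2)) ?_ fun x => ?_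
  · refine Integrable.of_bound (by fun_prop) 1 (Filter.Eventually.of_forall fun x => ?_)
    rw [Real.norm_eq_abs, abs_of_pos (Real.exp_pos _), Real.exp_le_one_iff]
    have := sq_nonneg (∑ i, x i - r)
    linarith
  · have := Real.add_one_le_exp (-(∑ i, x i - r) ^ 2 / 2)
    change 1 - (∑ i, x i - r) ^ 2 / 2 ≤ Real.exp (-(∑ i, x i - r) ^ 2 / 2)
    linarith

end Erlang

/-! ### The total Gaussian weight and its concentration on the quasirandom set. -/

section GaussianWeight

open scoped ENNReal Nat

variable {n : ℕ}

/-- The quasirandomness conditions on the values of the partners in a matching. -/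
def quasirandomSet (f : Fin n → Fin n) : Set (Fin n → ℝ) :=
  {x | |(∑ i, x i) - Real.sqrt n| ≤ 10 * Real.log n ∧
    (∀ i, x i ≤ Real.log n ^ 2 / Real.sqrt n) ∧
    |(∑ i with i < f i, x i * x (f i)) - 1 / 2| ≤ (n : ℝ) ^ (-(1 / 3) : ℝ) ∧
    |(∑ i, x i ^ 2) - 2| ≤ (n : ℝ) ^ (-(1 / 3) : ℝ)}

theorem measurableSet_quasirandomSet (f : Fin n → Fin n) : MeasurableSet (quasirandomSet f) := by
  have h : quasirandomSet f = {x : Fin n → ℝ | |(∑ i, x i) - Real.sqrt n| ≤ 10 * Real.log n} ∩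
      ((⋂ i, {x : Fin n → ℝ | x i ≤ Real.log n ^ 2 / Real.sqrt n}) ∩
      ({x : Fin n → ℝ | |(∑ i with i < f i, x i * x (f i)) - 1 / 2| ≤ (n : ℝ) ^ (-(1 / 3) : ℝ)} ∩
      {x : Fin n → ℝ | |(∑ i, x i ^ 2) - 2| ≤ (n : ℝ) ^ (-(1 / 3) : ℝ)})) := by
    ext x; simp [quasirandomSet]
  rw [h]
  exact (measurableSet_le (by fun_prop) measurable_const).inter
    ((MeasurableSet.iInter fun i => measurableSet_le (by fun_prop) measurable_const).inter
      ((measurableSet_le (by fun_prop) measurable_const).inter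
        (measurableSet_le (by fun_prop) measurable_const)))

/-- The weight `∏_{i ∈ S} x_i · s^{-|S|} · e^{-s²/2}`, where `s` is the sum of the `x_i`. -/
noncomputable def gaussWeight (S : Finset (Fin n)) (x : Fin n → ℝ) : ℝ≥0∞ :=
  (∏ i ∈ S, ENNReal.ofReal (x i)) * ENNReal.ofReal (((∑ i, x i) ^ S.card)⁻¹) *
    ENNReal.ofReal (Real.exp (-(∑ i, x i) ^ 2 / 2))

/-- The integral of `e^{-s²/2}` over the positive orthant. -/
noncomputable def gaussMass (n : ℕ) : ℝ≥0∞ :=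
  ∫⁻ x : Fin n → ℝ, ENNReal.ofReal (Real.exp (-(∑ i, x i) ^ 2 / 2))
    ∂(Measure.pi fun _ => halfLine)

theorem measurable_gaussWeight (S : Finset (Fin n)) : Measurable (gaussWeight S) := by
  unfold gaussWeight; fun_prop

theorem lintegral_gaussWeight (hn : 0 < n) (S : Finset (Fin n)) :
    ∫⁻ x, gaussWeight S x ∂(Measure.pi fun _ => halfLine) =
      ENNReal.ofReal ((n - 1)! / (n - 1 + S.card)!) * gaussMass n :=
  lintegral_pi_prod_mul_inv_pow_sum hn S (F := fun s => ENNReal.ofReal (Real.exp (-s ^ 2 / 2)))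
    (by fun_prop)

/-- The denominator contributes the `k` factors `n, …, n + k - 1`, each at least `n`. -/
theorem factorial_div_factorial_le (hn : 0 < n) (k : ℕ) :
    ((n - 1)! / (n - 1 + k)! : ℝ) ≤ ((n : ℝ) ^ k)⁻¹ := by
  have h := Nat.factorial_mul_pow_le_factorial (m := n - 1) (n := k)
  have h1 : n - 1 + 1 = n := by omega
  rw [h1] at h
  have h2 : (((n - 1)! * n ^ k : ℕ) : ℝ) ≤ ((n - 1 + k)! : ℕ) := by exact_mod_cast h
  push_cast at h2
  have hn' : (0 : ℝ) < n := by exact_mod_cast hn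
  rw [div_le_iff₀ (by positivity), inv_mul_eq_div, le_div_iff₀ (by positivity)]
  exact h2

/-- The same `k` factors are at most `n + k`, and Bernoulli bounds `(n / (n + k)) ^ k` from below.
-/
theorem le_factorial_div_factorial (hn : 0 < n) (k : ℕ) :
    ((n : ℝ) ^ k)⁻¹ * (1 - (k : ℝ) ^ 2 / n) ≤ ((n - 1)! / (n - 1 + k)! : ℝ) := by
  have hn' : (0 : ℝ) < n := by exact_mod_cast hn
  have h2 : (n - 1 + k)! ≤ (n - 1)! * (n + k) ^ k := by
    rw [← Nat.factorial_mul_ascFactorial]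
    refine Nat.mul_le_mul_left _ ?_
    refine (Nat.ascFactorial_le_pow_add _ _).trans (Nat.pow_le_pow_left (by omega) _)
  have h3 : ((n - 1 + k)! : ℝ) ≤ (n - 1)! * ((n : ℝ) + k) ^ k := by exact_mod_cast h2
  have hb := one_add_mul_le_pow (a := -((k : ℝ) / (n + k))) (by
    have : (k : ℝ) / (n + k) ≤ 1 := by
      rw [div_le_one (by positivity)]; linarith
    linarith) k
  have h4 : 1 + -((k : ℝ) / (n + k)) = n / (n + k) := by field_simp; ring
  rw [h4] at hb
  have h5 : 1 - (k : ℝ) ^ 2 / n ≤ 1 + k * -((k : ℝ) / (n + k)) := by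
    have : (k : ℝ) * (k / (n + k)) ≤ k ^ 2 / n := by
      rw [← mul_div_assoc, ← sq]
      exact div_le_div_of_nonneg_left (by positivity) hn' (by linarith [Nat.cast_nonneg (α := ℝ) k])
    linarith
  calc ((n : ℝ) ^ k)⁻¹ * (1 - (k : ℝ) ^ 2 / n) ≤ ((n : ℝ) ^ k)⁻¹ * ((n : ℝ) / (n + k)) ^ k :=
        mul_le_mul_of_nonneg_left (h5.trans hb) (by positivity)
    _ = (n - 1)! / ((n - 1)! * ((n : ℝ) + k) ^ k) := by
        have : ((n - 1)! : ℝ) ≠ 0 := by positivity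
        rw [div_pow]; field_simp
    _ ≤ _ := div_le_div_of_nonneg_left (by positivity) (by positivity) h3

/-- The ratio of `e^{-s²/2}` to the density of independent exponential variables with mean
`n^{-1/2}`, at the point where it is the largest. -/
noncomputable def gaussConst (n : ℕ) : ℝ := Real.exp (n / 2) / Real.sqrt n ^ n

/-- Complete the square: with `r = √n`, `-s²/2 = -rs + r²/2 - (s - r)²/2`. The term `-rs` gives
independent exponentials, the factors `x i` with `i ∈ S` raise their shape to 2, and the powers of
`r` needed to normalise these account for `(r s) ^ (-|S|)`. -/
theorem gaussWeight_eq (hn : 0 < n) (S : Finset (Fin n)) {x : Fin n → ℝ} (hx : ∀ i, 0 ≤ x i) :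
    gaussWeight S x =
      (∏ i, ENNReal.ofReal (erlangDensity (if i ∈ S then 1 else 0) (Real.sqrt n) (x i))) *
        ENNReal.ofReal (gaussConst n * ((Real.sqrt n * ∑ i, x i) ^ S.card)⁻¹ *
          Real.exp (-(∑ i, x i - Real.sqrt n) ^ 2 / 2)) := by
  have hn' : (0 : ℝ) < n := by exact_mod_cast hn
  set r := Real.sqrt n with hr
  have hr0 : 0 < r := Real.sqrt_pos.2 hn'
  have hrn : r ^ 2 = n := Real.sq_sqrt hn'.le
  have hs : 0 ≤ ∑ i, x i := Finset.sum_nonneg fun i _ => hx i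
  rw [gaussWeight, ← ENNReal.ofReal_prod_of_nonneg fun i _ => hx i,
    ← ENNReal.ofReal_prod_of_nonneg fun i _ => erlangDensity_nonneg _ hr0 (hx i),
    ← ENNReal.ofReal_mul (Finset.prod_nonneg fun i _ => hx i),
    ← ENNReal.ofReal_mul (mul_nonneg (Finset.prod_nonneg fun i _ => hx i) (by positivity)),
    ← ENNReal.ofReal_mul (Finset.prod_nonneg fun i _ => erlangDensity_nonneg _ hr0 (hx i))]
  congr 1
  have h1 : ∀ i, erlangDensity (if i ∈ S then 1 else 0) r (x i) =
      (if i ∈ S then r * x i else 1) * (r * Real.exp (-(r * x i))) := by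
    intro i
    split_ifs <;> simp [erlangDensity]
    ring
  simp_rw [h1]
  rw [Finset.prod_mul_distrib, Finset.prod_mul_distrib, Finset.prod_const, Finset.card_univ,
    Fintype.card_fin, ← Real.exp_sum, Finset.sum_neg_distrib, ← Finset.mul_sum,
    Finset.prod_ite_mem, Finset.univ_inter, Finset.prod_mul_distrib, Finset.prod_const]
  set s := ∑ i, x i
  have h2 : Real.exp (-s ^ 2 / 2) =
      Real.exp (-(r * s)) * (Real.exp (n / 2) * Real.exp (-(s - r) ^ 2 / 2)) := by
    rw [← Real.exp_add, ← Real.exp_add]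
    congr 1
    rw [← hrn]; ring
  rw [h2, gaussConst, ← hr, mul_pow]
  field_simp

theorem lintegral_gaussWeight_mul (hn : 0 < n) (S : Finset (Fin n)) {A : Set (Fin n → ℝ)}
    (hA : MeasurableSet A) :
    ∫⁻ x in A, gaussWeight S x ∂(Measure.pi fun _ => halfLine) =
      ∫⁻ x in A, ENNReal.ofReal (gaussConst n * ((Real.sqrt n * ∑ i, x i) ^ S.card)⁻¹ *
          Real.exp (-(∑ i, x i - Real.sqrt n) ^ 2 / 2))
        ∂(Measure.pi fun i => erlang (if i ∈ S then 1 else 0) (Real.sqrt n)) := by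
  have hn' : (0 : ℝ) < n := by exact_mod_cast hn
  have hr0 : 0 < Real.sqrt n := Real.sqrt_pos.2 hn'
  rw [pi_erlang _ hr0, setLIntegral_withDensity_eq_setLIntegral_mul _ _ (by fun_prop) hA]
  · refine lintegral_congr_ae (ae_restrict_of_ae ?_)
    filter_upwards [ae_pi_nonneg (fun _ : Fin n => halfLine) fun _ => ae_halfLine_nonneg] with x hx
    rw [gaussWeight_eq hn S hx]
    rfl
  · exact Finset.measurable_prod _ fun i _ => ENNReal.measurable_ofReal.comp
      ((measurable_erlangDensity _ _).comp (measurable_pi_apply i))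

theorem gaussConst_pos (hn : 0 < n) : 0 < gaussConst n := by
  have : (0 : ℝ) < n := by exact_mod_cast hn
  unfold gaussConst
  positivity

theorem gaussWeight_empty (x : Fin n → ℝ) :
    gaussWeight ∅ x = ENNReal.ofReal (Real.exp (-(∑ i, x i) ^ 2 / 2)) := by
  simp [gaussWeight]

theorem gaussConst_half_le_gaussMass (hn : 0 < n) :
    ENNReal.ofReal (gaussConst n / 2) ≤ gaussMass n := by
  have hn' : (0 : ℝ) < n := by exact_mod_cast hn
  have hr0 : 0 < Real.sqrt n := Real.sqrt_pos.2 hn'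
  have h := lintegral_gaussWeight_mul hn (∅ : Finset (Fin n)) MeasurableSet.univ
  simp only [gaussWeight_empty, Measure.restrict_univ, Finset.notMem_empty, if_false,
    Finset.card_empty, pow_zero, inv_one, mul_one] at h
  rw [gaussMass, h]
  have := isProbabilityMeasure_erlang 0 hr0
  rw [← ofReal_integral_eq_lintegral_ofReal, integral_const_mul]
  · refine ENNReal.ofReal_le_ofReal ?_
    have := pi_erlang_expectation_ge (n := n) hr0 (Real.sq_sqrt hn'.le)
    have := mul_le_mul_of_nonneg_left this (gaussConst_pos hn).le
    linarith
  · refine Integrable.const_mul ?_ _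
    refine Integrable.of_bound (Measurable.aestronglyMeasurable (by fun_prop)) 1
      (Filter.Eventually.of_forall fun x => ?_)
    rw [Real.norm_eq_abs, abs_of_pos (Real.exp_pos _), Real.exp_le_one_iff]
    have := sq_nonneg (∑ i, x i - Real.sqrt n)
    linarith
  · exact Filter.Eventually.of_forall fun x => mul_nonneg (gaussConst_pos hn).le (Real.exp_pos _).le

theorem gaussMass_ne_top (hn : 0 < n) : gaussMass n ≠ ∞ := by
  have hn' : (0 : ℝ) < n := by exact_mod_cast hn
  have hr0 : 0 < Real.sqrt n := Real.sqrt_pos.2 hn'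
  have h := lintegral_gaussWeight_mul hn (∅ : Finset (Fin n)) MeasurableSet.univ
  simp only [gaussWeight_empty, Measure.restrict_univ, Finset.notMem_empty, if_false,
    Finset.card_empty, pow_zero, inv_one, mul_one] at h
  rw [gaussMass, h]
  have := isProbabilityMeasure_erlang 0 hr0
  refine ne_top_of_le_ne_top (b := ENNReal.ofReal (gaussConst n)) ENNReal.ofReal_ne_top ?_
  refine (lintegral_mono (g := fun _ => ENNReal.ofReal (gaussConst n)) fun x =>
    ENNReal.ofReal_le_ofReal ?_).trans (by simp)
  refine mul_le_of_le_one_right (gaussConst_pos hn).le ?_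
  rw [Real.exp_le_one_iff]
  have := sq_nonneg (∑ i, x i - Real.sqrt n)
  linarith

theorem gaussMass_ne_zero (hn : 0 < n) : gaussMass n ≠ 0 := by
  have h1 := gaussConst_half_le_gaussMass hn
  have h2 : 0 < ENNReal.ofReal (gaussConst n / 2) :=
    ENNReal.ofReal_pos.2 (half_pos (gaussConst_pos hn))
  exact (h2.trans_le h1).ne'

/-- The factor `s ^ (-|S|)` is unbounded near 0, so no pointwise bound is available for general `S`.
The event depends only on `s`, however, so the Dirichlet identity reduces it exactly to `S = ∅`,
where the Gaussian factor is at most `exp (-a²/2)`. -/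
theorem lintegral_gaussWeight_sum_far_le (hn : 0 < n) (S : Finset (Fin n)) {a : ℝ} (ha : 0 ≤ a) :
    ∫⁻ x in {x : Fin n → ℝ | a < |∑ i, x i - Real.sqrt n|}, gaussWeight S x
        ∂(Measure.pi fun _ => halfLine) ≤
      ENNReal.ofReal (((n : ℝ) ^ S.card)⁻¹ * (gaussConst n * Real.exp (-a ^ 2 / 2))) := by
  have hn' : (0 : ℝ) < n := by exact_mod_cast hn
  have hr0 : 0 < Real.sqrt n := Real.sqrt_pos.2 hn'
  have hA : MeasurableSet {x : Fin n → ℝ | a < |∑ i, x i - Real.sqrt n|} :=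
    measurableSet_lt measurable_const (by fun_prop)
  have hB : MeasurableSet {s : ℝ | a < |s - Real.sqrt n|} :=
    measurableSet_lt measurable_const (by fun_prop)
  have key : ∀ S : Finset (Fin n),
      ∫⁻ x in {x : Fin n → ℝ | a < |∑ i, x i - Real.sqrt n|}, gaussWeight S x
        ∂(Measure.pi fun _ => halfLine) = ENNReal.ofReal ((n - 1)! / (n - 1 + S.card)!) *
      ∫⁻ x : Fin n → ℝ, {s : ℝ | a < |s - Real.sqrt n|}.indicator
        (fun s => ENNReal.ofReal (Real.exp (-s ^ 2 / 2))) (∑ i, x i)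
        ∂(Measure.pi fun _ => halfLine) := by
    intro S
    rw [← lintegral_indicator hA, ← lintegral_pi_prod_mul_inv_pow_sum hn S
      (Measurable.indicator (by fun_prop) hB)]
    refine lintegral_congr fun x => ?_
    by_cases hx : a < |∑ i, x i - Real.sqrt n|
    · rw [Set.indicator_of_mem (show x ∈ {x : Fin n → ℝ | a < |∑ i, x i - Real.sqrt n|} from hx),
        Set.indicator_of_mem (show ∑ i, x i ∈ {s : ℝ | a < |s - Real.sqrt n|} from hx), gaussWeight]
    · rw [Set.indicator_of_notMem
          (show x ∉ {x : Fin n → ℝ | a < |∑ i, x i - Real.sqrt n|} from hx),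
        Set.indicator_of_notMem (show ∑ i, x i ∉ {s : ℝ | a < |s - Real.sqrt n|} from hx), mul_zero]
  have h0 : ∫⁻ x : Fin n → ℝ, {s : ℝ | a < |s - Real.sqrt n|}.indicator
        (fun s => ENNReal.ofReal (Real.exp (-s ^ 2 / 2))) (∑ i, x i)
        ∂(Measure.pi fun _ => halfLine) ≤ ENNReal.ofReal (gaussConst n * Real.exp (-a ^ 2 / 2)) := by
    have h1 := key ∅
    rw [Finset.card_empty, add_zero, div_self (by positivity), ENNReal.ofReal_one, one_mul] at h1
    rw [← h1, lintegral_gaussWeight_mul hn _ hA]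
    simp only [Finset.notMem_empty, if_false, Finset.card_empty, pow_zero, inv_one, mul_one]
    have := isProbabilityMeasure_erlang 0 hr0
    refine (setLIntegral_mono measurable_const fun x hx => ENNReal.ofReal_le_ofReal
      (mul_le_mul_of_nonneg_left (Real.exp_le_exp.2 ?_) (gaussConst_pos hn).le)).trans
      (?_ : ∫⁻ _ in _, ENNReal.ofReal (gaussConst n * Real.exp (-a ^ 2 / 2)) ∂_ ≤ _)
    · have hx' : a < |∑ i, x i - Real.sqrt n| := hx
      have : a ^ 2 ≤ (∑ i, x i - Real.sqrt n) ^ 2 := by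
        rw [← sq_abs (∑ i, x i - Real.sqrt n)]
        exact pow_le_pow_left₀ ha hx'.le 2
      linarith
    · rw [setLIntegral_const]
      exact mul_le_of_le_one_right zero_le prob_le_one
  rw [key S, ENNReal.ofReal_mul (by positivity)]
  exact mul_le_mul' (ENNReal.ofReal_le_ofReal (factorial_div_factorial_le hn _)) h0

/-- When `s ≥ √n - a` and `|S| a ≤ √n / 2`, Bernoulli gives `(s / √n) ^ |S| ≥ 1/2`, which is the
factor 2. Estimates under the Erlang laws then transfer to the weight. -/
theorem lintegral_gaussWeight_near_le (hn : 0 < n) (S : Finset (Fin n)) {A : Set (Fin n → ℝ)}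
    (hA : MeasurableSet A) {a : ℝ} (ha : 0 ≤ a) (hk : 2 * S.card * a ≤ Real.sqrt n)
    (hAs : ∀ x ∈ A, Real.sqrt n - a ≤ ∑ i, x i) :
    ∫⁻ x in A, gaussWeight S x ∂(Measure.pi fun _ => halfLine) ≤
      ENNReal.ofReal (((n : ℝ) ^ S.card)⁻¹ * (gaussConst n * 2)) *
        Measure.pi (fun i => erlang (if i ∈ S then 1 else 0) (Real.sqrt n)) A := by
  have hn' : (0 : ℝ) < n := by exact_mod_cast hn
  have hr0 : 0 < Real.sqrt n := Real.sqrt_pos.2 hn'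
  rw [lintegral_gaussWeight_mul hn _ hA, ← setLIntegral_const]
  refine setLIntegral_mono measurable_const fun x hx => ENNReal.ofReal_le_ofReal ?_
  have hs := hAs x hx
  set s := ∑ i, x i
  have h1 : Real.exp (-(s - Real.sqrt n) ^ 2 / 2) ≤ 1 := by
    rw [Real.exp_le_one_iff]
    have := sq_nonneg (s - Real.sqrt n)
    linarith
  have h2 : ((Real.sqrt n * s) ^ S.card)⁻¹ ≤ ((n : ℝ) ^ S.card)⁻¹ * 2 := by
    -- For empty `S` the hypothesis `hk` says nothing about `a`, but the power is then 1.
    rcases Nat.eq_zero_or_pos S.card with h0 | h0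
    · rw [h0]; norm_num
    have hk1 : (1 : ℝ) ≤ S.card := by exact_mod_cast h0
    have hak : a ≤ Real.sqrt n / 2 := by
      have : 2 * 1 * a ≤ 2 * S.card * a := by gcongr
      linarith
    set r := Real.sqrt n
    have hrn : r ^ 2 = n := Real.sq_sqrt hn'.le
    have hb := one_add_mul_le_pow (a := -(a / r)) (by
      have : a / r ≤ 1 := by rw [div_le_one hr0]; linarith
      linarith) S.card
    have h3 : (S.card : ℝ) * (a / r) ≤ 1 / 2 := by
      rw [← mul_div_assoc, div_le_iff₀ hr0]; linarith
    have h4 : (1 + -(a / r)) ^ S.card ≤ (s / r) ^ S.card := by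
      refine pow_le_pow_left₀ ?_ ?_ _
      · have : a / r ≤ 1 := by rw [div_le_one hr0]; linarith
        linarith
      · rw [le_div_iff₀ hr0]
        have : (1 + -(a / r)) * r = r - a := by field_simp; ring
        linarith
    have h5 : 1 / 2 ≤ (s / r) ^ S.card := by linarith
    have h6 : (r * s) ^ S.card = (n : ℝ) ^ S.card * (s / r) ^ S.card := by
      rw [← mul_pow, ← hrn]; congr 1; field_simp
    rw [h6, mul_inv]
    refine mul_le_mul_of_nonneg_left ?_ (by positivity)
    have := inv_anti₀ (by norm_num) h5
    norm_num at this
    simpa using this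
  have hs0 : 0 ≤ ((Real.sqrt n * s) ^ S.card)⁻¹ := by
    rcases Nat.eq_zero_or_pos S.card with h0 | h0
    · rw [h0]; norm_num
    have hk1 : (1 : ℝ) ≤ S.card := by exact_mod_cast h0
    have hak : a ≤ Real.sqrt n / 2 := by
      have : 2 * 1 * a ≤ 2 * S.card * a := by gcongr
      linarith
    have : 0 ≤ s := by linarith
    positivity
  have hc := (gaussConst_pos hn).le
  calc gaussConst n * ((Real.sqrt n * s) ^ S.card)⁻¹ * Real.exp (-(s - Real.sqrt n) ^ 2 / 2)
      ≤ gaussConst n * ((Real.sqrt n * s) ^ S.card)⁻¹ * 1 :=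
        mul_le_mul_of_nonneg_left h1 (mul_nonneg hc hs0)
    _ ≤ gaussConst n * (((n : ℝ) ^ S.card)⁻¹ * 2) * 1 := by gcongr
    _ = _ := by ring

/-- A failure of the condition on the sum is handled by the Gaussian factor alone; the other three
conditions are tested under the Erlang laws where the sum is near `√n`. The factor `gaussConst n` is
absorbed by `gaussMass n`, which is at least half of it. -/
theorem lintegral_gaussWeight_compl_quasirandomSet_le (hl : 4 ≤ Real.log n) (S : Finset (Fin n))
    (hk1 : 20 * S.card * Real.log n ≤ Real.sqrt n)
    (hk2 : 8 * S.card / (n : ℝ) ≤ (n : ℝ) ^ (-(1 / 3) : ℝ))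
    {f : Fin n → Fin n} (hf : f.Involutive) (hf0 : ∀ i, f i ≠ i) :
    ∫⁻ x in (quasirandomSet f)ᶜ, gaussWeight S x ∂(Measure.pi fun _ => halfLine) ≤
      ENNReal.ofReal (3000 * (n : ℝ) ^ (-(1 / 3) : ℝ) * ((n : ℝ) ^ S.card)⁻¹) * gaussMass n := by
  have hn : 0 < n := by
    rcases Nat.eq_zero_or_pos n with rfl | h
    · norm_num at hl
    · exact h
  have hn' : (0 : ℝ) < n := by exact_mod_cast hn
  have hr0 : 0 < Real.sqrt n := Real.sqrt_pos.2 hn'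
  set δ := (n : ℝ) ^ (-(1 / 3) : ℝ) with hδdef
  have hδ : 0 < δ := Real.rpow_pos_of_pos hn' _
  have hδn : δ ^ 3 * n = 1 := by
    rw [hδdef, ← Real.rpow_natCast, ← Real.rpow_mul hn'.le]
    norm_num
    rw [Real.rpow_neg_one]; field_simp
  have hδexp : δ = Real.exp (-(1 / 3) * Real.log n) := by
    rw [hδdef, Real.rpow_def_of_pos hn', mul_comm]
  set j : Fin n → ℕ := fun i => if i ∈ S then 1 else 0 with hj
  have hj1 : ∀ i, j i ≤ 1 := fun i => by simp only [hj]; split_ifs <;> simp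
  have hjs : ∑ i, j i = S.card := by simp [hj]
  have hk2' : 4 * (∑ i, j i : ℕ) / (n : ℝ) ≤ δ / 2 := by
    rw [hjs]
    have : 8 * (S.card : ℝ) / n = 2 * (4 * S.card / n) := by ring
    linarith
  set a := 10 * Real.log n with ha
  have ha0 : 0 ≤ a := by positivity
  set A1 := {x : Fin n → ℝ | a < |∑ i, x i - Real.sqrt n|} with hA1
  have hA1m : MeasurableSet A1 := measurableSet_lt measurable_const (by fun_prop)
  set A2 := (quasirandomSet f)ᶜ \ A1 with hA2
  have hA2m : MeasurableSet A2 := (measurableSet_quasirandomSet f).compl.diff hA1m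
  have hsub : (quasirandomSet f)ᶜ ⊆ A1 ∪ A2 := by
    intro x hx
    by_cases h : x ∈ A1
    · exact Or.inl h
    · exact Or.inr ⟨hx, h⟩
  -- `628 = 4 + 144 + 480`, for the maximum, the pair sum and the sum of squares.
  have hmeas : Measure.pi (fun i => erlang (j i) (Real.sqrt n)) A2 ≤
      ENNReal.ofReal (628 * δ) := by
    have hsub2 : A2 ⊆ {x | ∃ i, Real.log n ^ 2 / Real.sqrt n < x i} ∪
        ({x | δ < |∑ i with i < f i, x i * x (f i) - 1 / 2|} ∪ {x | δ < |∑ i, x i ^ 2 - 2|}) := by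
      rintro x ⟨hx, hx1⟩
      by_contra h
      simp only [Set.mem_union, not_or] at h
      obtain ⟨h1, h2, h3⟩ := h
      refine hx ⟨not_lt.1 hx1, fun i => ?_, not_lt.1 h2, not_lt.1 h3⟩
      by_contra h4
      exact h1 ⟨i, not_le.1 h4⟩
    refine (measure_mono hsub2).trans ((measure_union_le _ _).trans ?_)
    have e1 := pi_erlang_max_le j hj1 hr0 (Real.log n ^ 2 / Real.sqrt n)
    have e2 := pi_erlang_sum_pairs_le j hj1 hr0 (Real.sq_sqrt hn'.le) hδ hδn hk2' hf hf0
    have e3 := pi_erlang_sum_sq_le j hj1 hr0 (Real.sq_sqrt hn'.le) hδ hδn hk2'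
    have e1' : (n : ℝ) * (4 * Real.exp (-(Real.sqrt n * (Real.log n ^ 2 / Real.sqrt n) / 2))) ≤
        4 * δ := by
      have h1 : Real.sqrt n * (Real.log n ^ 2 / Real.sqrt n) / 2 = Real.log n ^ 2 / 2 := by
        field_simp
      have h2 : (n : ℝ) * Real.exp (-(Real.log n ^ 2 / 2)) ≤ δ := by
        rw [hδexp]
        nth_rewrite 1 [← Real.exp_log hn']
        rw [← Real.exp_add]
        exact Real.exp_le_exp.2 (by nlinarith)
      rw [h1]; linarith
    calc _ ≤ ENNReal.ofReal (4 * δ) + (ENNReal.ofReal (144 * δ) + ENNReal.ofReal (480 * δ)) := by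
          refine add_le_add (e1.trans (ENNReal.ofReal_le_ofReal e1'))
            ((measure_union_le _ _).trans (add_le_add e2 e3))
      _ = _ := by
          rw [← ENNReal.ofReal_add (by positivity) (by positivity),
            ← ENNReal.ofReal_add (by positivity) (by positivity)]
          congr 1; ring
  have h1 := lintegral_gaussWeight_sum_far_le hn S ha0
  have h2 := lintegral_gaussWeight_near_le hn S hA2m ha0 (by linarith) (fun x hx => by
    have : |∑ i, x i - Real.sqrt n| ≤ a := not_lt.1 hx.2
    linarith [(abs_le.1 this).1])
  have hexp : Real.exp (-a ^ 2 / 2) ≤ δ := by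
    rw [hδexp]
    exact Real.exp_le_exp.2 (by rw [ha]; nlinarith)
  have hc := gaussConst_pos hn
  calc _ ≤ ∫⁻ x in A1 ∪ A2, gaussWeight S x ∂(Measure.pi fun _ => halfLine) :=
        lintegral_mono_set hsub
    _ ≤ _ := lintegral_union_le _ _ _
    _ ≤ ENNReal.ofReal (((n : ℝ) ^ S.card)⁻¹ * (gaussConst n * δ)) +
        ENNReal.ofReal (((n : ℝ) ^ S.card)⁻¹ * (gaussConst n * 2)) *
          ENNReal.ofReal (628 * δ) := by
        refine add_le_add (h1.trans (ENNReal.ofReal_le_ofReal ?_))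
          (h2.trans (mul_le_mul' le_rfl hmeas))
        gcongr
    _ ≤ ENNReal.ofReal (3000 * δ * ((n : ℝ) ^ S.card)⁻¹) * ENNReal.ofReal (gaussConst n / 2) := by
        rw [← ENNReal.ofReal_mul (by positivity), ← ENNReal.ofReal_add (by positivity)
          (by positivity), ← ENNReal.ofReal_mul (by positivity)]
        refine ENNReal.ofReal_le_ofReal ?_
        have : 0 ≤ ((n : ℝ) ^ S.card)⁻¹ * (gaussConst n * δ) := by positivity
        nlinarith
    _ ≤ _ := mul_le_mul' le_rfl (gaussConst_half_le_gaussMass hn)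

end GaussianWeight

/-! ### Estimates for products of `1 - x i * x j`. -/

section Products

/-- Keep the first two of the nonnegative terms of the series of `-log (1 - t)`; the case `t = 1` is
separate because the series diverges there. -/
theorem one_sub_le_exp_quadratic {t : ℝ} (h0 : 0 ≤ t) (h1 : t ≤ 1) :
    1 - t ≤ Real.exp (-t - t ^ 2 / 2) := by
  rcases h1.lt_or_eq with h1 | rfl
  · have hs := Real.hasSum_pow_div_log_of_abs_lt_one (x := t) (by rwa [abs_of_nonneg h0])
    have := sum_le_hasSum (Finset.range 2) (fun i _ => by positivity) hs
    rw [← Real.exp_log (sub_pos.2 h1)]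
    refine Real.exp_le_exp.2 ?_
    simp only [Finset.sum_range_succ, Finset.sum_range_zero] at this
    norm_num at this
    linarith
  · simpa using (Real.exp_pos _).le

theorem exp_cubic_le_one_sub {t : ℝ} (h0 : 0 ≤ t) (h1 : t ≤ 1 / 2) :
    Real.exp (-t - t ^ 2 / 2 - 2 * t ^ 3) ≤ 1 - t := by
  have h := Real.abs_log_sub_add_sum_range_le (x := t) (by rw [abs_of_nonneg h0]; linarith) 2
  simp only [Finset.sum_range_succ, Finset.sum_range_zero, abs_of_nonneg h0] at h
  have h2 : t ^ (2 + 1) / (1 - t) ≤ 2 * t ^ 3 := by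
    rw [div_le_iff₀ (by linarith)]
    have : 0 ≤ t ^ 3 := by positivity
    norm_num
    nlinarith
  have h3 := (abs_le.1 (h.trans h2)).1
  rw [← Real.exp_log (show 0 < 1 - t by linarith)]
  refine Real.exp_le_exp.2 ?_
  norm_num at h3
  linarith

variable {n : ℕ}

/-- The increasing pairs matched by neither of two maps. -/
def freePairs (f g : Fin n → Fin n) : Finset (Fin n × Fin n) :=
  Finset.univ.filter fun p => p.1 < p.2 ∧ f p.1 ≠ p.2 ∧ g p.1 ≠ p.2

theorem mem_freePairs {f g : Fin n → Fin n} {p : Fin n × Fin n} :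
    p ∈ freePairs f g ↔ p.1 < p.2 ∧ f p.1 ≠ p.2 ∧ g p.1 ≠ p.2 := by simp [freePairs]

theorem sum_lt_add_sum_diag (v : Fin n → Fin n → ℝ) :
    ∑ p : Fin n × Fin n with p.1 < p.2, (v p.1 p.2 + v p.2 p.1) + ∑ i, v i i =
      ∑ i, ∑ j, v i j := by
  rw [← Finset.sum_product' Finset.univ Finset.univ, Finset.univ_product_univ,
    ← Finset.sum_filter_add_sum_filter_not Finset.univ (fun p : Fin n × Fin n => p.1 < p.2),
    Finset.sum_add_distrib, add_assoc]
  congr 1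
  rw [← Finset.sum_filter_add_sum_filter_not
    (Finset.univ.filter fun p : Fin n × Fin n => ¬ p.1 < p.2)
    (fun p : Fin n × Fin n => p.2 < p.1)]
  congr 1
  · refine Finset.sum_bij' (fun p _ => (p.2, p.1)) (fun p _ => (p.2, p.1)) ?_ ?_ ?_ ?_ ?_
    · intro p hp
      simp only [Finset.mem_filter, Finset.mem_univ, true_and] at *
      exact ⟨hp.not_gt, hp⟩
    · intro p hp
      simp only [Finset.mem_filter, Finset.mem_univ, true_and] at *
      exact hp.2
    · intro p _; rfl
    · intro p _; rfl
    · intro p _; rfl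
  · refine Finset.sum_bij' (fun i _ => (i, i)) (fun p _ => p.1) ?_ ?_ ?_ ?_ ?_
    · intro i _; simp
    · intro p _; simp
    · intro i _; rfl
    · intro p hp
      simp only [Finset.mem_filter, Finset.mem_univ, true_and] at hp
      exact Prod.ext rfl (le_antisymm (not_lt.1 hp.2) (not_lt.1 hp.1))
    · intro i _; rfl

theorem sum_freePairs_mul (f : Fin n → Fin n) (a : Fin n → ℝ) :
    ∑ p ∈ freePairs f f, a p.1 * a p.2 =
      ((∑ i, a i) ^ 2 - ∑ i, a i ^ 2) / 2 - ∑ i with i < f i, a i * a (f i) := by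
  have h1 := sum_lt_add_sum_diag fun i j => a i * a j
  have h2 : ∑ i, ∑ j, a i * a j = (∑ i, a i) ^ 2 := by
    rw [sq, Finset.sum_mul_sum]
  have h3 : ∑ p : Fin n × Fin n with p.1 < p.2, a p.1 * a p.2 =
      ∑ p ∈ freePairs f f, a p.1 * a p.2 + ∑ i with i < f i, a i * a (f i) := by
    rw [← Finset.sum_filter_add_sum_filter_not
      (Finset.univ.filter fun p : Fin n × Fin n => p.1 < p.2) (fun p => f p.1 ≠ p.2)]
    congr 1
    · refine Finset.sum_congr ?_ fun _ _ => rfl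
      ext p; simp [freePairs]
    · symm
      refine Finset.sum_bij' (fun i _ => (i, f i)) (fun p _ => p.1) ?_ ?_ ?_ ?_ ?_
      · intro i hi; simpa using hi
      · intro p hp
        simp only [Finset.mem_filter, Finset.mem_univ, true_and, not_not] at *
        rw [hp.2]; exact hp.1
      · intro i _; rfl
      · intro p hp
        simp only [Finset.mem_filter, Finset.mem_univ, true_and, not_not] at hp
        exact Prod.ext rfl hp.2
      · intro i _; rfl
  have h4 : ∀ p : Fin n × Fin n, a p.1 * a p.2 + a p.2 * a p.1 = 2 * (a p.1 * a p.2) :=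
    fun p => by ring
  rw [h2] at h1
  simp only [h4, ← Finset.mul_sum, h3, ← sq] at h1
  linarith

/-- The probability that no pair blocks a matching in which the partners have given values. -/
def stabilityWeight (f : Fin n → Fin n) (x : Fin n → ℝ) : ℝ :=
  ∏ p ∈ freePairs f f, (1 - x p.1 * x p.2)

variable {f g : Fin n → Fin n} {x : Fin n → ℝ}

theorem sum_pairs_sq_le (hf : f.Involutive) (hf0 : ∀ i, f i ≠ i) (a : Fin n → ℝ) :
    ∑ i with i < f i, a i * a (f i) ≤ (∑ i, a i ^ 2) / 2 := by
  rw [← sum_lt_involution hf hf0, Finset.sum_div]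
  refine Finset.sum_le_sum fun i _ => ?_
  nlinarith [sq_nonneg (a i - a (f i))]

/-- Bound `log (1 - t)` by `-t - t²/2` in each factor; the sums of `t` and of `t²` over the
unmatched pairs are given by `sum_freePairs_mul`, applied to `x` and to its square. -/
theorem stabilityWeight_le_exp (hx0 : ∀ i, 0 ≤ x i) (hx1 : ∀ i, x i ≤ 1) :
    stabilityWeight f x ≤ Real.exp (-((∑ i, x i) ^ 2 - ∑ i, x i ^ 2) / 2 +
      ∑ i with i < f i, x i * x (f i) - ((∑ i, x i ^ 2) ^ 2 - ∑ i, x i ^ 4) / 4 +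
      (∑ i with i < f i, x i ^ 2 * x (f i) ^ 2) / 2) := by
  have h1 := sum_freePairs_mul f x
  have h2 := sum_freePairs_mul f fun i => x i ^ 2
  simp only [← pow_mul] at h2
  norm_num at h2
  calc stabilityWeight f x ≤ ∏ p ∈ freePairs f f,
        Real.exp (-(x p.1 * x p.2) - (x p.1 * x p.2) ^ 2 / 2) := by
        refine Finset.prod_le_prod (fun p _ => ?_) fun p _ => ?_
        · exact sub_nonneg.2 (mul_le_one₀ (hx1 _) (hx0 _) (hx1 _))
        · exact one_sub_le_exp_quadratic (mul_nonneg (hx0 _) (hx0 _))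
            (mul_le_one₀ (hx1 _) (hx0 _) (hx1 _))
    _ ≤ _ := by
        rw [← Real.exp_sum]
        refine Real.exp_le_exp.2 (le_of_eq ?_)
        simp only [mul_pow]
        rw [Finset.sum_sub_distrib, Finset.sum_neg_distrib, h1, ← Finset.sum_div, h2]
        ring

/-- With `q` the sum of squares, the exponent beyond `-s²/2` is at most `3q/2 - q²/4`, whose maximum
`9/4` is attained at `q = 3`. The quadratic term of the logarithm is what makes the bound uniform in
`x`. -/
theorem stabilityWeight_le_global (hf : f.Involutive) (hf0 : ∀ i, f i ≠ i)
    (hx0 : ∀ i, 0 ≤ x i) (hx1 : ∀ i, x i ≤ 1) :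
    stabilityWeight f x ≤ Real.exp (9 / 4) * Real.exp (-(∑ i, x i) ^ 2 / 2) := by
  refine (stabilityWeight_le_exp hx0 hx1).trans ?_
  rw [← Real.exp_add]
  refine Real.exp_le_exp.2 ?_
  have h1 := sum_pairs_sq_le hf hf0 x
  have h2 := sum_pairs_sq_le hf hf0 fun i => x i ^ 2
  have h3 : ∑ i, x i ^ 4 ≤ ∑ i, x i ^ 2 := by
    refine Finset.sum_le_sum fun i _ => ?_
    exact pow_le_pow_of_le_one (hx0 i) (hx1 i) (by norm_num)
  simp only [← pow_mul] at h2
  norm_num at h2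
  nlinarith [sq_nonneg (∑ i, x i ^ 2 - 3)]

/-- With sum of squares `q` near 2 and pair sum `p` near 1/2, the main exponent `-s²/2 + q/2 + p -
q²/4` is near `1/2 - s²/2`. The fourth-power sums and the cubic remainders carry an extra factor `m²
≤ δ/10`. -/
theorem stabilityWeight_quasirandom (hf : f.Involutive) (hf0 : ∀ i, f i ≠ i)
    (hx0 : ∀ i, 0 ≤ x i) {m δ : ℝ} (hxm : ∀ i, x i ≤ m) (hm : m ^ 2 ≤ δ / 10) (hδ1 : δ ≤ 1)
    (hp : |(∑ i with i < f i, x i * x (f i)) - 1 / 2| ≤ δ) (hq : |(∑ i, x i ^ 2) - 2| ≤ δ) :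
    Real.exp (-(4 * δ)) * (Real.exp (1 / 2) * Real.exp (-(∑ i, x i) ^ 2 / 2)) ≤
        stabilityWeight f x ∧
      stabilityWeight f x ≤
        Real.exp (4 * δ) * (Real.exp (1 / 2) * Real.exp (-(∑ i, x i) ^ 2 / 2)) := by
  have hδ0 : 0 ≤ δ := (abs_nonneg _).trans hp
  obtain ⟨hp1, hp2⟩ := abs_le.1 hp
  obtain ⟨hq1, hq2⟩ := abs_le.1 hq
  have hx2 : ∀ i, x i ^ 2 ≤ m ^ 2 := fun i => pow_le_pow_left₀ (hx0 i) (hxm i) 2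
  have ht : ∀ i k, x i * x k ≤ m ^ 2 := fun i k => by nlinarith [hx2 i, hx2 k, sq_nonneg (x i - x k)]
  set q := ∑ i, x i ^ 2 with hqdef
  set s := ∑ i, x i
  set p := ∑ i with i < f i, x i * x (f i)
  have hr4 : ∑ i, x i ^ 4 ≤ m ^ 2 * q := by
    rw [hqdef, Finset.mul_sum]
    refine Finset.sum_le_sum fun i _ => ?_
    have : x i ^ 4 = x i ^ 2 * x i ^ 2 := by ring
    rw [this]
    exact mul_le_mul_of_nonneg_right (hx2 i) (sq_nonneg _)
  have hr40 : 0 ≤ ∑ i, x i ^ 4 := Finset.sum_nonneg fun i _ => by positivity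
  have hp20 : 0 ≤ ∑ i with i < f i, x i ^ 2 * x (f i) ^ 2 :=
    Finset.sum_nonneg fun i _ => by positivity
  have hmq : m ^ 2 * q ≤ δ / 10 * 3 :=
    mul_le_mul hm (by linarith) (Finset.sum_nonneg fun i _ => sq_nonneg _) (by linarith)
  constructor
  · have h1 := sum_freePairs_mul f x
    have h2 := sum_freePairs_mul f fun i => x i ^ 2
    simp only [← pow_mul] at h2
    norm_num at h2
    have h3 : ∏ p ∈ freePairs f f,
        Real.exp (-(x p.1 * x p.2) - (1 / 2 + 2 * m ^ 2) * (x p.1 ^ 2 * x p.2 ^ 2)) ≤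
        stabilityWeight f x := by
      refine Finset.prod_le_prod (fun p _ => (Real.exp_pos _).le) fun p _ => ?_
      refine le_trans (Real.exp_le_exp.2 ?_) (exp_cubic_le_one_sub (mul_nonneg (hx0 _) (hx0 _))
        ((ht _ _).trans (by linarith)))
      -- The cubic remainder only perturbs the coefficient `1/2` of the quadratic term by `2 * m ^
      -- 2`.
      have : (x p.1 * x p.2) ^ 3 ≤ m ^ 2 * (x p.1 ^ 2 * x p.2 ^ 2) := by
        have e : (x p.1 * x p.2) ^ 3 = (x p.1 * x p.2) * (x p.1 ^ 2 * x p.2 ^ 2) := by ring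
        rw [e]
        exact mul_le_mul_of_nonneg_right (ht _ _) (by positivity)
      have e2 : (x p.1 * x p.2) ^ 2 = x p.1 ^ 2 * x p.2 ^ 2 := by ring
      rw [e2]; linarith
    refine le_trans ?_ h3
    rw [← Real.exp_sum, ← Real.exp_add, ← Real.exp_add]
    refine Real.exp_le_exp.2 ?_
    rw [Finset.sum_sub_distrib, Finset.sum_neg_distrib, ← Finset.mul_sum, h1, h2]
    have hq2' : q ^ 2 ≤ 4 + 5 * δ := by nlinarith
    have hb : (q ^ 2 - ∑ i, x i ^ 4) / 2 - ∑ i with i < f i, x i ^ 2 * x (f i) ^ 2 ≤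
        2 + 5 / 2 * δ := by linarith
    have hb2 : (1 / 2 + 2 * m ^ 2) * ((q ^ 2 - ∑ i, x i ^ 4) / 2 -
        ∑ i with i < f i, x i ^ 2 * x (f i) ^ 2) ≤ (1 / 2 + 2 * m ^ 2) * (2 + 5 / 2 * δ) :=
      mul_le_mul_of_nonneg_left hb (by positivity)
    have hb3 : (1 / 2 + 2 * m ^ 2) * (2 + 5 / 2 * δ) ≤ 1 + 5 / 4 * δ + 9 * m ^ 2 := by
      nlinarith [sq_nonneg m]
    linarith
  · refine (stabilityWeight_le_exp hx0 fun i => ?_).trans ?_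
    · have := hx2 i
      nlinarith [hx0 i]
    · rw [← Real.exp_add, ← Real.exp_add]
      refine Real.exp_le_exp.2 ?_
      have h2 := sum_pairs_sq_le hf hf0 fun i => x i ^ 2
      simp only [← pow_mul] at h2
      norm_num at h2
      have hq2' : 4 - 4 * δ ≤ q ^ 2 := by nlinarith
      linarith

theorem left_mem_moved_iff (hf : f.Involutive) (hg : g.Involutive) {t : Fin n} :
    f t ∈ moved f g ↔ t ∈ moved f g :=
  ⟨fun h => by simpa [hf t] using left_mem_moved hf hg h, left_mem_moved hf hg⟩

theorem right_mem_moved_iff (hf : f.Involutive) (hg : g.Involutive) {t : Fin n} :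
    g t ∈ moved f g ↔ t ∈ moved f g :=
  ⟨fun h => by simpa [hg t] using right_mem_moved hf hg h, right_mem_moved hf hg⟩

theorem freePairs_subset : freePairs f g ⊆ freePairs f f := fun p hp => by
  rw [mem_freePairs] at *; exact ⟨hp.1, hp.2.1, hp.2.1⟩

theorem stabilityWeight_le_prod_freePairs (hx0 : ∀ i, 0 ≤ x i) (hx1 : ∀ i, x i ≤ 1) :
    stabilityWeight f x ≤ ∏ p ∈ freePairs f g, (1 - x p.1 * x p.2) := by
  unfold stabilityWeight
  rw [← Finset.prod_sdiff freePairs_subset]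
  refine mul_le_of_le_one_left (Finset.prod_nonneg fun p _ =>
    sub_nonneg.2 (mul_le_one₀ (hx1 _) (hx0 _) (hx1 _))) ?_
  refine Finset.prod_le_one (fun p _ => sub_nonneg.2 (mul_le_one₀ (hx1 _) (hx0 _) (hx1 _)))
    fun p _ => ?_
  linarith [mul_nonneg (hx0 p.1) (hx0 p.2)]

/-- The extra pairs in `stabilityWeight` are those matched by `g` but not by `f`. Such a pair is
determined by its first, moved, end, so there are few of them, and each factor is at least `1 - m²`.
-/
theorem prod_freePairs_mul_le (hx0 : ∀ i, 0 ≤ x i) {m : ℝ} (hxm : ∀ i, x i ≤ m) (hm0 : 0 ≤ m)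
    (hm : m ≤ 1) :
    (∏ p ∈ freePairs f g, (1 - x p.1 * x p.2)) * (1 - (moved f g).card * m ^ 2) ≤
      stabilityWeight f x := by
  have hx1 : ∀ i, x i ≤ 1 := fun i => (hxm i).trans hm
  have hm2 : m ^ 2 ≤ 1 := pow_le_one₀ hm0 hm
  unfold stabilityWeight
  rw [← Finset.prod_sdiff (freePairs_subset (f := f) (g := g)), mul_comm]
  refine mul_le_mul_of_nonneg_right ?_ (Finset.prod_nonneg fun p _ =>
    sub_nonneg.2 (mul_le_one₀ (hx1 _) (hx0 _) (hx1 _)))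
  have hc : (freePairs f f \ freePairs f g).card ≤ (moved f g).card := by
    refine Finset.card_le_card_of_injOn (fun p => p.1) ?_ ?_
    · intro p hp
      simp only [Finset.coe_sdiff, Set.mem_sdiff, Finset.mem_coe, mem_freePairs] at hp
      rw [Finset.mem_coe, mem_moved]
      intro h
      exact hp.2 ⟨hp.1.1, hp.1.2.1, h ▸ hp.1.2.1⟩
    · intro p hp p' hp' h
      have e : ∀ p : Fin n × Fin n, p ∈ ((freePairs f f \ freePairs f g : Finset _) : Set _) →
          g p.1 = p.2 := by
        intro p hp
        simp only [Finset.coe_sdiff, Set.mem_sdiff, Finset.mem_coe, mem_freePairs] at hp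
        by_contra h
        exact hp.2 ⟨hp.1.1, hp.1.2.1, h⟩
      have h' : p.1 = p'.1 := h
      exact Prod.ext h' (by rw [← e p hp, ← e p' hp', h'])
  calc 1 - (moved f g).card * m ^ 2 ≤ 1 - (freePairs f f \ freePairs f g).card * m ^ 2 := by
        have : ((freePairs f f \ freePairs f g).card : ℝ) ≤ (moved f g).card := by exact_mod_cast hc
        nlinarith [sq_nonneg m]
    _ ≤ (1 + -m ^ 2) ^ (freePairs f f \ freePairs f g).card := by
        have := one_add_mul_le_pow (a := -m ^ 2) (by linarith)
          (freePairs f f \ freePairs f g).card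
        linarith
    _ ≤ _ := by
        rw [← Finset.prod_const]
        refine Finset.prod_le_prod (fun _ _ => by linarith) fun p _ => ?_
        have : x p.1 * x p.2 ≤ m ^ 2 := by
          rw [sq]; exact mul_le_mul (hxm _) (hxm _) (hx0 _) hm0
        linarith

/-- Only the pairs with exactly one moved end are exploited: there the increase of the product is
the unmoved `x i` times the excess `d j`. All such pairs are free, since `f` and `g` match moved
points with moved points, so the increases sum to a product of two sums. Then `1 - a - w ≤ (1 - a)
(1 - w) ≤ (1 - a) exp (-w)`. -/
theorem prod_freePairs_max_le (hf : f.Involutive) (hg : g.Involutive) (hx0 : ∀ i, 0 ≤ x i)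
    (hx1 : ∀ i, x i ≤ 1) {Y : Fin n → ℝ} (hY : ∀ i ∉ moved f g, Y i = x i)
    (hY0 : ∀ i, 0 ≤ Y i) (hY1 : ∀ i, Y i ≤ 1) :
    ∏ p ∈ freePairs f g, (1 - max (x p.1 * x p.2) (Y p.1 * Y p.2)) ≤
      (∏ p ∈ freePairs f g, (1 - x p.1 * x p.2)) *
        Real.exp (-((∑ i with i ∉ moved f g, x i) * ∑ i ∈ moved f g, max (Y i - x i) 0)) := by
  set T := moved f g
  set d : Fin n → ℝ := fun i => max (Y i - x i) 0 with hd
  have hd0 : ∀ i, 0 ≤ d i := fun i => le_max_right _ _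
  set v : Fin n → Fin n → ℝ := fun i j => (if i ∉ T then x i else 0) * (if j ∈ T then d j else 0)
    with hv
  have hv0 : ∀ i j, 0 ≤ v i j := fun i j => by
    simp only [hv]
    split_ifs <;> first | exact mul_nonneg (hx0 _) (hd0 _) | simp
  have hsum : ∑ p ∈ freePairs f g, (v p.1 p.2 + v p.2 p.1) =
      (∑ i with i ∉ T, x i) * ∑ i ∈ T, d i := by
    have h1 := sum_lt_add_sum_diag v
    have h2 : ∑ i, v i i = 0 := Finset.sum_eq_zero fun i _ => by
      simp only [hv]
      by_cases h : i ∈ T <;> simp [h]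
    have h3 : ∑ i, ∑ j, v i j = (∑ i with i ∉ T, x i) * ∑ i ∈ T, d i := by
      simp only [hv]
      rw [← Finset.sum_mul_sum, Finset.sum_filter]
      congr 1
      rw [Finset.sum_ite_mem, Finset.univ_inter]
    rw [h2, add_zero, h3] at h1
    rw [← h1]
    refine Finset.sum_subset ?_ ?_
    · intro p hp
      rw [mem_freePairs] at hp
      simpa using hp.1
    · intro p hp hp'
      have hp1 : p.1 < p.2 := by simpa using hp
      have h4 : p.2 ∈ T ↔ p.1 ∈ T := by
        by_cases h5 : f p.1 = p.2
        · rw [← h5]; exact left_mem_moved_iff hf hg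
        · by_cases h6 : g p.1 = p.2
          · rw [← h6]; exact right_mem_moved_iff hf hg
          · exact absurd (mem_freePairs.2 ⟨hp1, h5, h6⟩) hp'
      simp only [hv]
      by_cases h : p.1 ∈ T
      · simp [h, h4.2 h]
      · have h' : p.2 ∉ T := fun h' => h (h4.1 h')
        simp [h, h']
  rw [← hsum, ← Finset.sum_neg_distrib, Real.exp_sum, ← Finset.prod_mul_distrib]
  refine Finset.prod_le_prod (fun p _ => ?_) fun p _ => ?_
  · exact sub_nonneg.2 (max_le (mul_le_one₀ (hx1 _) (hx0 _) (hx1 _))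
      (mul_le_one₀ (hY1 _) (hY0 _) (hY1 _)))
  · set w := v p.1 p.2 + v p.2 p.1 with hw
    have hw0 : 0 ≤ w := add_nonneg (hv0 _ _) (hv0 _ _)
    have ha0 := mul_nonneg (hx0 p.1) (hx0 p.2)
    have ha1 := mul_le_one₀ (hx1 p.1) (hx0 p.2) (hx1 p.2)
    have key : x p.1 * x p.2 + w ≤ max (x p.1 * x p.2) (Y p.1 * Y p.2) := by
      have hmax : ∀ a b y : ℝ, 0 ≤ a → a * b + a * max (y - b) 0 ≤ max (a * b) (a * y) := by
        intro a b y ha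
        rcases le_total y b with h | h
        · rw [max_eq_right (sub_nonpos.2 h)]; simp
        · rw [max_eq_left (sub_nonneg.2 h)]
          refine le_max_of_le_right (le_of_eq ?_); ring
      by_cases h1 : p.1 ∈ T <;> by_cases h2 : p.2 ∈ T
      · simp [hw, hv, h1, h2]
      · have e : w = x p.2 * d p.1 := by simp [hw, hv, h1, h2]
        rw [e, hY _ h2, mul_comm (x p.1), mul_comm (Y p.1)]
        exact hmax _ _ _ (hx0 _)
      · have e : w = x p.1 * d p.2 := by simp [hw, hv, h1, h2]
        rw [e, hY _ h1]
        exact hmax _ _ _ (hx0 _)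
      · simp [hw, hv, h1, h2]
    have h3 := Real.add_one_le_exp (-w)
    calc 1 - max (x p.1 * x p.2) (Y p.1 * Y p.2) ≤ 1 - (x p.1 * x p.2 + w) := by linarith
      _ ≤ (1 - x p.1 * x p.2) * (1 - w) := by nlinarith [mul_nonneg ha0 hw0]
      _ ≤ _ := mul_le_mul_of_nonneg_left (by linarith) (by linarith)

/-- Write `1 - a - u = (1 - a) (1 - v)` with `v = u / (1 - a)`. Both `v - u` and the higher terms of
`-log (1 - v)` are `O(m²) u`; 14 leaves room for `2 + (3/2) * 7`. -/
theorem exp_le_one_sub_of_small {m a u : ℝ} (hm : m ^ 2 ≤ 1 / 100)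
    (ha : a ≤ m ^ 2) (hu0 : 0 ≤ u) (hu : u ≤ 3 * m ^ 2) :
    (1 - a) * Real.exp (-((1 + 14 * m ^ 2) * u)) ≤ 1 - a - u := by
  have ha1 : 0 < 1 - a := by linarith
  set v := u / (1 - a) with hv
  have hv0 : 0 ≤ v := by positivity
  have hvu : v ≤ u * (1 + 2 * m ^ 2) := by
    rw [hv, div_le_iff₀ ha1, mul_assoc]
    refine le_mul_of_one_le_right hu0 ?_
    nlinarith
  have hv1 : v ≤ 1 / 2 := by nlinarith
  have h1 : 1 - a - u = (1 - a) * (1 - v) := by rw [hv]; field_simp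
  rw [h1]
  refine mul_le_mul_of_nonneg_left ?_ ha1.le
  refine le_trans (Real.exp_le_exp.2 ?_) (exp_cubic_le_one_sub hv0 hv1)
  have hv2 : v ≤ 2 * u := by nlinarith
  have h2 : v ^ 2 / 2 + 2 * v ^ 3 ≤ 3 / 2 * v ^ 2 := by nlinarith [sq_nonneg v]
  have h3 : v ^ 2 ≤ (2 * u) * (u * (1 + 2 * m ^ 2)) := by
    rw [sq]; exact mul_le_mul hv2 hvu hv0 (by linarith)
  have h4 : (2 * u) * (u * (1 + 2 * m ^ 2)) ≤ u * (7 * m ^ 2) := by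
    have : 2 * u * (1 + 2 * m ^ 2) ≤ 7 * m ^ 2 := by nlinarith
    calc (2 * u) * (u * (1 + 2 * m ^ 2)) = u * (2 * u * (1 + 2 * m ^ 2)) := by ring
      _ ≤ _ := mul_le_mul_of_nonneg_left this hu0
  nlinarith [mul_nonneg hu0 (sq_nonneg m)]

/-- The maximum is `x i + d i`, so each product grows by `x i d j + x j d i + d i d j`, and over all
pairs the growth is at most `s D + D²` with `D` the total excess. The main term `s D` matches the
upper bound up to replacing the unmoved sum by `s`. -/
theorem le_prod_freePairs_max (hx0 : ∀ i, 0 ≤ x i) {m : ℝ} (hm0 : 0 ≤ m)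
    (hm : m ^ 2 ≤ 1 / 100) (hxm : ∀ i, x i ≤ m) {Y : Fin n → ℝ}
    (hY : ∀ i ∉ moved f g, Y i = x i) (hYm : ∀ i, Y i ≤ x i + m) :
    stabilityWeight f x * Real.exp (-((1 + 14 * m ^ 2) *
        ((∑ i, x i) * (∑ i ∈ moved f g, max (Y i - x i) 0) +
          (∑ i ∈ moved f g, max (Y i - x i) 0) ^ 2))) ≤
      ∏ p ∈ freePairs f g, (1 - max (x p.1) (Y p.1) * max (x p.2) (Y p.2)) := by
  set T := moved f g
  have hm1 : m ≤ 1 := by nlinarith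
  have hx1 : ∀ i, x i ≤ 1 := fun i => (hxm i).trans hm1
  set d : Fin n → ℝ := fun i => max (Y i - x i) 0 with hd
  have hd0 : ∀ i, 0 ≤ d i := fun i => le_max_right _ _
  have hdm : ∀ i, d i ≤ m := fun i => max_le (by linarith [hYm i]) hm0
  have hz : ∀ i, max (x i) (Y i) = x i + d i := by
    intro i
    simp only [hd]
    rcases le_total (Y i) (x i) with h | h
    · rw [max_eq_left h, max_eq_right (sub_nonpos.2 h), add_zero]
    · rw [max_eq_right h, max_eq_left (sub_nonneg.2 h)]; ring
  have hdT : ∑ i ∈ T, d i = ∑ i, d i := by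
    refine Finset.sum_subset (Finset.subset_univ _) fun i _ hi => ?_
    simp [hd, hY i hi]
  have hxx : ∀ i k, x i * x k ≤ m ^ 2 := fun i k => by
    rw [sq]; exact mul_le_mul (hxm i) (hxm k) (hx0 k) hm0
  have hxd : ∀ i k, x i * d k ≤ m ^ 2 := fun i k => by
    rw [sq]; exact mul_le_mul (hxm i) (hdm k) (hd0 k) hm0
  have hdd : ∀ i k, d i * d k ≤ m ^ 2 := fun i k => by
    rw [sq]; exact mul_le_mul (hdm i) (hdm k) (hd0 k) hm0
  set u : Fin n × Fin n → ℝ := fun p => x p.1 * d p.2 + x p.2 * d p.1 + d p.1 * d p.2 with hu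
  have hu0 : ∀ p, 0 ≤ u p := fun p => add_nonneg (add_nonneg (mul_nonneg (hx0 _) (hd0 _))
    (mul_nonneg (hx0 _) (hd0 _))) (mul_nonneg (hd0 _) (hd0 _))
  have hsum : ∑ p ∈ freePairs f g, u p ≤ (∑ i, x i) * (∑ i, d i) + (∑ i, d i) ^ 2 := by
    have h1 := sum_lt_add_sum_diag fun i j => x i * d j + d i * d j / 2
    have h2 : ∑ i, ∑ j, (x i * d j + d i * d j / 2) =
        (∑ i, x i) * (∑ i, d i) + (∑ i, d i) ^ 2 / 2 := by
      rw [sq, Finset.sum_mul_sum, Finset.sum_mul_sum, Finset.sum_div]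
      simp only [Finset.sum_add_distrib, Finset.sum_div]
    have h3 : 0 ≤ ∑ i, (x i * d i + d i * d i / 2) := Finset.sum_nonneg fun i _ =>
      add_nonneg (mul_nonneg (hx0 _) (hd0 _)) (by have := mul_nonneg (hd0 i) (hd0 i); linarith)
    have h4 : ∑ p ∈ freePairs f g, u p ≤ ∑ p : Fin n × Fin n with p.1 < p.2,
        (x p.1 * d p.2 + d p.1 * d p.2 / 2 + (x p.2 * d p.1 + d p.2 * d p.1 / 2)) := by
      have h5 : ∑ p : Fin n × Fin n with p.1 < p.2,
        (x p.1 * d p.2 + d p.1 * d p.2 / 2 + (x p.2 * d p.1 + d p.2 * d p.1 / 2)) =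
        ∑ p : Fin n × Fin n with p.1 < p.2, u p :=
        Finset.sum_congr rfl fun p _ => by simp only [hu]; ring
      rw [h5]
      refine Finset.sum_le_sum_of_subset_of_nonneg ?_ fun p _ _ => hu0 p
      intro p hp
      rw [mem_freePairs] at hp
      simpa using hp.1
    have h6 : 0 ≤ (∑ i, d i) ^ 2 := sq_nonneg _
    linarith
  rw [hdT]
  calc _ ≤ (∏ p ∈ freePairs f g, (1 - x p.1 * x p.2)) *
        Real.exp (-((1 + 14 * m ^ 2) * ∑ p ∈ freePairs f g, u p)) := by
        refine mul_le_mul (stabilityWeight_le_prod_freePairs hx0 hx1) ?_ (Real.exp_pos _).le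
          (Finset.prod_nonneg fun p _ => by linarith [hxx p.1 p.2])
        refine Real.exp_le_exp.2 (neg_le_neg (mul_le_mul_of_nonneg_left hsum (by positivity)))
    _ ≤ _ := by
        rw [Finset.mul_sum, ← Finset.sum_neg_distrib, Real.exp_sum, ← Finset.prod_mul_distrib]
        refine Finset.prod_le_prod (fun p _ => mul_nonneg (by linarith [hxx p.1 p.2])
          (Real.exp_pos _).le) fun p _ => ?_
        have h := exp_le_one_sub_of_small hm (hxx p.1 p.2)
          (hu0 p) (by simp only [hu]; linarith [hxd p.1 p.2, hxd p.2 p.1, hdd p.1 p.2])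
        refine h.trans (le_of_eq ?_)
        rw [hz, hz]; simp only [hu]; ring

end Products

/-! ### Integrating out the new values for a fixed alternating set. -/

section NewValues

open scoped ENNReal

theorem unitLaw_eq_restrict_halfLine : unitLaw = halfLine.restrict (Set.Icc 0 1) := by
  rw [halfLine, Measure.restrict_restrict measurableSet_Icc, unitLaw]
  congr 1
  ext x
  simp only [Set.mem_inter_iff, Set.mem_Icc, Set.mem_Ici]
  tauto

theorem pi_unitLaw (ι : Type*) [Fintype ι] : Measure.pi (fun _ : ι => unitLaw) =
    (Measure.pi fun _ : ι => halfLine).restrict (Set.univ.pi fun _ => Set.Icc 0 1) := by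
  rw [Measure.restrict_pi_pi, ← unitLaw_eq_restrict_halfLine]

theorem ae_pi_unitLaw (ι : Type*) [Fintype ι] :
    ∀ᵐ y ∂Measure.pi (fun _ : ι => unitLaw), ∀ i, y i ∈ Set.Icc (0 : ℝ) 1 := by
  rw [pi_unitLaw]
  filter_upwards [ae_restrict_mem (MeasurableSet.univ_pi fun _ => measurableSet_Icc)] with y hy i
  exact hy i (Set.mem_univ i)

theorem unitLaw_Iio {u : ℝ} (h1 : u ≤ 1) : unitLaw (Set.Iio u) = ENNReal.ofReal u := by
  rw [← unitLaw_Iic h1]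
  refine measure_congr ?_
  have : NullSingletonClass unitLaw := by unfold unitLaw; infer_instance
  exact Iio_ae_eq_Iic

theorem lintegral_unitLaw_exp_le (a : ℝ) {σ : ℝ} (hσ : 0 < σ) :
    ∫⁻ y, (Set.Ioi a).indicator 1 y * ENNReal.ofReal (Real.exp (-(σ * max (y - a) 0))) ∂unitLaw ≤
      ENNReal.ofReal σ⁻¹ := by
  have h0 := lintegral_halfLine_pow_mul_exp 0 hσ
  simp only [pow_zero, one_mul, Nat.factorial_zero, Nat.cast_one, zero_add, pow_one,
    one_div] at h0
  rw [← h0, halfLine, ← lintegral_indicator measurableSet_Ici,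
    ← lintegral_sub_right_eq_self (fun x => (Set.Ici 0).indicator
      (fun x => ENNReal.ofReal (Real.exp (-(σ * x)))) x) a]
  refine (lintegral_mono' Measure.restrict_le_self le_rfl).trans (lintegral_mono fun y => ?_)
  by_cases hy : a < y
  · rw [Set.indicator_of_mem (show y ∈ Set.Ioi a from hy),
      Set.indicator_of_mem (show y - a ∈ Set.Ici 0 from (sub_pos.2 hy).le),
      max_eq_left (sub_pos.2 hy).le]
    simp
  · rw [Set.indicator_of_notMem (show y ∉ Set.Ioi a from hy), zero_mul]
    exact zero_le

theorem le_lintegral_unitLaw_exp {a m s : ℝ} (ha : 0 ≤ a) (hm : 0 ≤ m) (ham : a + m ≤ 1)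
    (hs : 0 < s) :
    ENNReal.ofReal ((1 - Real.exp (-(s * m))) / s) ≤
      ∫⁻ y, (Set.Ioc a (a + m)).indicator (fun y => ENNReal.ofReal (Real.exp (-(s * (y - a))))) y
        ∂unitLaw := by
  have hsub : Set.Ioc a (a + m) ⊆ Set.Icc 0 1 := fun y hy => ⟨ha.trans hy.1.le, hy.2.trans ham⟩
  have hF : ∀ y ∈ Set.uIcc a (a + m), HasDerivAt (fun y => -Real.exp (-(s * (y - a))) / s)
      (Real.exp (-(s * (y - a)))) y := by
    intro y _
    have h1 : HasDerivAt (fun y => -(s * (y - a))) (-(s * 1)) y :=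
      (((hasDerivAt_id y).sub_const a).const_mul s).neg
    have h2 := (h1.exp.neg).div_const s
    exact h2.congr_deriv (by field_simp)
  have hint := intervalIntegral.integral_eq_sub_of_hasDerivAt hF
    (Continuous.intervalIntegrable (by fun_prop) _ _)
  have hval : ∫ y in a..(a + m), Real.exp (-(s * (y - a))) = (1 - Real.exp (-(s * m))) / s := by
    rw [hint]; simp; ring
  rw [lintegral_indicator measurableSet_Ioc, unitLaw, Measure.restrict_restrict measurableSet_Ioc,
    Set.inter_eq_left.2 hsub, ← hval, intervalIntegral.integral_of_le (by linarith),
    ofReal_integral_eq_lintegral_ofReal]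
  · exact (Continuous.integrableOn_Icc (by fun_prop)).mono_set Set.Ioc_subset_Icc_self
  · exact Filter.Eventually.of_forall fun y => (Real.exp_pos _).le

variable {n : ℕ} {f g : Fin n → Fin n}

theorem extend_of_notMem {x : Fin n → ℝ} {y : Moved f g → ℝ} {i : Fin n} (hi : i ∉ moved f g) :
    extend x y i = x i := by simp [extend, hi]

theorem extend_coe (x : Fin n → ℝ) (y : Moved f g → ℝ) (t : Moved f g) :
    extend x y t = y t := by simp [extend, t.2]

theorem extend_mem_Icc {x : Fin n → ℝ} {y : Moved f g → ℝ} (hx : ∀ i, x i ∈ Set.Icc (0 : ℝ) 1)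
    (hy : ∀ t, y t ∈ Set.Icc (0 : ℝ) 1) (i : Fin n) : extend x y i ∈ Set.Icc (0 : ℝ) 1 := by
  unfold extend
  split_ifs
  · exact hy _
  · exact hx i

theorem prod_freePair (h : Fin n × Fin n → ℝ≥0∞) :
    ∏ p : FreePair f g, h p.1 = ∏ p ∈ freePairs f g, h p :=
  (Finset.prod_subtype (freePairs f g) (fun _ => mem_freePairs) h).symm

theorem prod_moved_ite {S : Finset (Fin n)} (hS : S ⊆ moved f g) (a : Fin n → ℝ≥0∞) (b : ℝ≥0∞) :
    ∏ t : Moved f g, (if t.1 ∈ S then a t.1 else b) =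
      (∏ i ∈ S, a i) * b ^ (moved f g \ S).card := by
  rw [← Finset.prod_subtype (moved f g) (fun _ => Iff.rfl) fun i => if i ∈ S then a i else b,
    ← Finset.prod_sdiff hS, mul_comm, ← Finset.prod_const]
  congr 1
  · exact Finset.prod_congr rfl fun i hi => by simp [hi]
  · exact Finset.prod_congr rfl fun i hi => by simp [(Finset.mem_sdiff.1 hi).2]

theorem sum_moved (h : Fin n → ℝ) : ∑ t : Moved f g, h t.1 = ∑ i ∈ moved f g, h i :=
  (Finset.sum_subtype (moved f g) (fun _ => Iff.rfl) h).symm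

theorem prod_freeProb_le (hf : f.Involutive) (hg : g.Involutive) {x : Fin n → ℝ}
    (hx : ∀ i, x i ∈ Set.Icc (0 : ℝ) 1) {y : Moved f g → ℝ} (hy : ∀ t, y t ∈ Set.Icc (0 : ℝ) 1) :
    ∏ p : FreePair f g, freeProb (x p.1.1) (x p.1.2) (extend x y p.1.1) (extend x y p.1.2) ≤
      ENNReal.ofReal (∏ p ∈ freePairs f g, (1 - x p.1 * x p.2)) *
        ∏ t : Moved f g, ENNReal.ofReal
          (Real.exp (-((∑ i with i ∉ moved f g, x i) * max (y t - x t) 0))) := by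
  have hY := extend_mem_Icc (f := f) (g := g) hx hy
  rw [prod_freePair fun p => freeProb (x p.1) (x p.2) (extend x y p.1) (extend x y p.2)]
  have h1 := prod_freePairs_max_le hf hg (fun i => (hx i).1) (fun i => (hx i).2)
    (fun i hi => extend_of_notMem (y := y) hi) (fun i => (hY i).1) (fun i => (hY i).2)
  calc _ ≤ ∏ p ∈ freePairs f g, ENNReal.ofReal
        (1 - max (x p.1 * x p.2) (extend x y p.1 * extend x y p.2)) :=
        Finset.prod_le_prod' fun p _ => freeProb_le (hx _) (hx _) (hY _) (hY _)
    _ = ENNReal.ofReal (∏ p ∈ freePairs f g,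
        (1 - max (x p.1 * x p.2) (extend x y p.1 * extend x y p.2))) := by
        rw [ENNReal.ofReal_prod_of_nonneg]
        intro p _
        exact sub_nonneg.2 (max_le (mul_le_one₀ (hx _).2 (hx _).1 (hx _).2)
          (mul_le_one₀ (hY _).2 (hY _).1 (hY _).2))
    _ ≤ _ := ENNReal.ofReal_le_ofReal h1
    _ = _ := by
        rw [ENNReal.ofReal_mul (Finset.prod_nonneg fun p _ =>
          sub_nonneg.2 (mul_le_one₀ (hx _).2 (hx _).1 (hx _).2)),
          ← ENNReal.ofReal_prod_of_nonneg fun _ _ => (Real.exp_pos _).le, ← Real.exp_sum,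
          Finset.sum_neg_distrib, ← Finset.mul_sum,
          ← sum_moved fun i => max (extend x y i - x i) 0]
        simp_rw [extend_coe]

/-- Once the free pairs are bounded by exponentials in the excesses, the integrand factorises over
the moved vertices: a vertex of `S` has no excess and gives the length `x t`, any other gives at
most `1 / σ`, and there are equally many of both. -/
theorem lintegral_pattern_le (hf : f.Involutive) (hg : g.Involutive) {x : Fin n → ℝ}
    (hx : ∀ i, x i ∈ Set.Icc (0 : ℝ) 1) {S : Finset (Fin n)} (hS : S ∈ alternatingSets f g)
    (hσ : 0 < ∑ i with i ∉ moved f g, x i) :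
    ∫⁻ y, (∏ t, patternWeight f g S x t (y t)) * ∏ p : FreePair f g,
        freeProb (x p.1.1) (x p.1.2) (extend x y p.1.1) (extend x y p.1.2)
        ∂(Measure.pi fun _ => unitLaw) ≤
      ENNReal.ofReal (∏ p ∈ freePairs f g, (1 - x p.1 * x p.2)) *
        ((∏ i ∈ S, ENNReal.ofReal (x i)) *
          ENNReal.ofReal (∑ i with i ∉ moved f g, x i)⁻¹ ^ S.card) := by
  set σ := ∑ i with i ∉ moved f g, x i
  have hm : ∀ t : Moved f g, Measurable fun y => patternWeight f g S x t y *
      ENNReal.ofReal (Real.exp (-(σ * max (y - x t) 0))) := fun t =>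
    (measurable_patternWeight f g S x t).mul (by fun_prop)
  calc _ ≤ ∫⁻ y, ENNReal.ofReal (∏ p ∈ freePairs f g, (1 - x p.1 * x p.2)) *
        ∏ t : Moved f g, (patternWeight f g S x t (y t) *
          ENNReal.ofReal (Real.exp (-(σ * max (y t - x t) 0)))) ∂(Measure.pi fun _ => unitLaw) := by
        refine lintegral_mono_ae ?_
        filter_upwards [ae_pi_unitLaw (Moved f g)] with y hy
        rw [Finset.prod_mul_distrib, mul_left_comm]
        exact mul_le_mul' le_rfl (prod_freeProb_le hf hg hx hy)
    _ = ENNReal.ofReal (∏ p ∈ freePairs f g, (1 - x p.1 * x p.2)) *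
        ∏ t : Moved f g, ∫⁻ y, patternWeight f g S x t y *
          ENNReal.ofReal (Real.exp (-(σ * max (y - x t) 0))) ∂unitLaw := by
        rw [lintegral_const_mul' _ _ ENNReal.ofReal_ne_top]
        congr 1
        exact lintegral_pi_prod_eq_prod (fun _ => unitLaw) (fun (t : Moved f g) y =>
          patternWeight f g S x t y * ENNReal.ofReal (Real.exp (-(σ * max (y - x t) 0)))) hm
    _ ≤ ENNReal.ofReal (∏ p ∈ freePairs f g, (1 - x p.1 * x p.2)) *
        ∏ t : Moved f g, (if t.1 ∈ S then ENNReal.ofReal (x t.1) else ENNReal.ofReal σ⁻¹) := by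
        refine mul_le_mul' le_rfl (Finset.prod_le_prod' fun t _ => ?_)
        unfold patternWeight
        split_ifs with h
        · rw [← unitLaw_Iio (hx t).2, ← lintegral_indicator_one measurableSet_Iio]
          refine lintegral_mono fun y => mul_le_of_le_one_right zero_le ?_
          rw [ENNReal.ofReal_le_one, Real.exp_le_one_iff, neg_nonpos]
          exact mul_nonneg hσ.le (le_max_right _ _)
        · exact lintegral_unitLaw_exp_le _ hσ
    _ = _ := by
        rw [prod_moved_ite (mem_alternatingSets.1 hS).1 fun i => ENNReal.ofReal (x i),
          card_moved_sdiff hf hg hS]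

/-- The excesses are truncated at `m`, where the lower bound for the free pairs is valid; each
truncation costs a factor `1 - exp (-(s * m))`. The hypothesis `hE` collects all second-order terms
of the exponent into one constant `E`, after which the integrand factorises. -/
theorem le_lintegral_pattern (hf : f.Involutive) (hg : g.Involutive) {x : Fin n → ℝ} {m E : ℝ}
    (hm0 : 0 ≤ m) (hm : m ^ 2 ≤ 1 / 100) (hx0 : ∀ i, 0 ≤ x i) (hxm : ∀ i, x i ≤ m)
    {S : Finset (Fin n)} (hS : S ∈ alternatingSets f g) (hs : 0 < ∑ i, x i)
    (hE : ∀ d, 0 ≤ d → d ≤ (moved f g).card * m →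
      (1 + 14 * m ^ 2) * ((∑ i, x i) * d + d ^ 2) ≤ (∑ i, x i) * d + E) :
    ENNReal.ofReal (stabilityWeight f x * Real.exp (-E)) *
        ((∏ i ∈ S, ENNReal.ofReal (x i)) *
          ENNReal.ofReal ((1 - Real.exp (-((∑ i, x i) * m))) / ∑ i, x i) ^ S.card) ≤
      ∫⁻ y, (∏ t, patternWeight f g S x t (y t)) * ∏ p : FreePair f g,
        freeProb (x p.1.1) (x p.1.2) (extend x y p.1.1) (extend x y p.1.2)
        ∂(Measure.pi fun _ => unitLaw) := by
  have hm1 : m ≤ 1 / 10 := by nlinarith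
  have hx : ∀ i, x i ∈ Set.Icc (0 : ℝ) 1 := fun i => ⟨hx0 i, by linarith [hxm i]⟩
  set s := ∑ i, x i
  have hD0 : 0 ≤ stabilityWeight f x := Finset.prod_nonneg fun p _ =>
    sub_nonneg.2 (mul_le_one₀ (hx _).2 (hx _).1 (hx _).2)
  set h : Moved f g → ℝ → ℝ≥0∞ := fun t => if t.1 ∈ S then (Set.Iio (x t)).indicator 1 else
    (Set.Ioc (x t) (x t + m)).indicator (fun y => ENNReal.ofReal (Real.exp (-(s * (y - x t)))))
    with hh
  have hmeas : ∀ t, Measurable (h t) := by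
    intro t
    simp only [hh]
    split_ifs
    · exact measurable_one.indicator measurableSet_Iio
    · exact Measurable.indicator (by fun_prop) measurableSet_Ioc
  calc _ ≤ ENNReal.ofReal (stabilityWeight f x * Real.exp (-E)) *
        ∏ t : Moved f g, (if t.1 ∈ S then ENNReal.ofReal (x t.1) else
          ENNReal.ofReal ((1 - Real.exp (-(s * m))) / s)) := by
        rw [prod_moved_ite (mem_alternatingSets.1 hS).1 fun i => ENNReal.ofReal (x i),
          card_moved_sdiff hf hg hS]
    _ ≤ ENNReal.ofReal (stabilityWeight f x * Real.exp (-E)) *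
        ∏ t : Moved f g, ∫⁻ y, h t y ∂unitLaw := by
        refine mul_le_mul' le_rfl (Finset.prod_le_prod' fun t _ => ?_)
        simp only [hh]
        split_ifs with hS'
        · rw [lintegral_indicator_one measurableSet_Iio, unitLaw_Iio (hx t).2]
        · exact le_lintegral_unitLaw_exp (hx0 _) hm0 (by linarith [hxm t]) hs
    _ = ∫⁻ y, ENNReal.ofReal (stabilityWeight f x * Real.exp (-E)) *
        ∏ t : Moved f g, h t (y t) ∂(Measure.pi fun _ => unitLaw) := by
        rw [lintegral_const_mul' _ _ ENNReal.ofReal_ne_top]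
        congr 1
        exact (lintegral_pi_prod_eq_prod (fun _ => unitLaw) h hmeas).symm
    _ ≤ _ := by
        refine lintegral_mono_ae ?_
        filter_upwards [ae_pi_unitLaw (Moved f g)] with y hy
        have hY := extend_mem_Icc (f := f) (g := g) hx hy
        by_cases hym : ∀ t, y t ≤ x t + m
        · have hYm : ∀ i, extend x y i ≤ x i + m := by
            intro i
            by_cases hi : i ∈ moved f g
            · have := hym ⟨i, hi⟩
              rwa [← extend_coe x y] at this
            · rw [extend_of_notMem hi]; linarith
          have h1 := le_prod_freePairs_max hx0 hm0 hm hxm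
            (fun i hi => extend_of_notMem (f := f) (g := g) (y := y) hi) hYm
          set d := ∑ i ∈ moved f g, max (extend x y i - x i) 0 with hd
          have hd0 : 0 ≤ d := Finset.sum_nonneg fun i _ => le_max_right _ _
          have hd1 : d ≤ (moved f g).card * m := by
            rw [← nsmul_eq_mul, ← Finset.sum_const]
            exact Finset.sum_le_sum fun i _ => max_le (by linarith [hYm i]) hm0
          have h2 : ENNReal.ofReal (stabilityWeight f x * Real.exp (-E) * Real.exp (-(s * d))) ≤
              ∏ p : FreePair f g,
                freeProb (x p.1.1) (x p.1.2) (extend x y p.1.1) (extend x y p.1.2) := by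
            rw [prod_freePair fun p => freeProb (x p.1) (x p.2) (extend x y p.1) (extend x y p.2)]
            calc _ ≤ ENNReal.ofReal (∏ p ∈ freePairs f g,
                  (1 - max (x p.1) (extend x y p.1) * max (x p.2) (extend x y p.2))) := by
                  refine ENNReal.ofReal_le_ofReal (le_trans ?_ h1)
                  rw [mul_assoc, ← Real.exp_add]
                  refine mul_le_mul_of_nonneg_left (Real.exp_le_exp.2 ?_) hD0
                  linarith [hE d hd0 hd1]
              _ = ∏ p ∈ freePairs f g, ENNReal.ofReal
                  (1 - max (x p.1) (extend x y p.1) * max (x p.2) (extend x y p.2)) := by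
                  rw [ENNReal.ofReal_prod_of_nonneg]
                  intro p _
                  exact sub_nonneg.2 (mul_le_one₀ (max_le (hx _).2 (hY _).2)
                    (le_max_of_le_left (hx0 _)) (max_le (hx _).2 (hY _).2))
              _ ≤ _ := Finset.prod_le_prod' fun p _ => le_freeProb (hx _) (hx _) (hY _) (hY _)
          have h3 : ∏ t : Moved f g, h t (y t) ≤ (∏ t, patternWeight f g S x t (y t)) *
              ENNReal.ofReal (Real.exp (-(s * d))) := by
            rw [hd, ← sum_moved fun i => max (extend x y i - x i) 0, Finset.mul_sum,
              ← Finset.sum_neg_distrib, Real.exp_sum,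
              ENNReal.ofReal_prod_of_nonneg fun _ _ => (Real.exp_pos _).le,
              ← Finset.prod_mul_distrib]
            refine Finset.prod_le_prod' fun t _ => ?_
            simp only [extend_coe, hh, patternWeight]
            split_ifs with hS'
            · by_cases hlt : y t < x t
              · rw [Set.indicator_of_mem (show y t ∈ Set.Iio (x t) from hlt),
                  max_eq_right (sub_nonpos.2 hlt.le)]
                simp
              · rw [Set.indicator_of_notMem (show y t ∉ Set.Iio (x t) from hlt)]
                exact zero_le
            · by_cases hlt : y t ∈ Set.Ioc (x t) (x t + m)
              · rw [Set.indicator_of_mem hlt,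
                  Set.indicator_of_mem (show y t ∈ Set.Ioi (x t) from hlt.1),
                  max_eq_left (sub_nonneg.2 hlt.1.le)]
                simp
              · rw [Set.indicator_of_notMem hlt]; exact zero_le
          calc _ ≤ ENNReal.ofReal (stabilityWeight f x * Real.exp (-E)) *
                ((∏ t, patternWeight f g S x t (y t)) * ENNReal.ofReal (Real.exp (-(s * d)))) :=
                mul_le_mul' le_rfl h3
            _ = (∏ t, patternWeight f g S x t (y t)) * ENNReal.ofReal
                (stabilityWeight f x * Real.exp (-E) * Real.exp (-(s * d))) := by
                rw [ENNReal.ofReal_mul (p := stabilityWeight f x * Real.exp (-E))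
                  (mul_nonneg hD0 (Real.exp_pos _).le)]
                ring
            _ ≤ _ := mul_le_mul' le_rfl h2
        -- Outside the truncation range the minorant `h` vanishes.
        · push Not at hym
          obtain ⟨t, ht⟩ := hym
          have : ∏ t : Moved f g, h t (y t) = 0 := by
            refine Finset.prod_eq_zero (Finset.mem_univ t) ?_
            simp only [hh]
            split_ifs
            · exact Set.indicator_of_notMem (fun h => by
                have h' : y t < x t := h
                linarith) _
            · exact Set.indicator_of_notMem (fun h => by
                have h' := h.2
                linarith) _
          rw [this, mul_zero]
          exact zero_le

end NewValues

/-! ### Comparison with the Gaussian weight at a quasirandom point. -/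

section Pointwise

open scoped ENNReal

/-- The number of people is large in terms of the number of changed edges. -/
structure SizeConditions (n k : ℕ) : Prop where
  log_ge : 30 ≤ Real.log n
  sqrt_ge : 20 * ((k : ℝ) + 1) * Real.log n ≤ Real.sqrt n
  card_le : 8 * (k : ℝ) / n ≤ (n : ℝ) ^ (-(1 / 3) : ℝ)
  sq_le : (1 + (k : ℝ)) ^ 2 * Real.log n ^ 2 * (Real.log n ^ 2 / Real.sqrt n) ^ 2 ≤
    (n : ℝ) ^ (-(1 / 3) : ℝ) / 100

namespace SizeConditions

variable {n k : ℕ}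

theorem pos (h : SizeConditions n k) : 0 < n := by
  rcases Nat.eq_zero_or_pos n with rfl | h'
  · have := h.log_ge; norm_num at this
  · exact h'

theorem cast_pos (h : SizeConditions n k) : (0 : ℝ) < n := by exact_mod_cast h.pos

theorem rpow_eq_exp (h : SizeConditions n k) :
    (n : ℝ) ^ (-(1 / 3) : ℝ) = Real.exp (-(1 / 3) * Real.log n) := by
  rw [Real.rpow_def_of_pos h.cast_pos, mul_comm]

theorem rpow_pos (h : SizeConditions n k) : 0 < (n : ℝ) ^ (-(1 / 3) : ℝ) :=
  Real.rpow_pos_of_pos h.cast_pos _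

theorem rpow_le (h : SizeConditions n k) : (n : ℝ) ^ (-(1 / 3) : ℝ) ≤ 1 / 20000 := by
  rw [h.rpow_eq_exp]
  have h1 : Real.exp (-(1 / 3) * Real.log n) ≤ Real.exp (-10) :=
    Real.exp_le_exp.2 (by linarith [h.log_ge])
  have h2 : (20000 : ℝ) ≤ Real.exp 10 := by
    have h3 : Real.exp 10 = Real.exp 1 ^ 10 := by rw [← Real.exp_nat_mul]; norm_num
    rw [h3]
    have h4 := Real.exp_one_gt_d9.le
    calc (20000 : ℝ) ≤ (2.7182818283 : ℝ) ^ 10 := by norm_num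
      _ ≤ _ := pow_le_pow_left₀ (by norm_num) h4 10
  rw [Real.exp_neg] at h1
  refine h1.trans ?_
  rw [one_div]
  exact inv_anti₀ (by norm_num) h2

/-- The denominator of the conditional probability is the case `k = 0`. -/
theorem mono (h : SizeConditions n k) : SizeConditions n 0 where
  log_ge := h.log_ge
  sqrt_ge := by
    refine le_trans ?_ h.sqrt_ge
    have := h.log_ge
    have hk : (0 : ℝ) ≤ k := Nat.cast_nonneg k
    push_cast
    nlinarith
  card_le := by simpa using h.rpow_pos.le
  sq_le := by
    refine le_trans ?_ h.sq_le
    have hk : (0 : ℝ) ≤ k := Nat.cast_nonneg k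
    gcongr
    exact Nat.zero_le k

theorem sq_mul_le (h : SizeConditions n k) :
    (1 + (k : ℝ)) ^ 2 * (Real.log n ^ 2 / Real.sqrt n) ^ 2 ≤
      (n : ℝ) ^ (-(1 / 3) : ℝ) / 90000 := by
  have h1 := h.sq_le
  have h2 := h.log_ge
  set B := (1 + (k : ℝ)) ^ 2 * (Real.log n ^ 2 / Real.sqrt n) ^ 2 with hB
  have hB0 : 0 ≤ B := by positivity
  have h3 : (1 + (k : ℝ)) ^ 2 * Real.log n ^ 2 * (Real.log n ^ 2 / Real.sqrt n) ^ 2 =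
      Real.log n ^ 2 * B := by rw [hB]; ring
  rw [h3] at h1
  have h4 : 900 * B ≤ Real.log n ^ 2 * B := mul_le_mul_of_nonneg_right (by nlinarith) hB0
  linarith

theorem sq_le_div (h : SizeConditions n k) :
    (Real.log n ^ 2 / Real.sqrt n) ^ 2 ≤ (n : ℝ) ^ (-(1 / 3) : ℝ) / 90000 := by
  simpa using h.mono.sq_mul_le

end SizeConditions

variable {n k : ℕ} {f g : Fin n → Fin n} {x : Fin n → ℝ}

theorem sum_bounds_of_mem_quasirandomSet (h : SizeConditions n k) (hx : x ∈ quasirandomSet f) :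
    Real.sqrt n / 2 ≤ ∑ i, x i ∧ ∑ i, x i ≤ 2 * Real.sqrt n := by
  have h1 := abs_le.1 hx.1
  have h2 := h.mono.sqrt_ge
  norm_num at h2
  constructor <;> linarith

theorem card_moved (hf : f.Involutive) (hg : g.Involutive) {S : Finset (Fin n)}
    (hS : S ∈ alternatingSets f g) : (moved f g).card = 2 * S.card := by
  rw [← Finset.card_sdiff_add_card_eq_card (mem_alternatingSets.1 hS).1, card_moved_sdiff hf hg hS]
  ring

theorem gaussWeight_eq_mul (S : Finset (Fin n)) (hx0 : ∀ i, 0 ≤ x i) {c : ℝ} (hc : 0 ≤ c) :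
    ENNReal.ofReal c * gaussWeight S x = ENNReal.ofReal
      (c * (((∑ i, x i) ^ S.card)⁻¹ * Real.exp (-(∑ i, x i) ^ 2 / 2))) *
        ∏ i ∈ S, ENNReal.ofReal (x i) := by
  have hs : 0 ≤ ∑ i, x i := Finset.sum_nonneg fun i _ => hx0 i
  rw [gaussWeight, ENNReal.ofReal_mul hc, ENNReal.ofReal_mul (by positivity)]
  ring

theorem one_le_add_one_mul_sq {δ : ℝ} (h0 : 0 ≤ δ) (h1 : δ ≤ 1 / 20000) :
    1 ≤ (δ + 1) * (1 - δ / 25) ^ 2 := by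
  have h2 : 1 - 2 * (δ / 25) ≤ (1 - δ / 25) ^ 2 := by nlinarith [sq_nonneg (δ / 25)]
  have h3 : 1 ≤ (δ + 1) * (1 - 2 * (δ / 25)) := by nlinarith
  exact h3.trans (mul_le_mul_of_nonneg_left h2 (by linarith))

set_option maxHeartbeats 1000000 in
-- Two replacements are made in `lintegral_pattern_le`: the product over free pairs by
-- `stabilityWeight`, and the unmoved sum `σ` by `s`. Each costs a factor `1 - δ/25`, and together
-- they turn `exp (4δ)` into `exp (5δ)`.
theorem lintegral_pattern_le_gaussWeight (h : SizeConditions n k) (hf : f.Involutive)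
    (hg : g.Involutive) (hf0 : ∀ i, f i ≠ i) {S : Finset (Fin n)} (hS : S ∈ alternatingSets f g)
    (hSk : S.card = k) (hx : x ∈ quasirandomSet f) (hx0 : ∀ i, 0 ≤ x i) :
    ∫⁻ y, (∏ t, patternWeight f g S x t (y t)) * ∏ p : FreePair f g,
        freeProb (x p.1.1) (x p.1.2) (extend x y p.1.1) (extend x y p.1.2)
        ∂(Measure.pi fun _ => unitLaw) ≤
      ENNReal.ofReal (Real.exp (5 * (n : ℝ) ^ (-(1 / 3) : ℝ)) * Real.exp (1 / 2)) *
        gaussWeight S x := by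
  have hnp := h.cast_pos
  have hr0 : 0 < Real.sqrt n := Real.sqrt_pos.2 hnp
  have hrn : Real.sqrt n ^ 2 = n := Real.sq_sqrt hnp.le
  have hl := h.log_ge
  have hT := card_moved hf hg hS
  rw [hSk] at hT
  obtain ⟨hs1, hs2⟩ := sum_bounds_of_mem_quasirandomSet h hx
  have hδ0 := h.rpow_pos
  have hδ1 := h.rpow_le
  have hsq := h.sq_mul_le
  have hm2 := h.sq_le_div
  have hm3 := h.sq_le
  set δ := (n : ℝ) ^ (-(1 / 3) : ℝ) with hδ
  set r := Real.sqrt n with hr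
  set m := Real.log n ^ 2 / r with hm
  have hxm : ∀ i, x i ≤ m := hx.2.1
  have hm0 : 0 ≤ m := by positivity
  have hm1 : m ≤ 1 / 10 := by nlinarith
  have hx1 : ∀ i, x i ≤ 1 := fun i => by linarith [hxm i]
  have hx' : ∀ i, x i ∈ Set.Icc (0 : ℝ) 1 := fun i => ⟨hx0 i, hx1 i⟩
  have hk0 : (0 : ℝ) ≤ k := Nat.cast_nonneg k
  obtain ⟨-, hD⟩ := stabilityWeight_quasirandom hf hf0 hx0 hxm (by linarith) (by linarith)
    hx.2.2.1 hx.2.2.2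
  set s := ∑ i, x i with hs
  have hs0 : 0 < s := by linarith
  set A := ∏ p ∈ freePairs f g, (1 - x p.1 * x p.2) with hA
  have hA0 : 0 ≤ A := Finset.prod_nonneg fun p _ =>
    sub_nonneg.2 (mul_le_one₀ (hx1 _) (hx0 _) (hx1 _))
  have hAD := prod_freePairs_mul_le (f := f) (g := g) hx0 hxm hm0 (by linarith)
  rw [hT, ← hA] at hAD
  push_cast at hAD
  have hkm : 2 * k * m ^ 2 ≤ δ / 25 := by nlinarith [sq_nonneg m]
  set σ := ∑ i with i ∉ moved f g, x i with hσ
  have hσs : s - 2 * k * m ≤ σ := by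
    have h1 : ∑ i ∈ moved f g, x i ≤ 2 * k * m := by
      have : ((moved f g).card : ℝ) = 2 * k := by rw [hT]; push_cast; ring
      rw [← this, ← nsmul_eq_mul, ← Finset.sum_const]
      exact Finset.sum_le_sum fun i _ => hxm i
    have h2 := Finset.sum_filter_add_sum_filter_not Finset.univ (fun i => i ∈ moved f g) x
    have h3 : Finset.univ.filter (fun i => i ∈ moved f g) = moved f g := by ext; simp
    rw [h3] at h2
    linarith
  -- Chosen so that the moved sum, at most `2 * k * m = (r / 2) * η`, is at most `s * η`.
  set η := 4 * k * Real.log n ^ 2 / n with hη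
  have hη0 : 0 ≤ η := by positivity
  have hsη : 2 * k * m ≤ s * η := by
    have h1 : 2 * k * m = r / 2 * η := by
      rw [hη, hm, ← hrn]; field_simp; ring
    rw [h1]
    exact mul_le_mul_of_nonneg_right hs1 hη0
  have hbase : Real.log n ^ 2 / n ≤ Real.log n ^ 2 * m ^ 2 := by
    have h1 : m ^ 2 = Real.log n ^ 4 / n := by rw [hm, div_pow, hrn]; ring
    rw [h1, div_eq_mul_one_div]
    refine mul_le_mul_of_nonneg_left ?_ (by positivity)
    refine div_le_div_of_nonneg_right ?_ hnp.le
    exact one_le_pow₀ (by linarith)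
  have hkη' : (1 + (k : ℝ)) ^ 2 * (Real.log n ^ 2 / n) ≤ δ / 100 := by
    refine le_trans ?_ hm3
    rw [mul_assoc]
    exact mul_le_mul_of_nonneg_left hbase (by positivity)
  have hLn : 0 ≤ Real.log n ^ 2 / n := by positivity
  have hkη : k * η ≤ δ / 25 := by
    have h1 : k * η = 4 * ((k : ℝ) ^ 2 * (Real.log n ^ 2 / n)) := by rw [hη]; ring
    have h2 : (k : ℝ) ^ 2 ≤ (1 + k) ^ 2 := pow_le_pow_left₀ hk0 (by linarith) 2
    have h3 := mul_le_mul_of_nonneg_right h2 hLn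
    linarith
  have hη1 : η ≤ δ / 25 := by
    have h1 : η = 4 * (k * (Real.log n ^ 2 / n)) := by rw [hη]; ring
    have h2 : (k : ℝ) ≤ (1 + k) ^ 2 := by linarith [sq_nonneg (k : ℝ)]
    have h3 := mul_le_mul_of_nonneg_right h2 hLn
    linarith
  have hσ1 : s * (1 - η) ≤ σ := by linarith
  have hσ0 : 0 < σ := lt_of_lt_of_le (mul_pos hs0 (by linarith)) hσ1
  have hpow : s ^ k * (1 - δ / 25) ≤ σ ^ k := by
    have hb := one_add_mul_le_pow (a := -η) (by linarith) k
    calc s ^ k * (1 - δ / 25) ≤ s ^ k * (1 + -η) ^ k :=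
          mul_le_mul_of_nonneg_left (by linarith) (by positivity)
      _ = (s * (1 - η)) ^ k := by rw [mul_pow]; ring
      _ ≤ _ := pow_le_pow_left₀ (mul_nonneg hs0.le (by linarith)) hσ1 k
  have hreal : A * (σ⁻¹) ^ k ≤ Real.exp (5 * δ) * Real.exp (1 / 2) *
      ((s ^ k)⁻¹ * Real.exp (-s ^ 2 / 2)) := by
    set B := Real.exp (1 / 2) * Real.exp (-s ^ 2 / 2) with hB
    have hB0 : 0 < B := by positivity
    have hu : 0 < 1 - δ / 25 := by linarith
    have h1 : A * (1 - δ / 25) ≤ Real.exp (4 * δ) * B :=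
      le_trans (mul_le_mul_of_nonneg_left (by linarith) hA0) (hAD.trans hD)
    have h2 : (σ⁻¹) ^ k * (1 - δ / 25) ≤ (s ^ k)⁻¹ := by
      rw [inv_pow, inv_mul_eq_div, div_le_iff₀ (by positivity), inv_mul_eq_div,
        le_div_iff₀ (by positivity)]
      linarith
    have h3 : 1 ≤ Real.exp δ * (1 - δ / 25) ^ 2 := by
      have h4 := Real.add_one_le_exp δ
      have h5 := one_le_add_one_mul_sq hδ0.le hδ1
      exact h5.trans (mul_le_mul_of_nonneg_right h4 (sq_nonneg _))
    have h6 : Real.exp (5 * δ) = Real.exp δ * Real.exp (4 * δ) := by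
      rw [← Real.exp_add]; congr 1; ring
    have hσk : 0 ≤ A * (σ⁻¹) ^ k := mul_nonneg hA0 (pow_nonneg (inv_nonneg.2 hσ0.le) _)
    calc A * (σ⁻¹) ^ k ≤ A * (σ⁻¹) ^ k * (Real.exp δ * (1 - δ / 25) ^ 2) :=
          le_mul_of_one_le_right hσk h3
      _ = Real.exp δ * ((A * (1 - δ / 25)) * ((σ⁻¹) ^ k * (1 - δ / 25))) := by ring
      _ ≤ Real.exp δ * ((Real.exp (4 * δ) * B) * (s ^ k)⁻¹) := by
          refine mul_le_mul_of_nonneg_left (mul_le_mul h1 h2 ?_ (by positivity)) (by positivity)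
          exact mul_nonneg (pow_nonneg (inv_nonneg.2 hσ0.le) _) hu.le
      _ = _ := by rw [h6, hB]; ring
  refine (lintegral_pattern_le hf hg hx' hS hσ0).trans ?_
  rw [gaussWeight_eq_mul S hx0 (by positivity), hSk, mul_comm (∏ i ∈ S, ENNReal.ofReal (x i)),
    ← mul_assoc]
  refine mul_le_mul' ?_ le_rfl
  rw [← ENNReal.ofReal_pow (inv_nonneg.2 hσ0.le), ← ENNReal.ofReal_mul hA0]
  exact ENNReal.ofReal_le_ofReal hreal

set_option maxHeartbeats 1000000 in
-- `le_lintegral_pattern` is applied with `E = δ`. The losses are `exp (-4δ)` from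
-- `stabilityWeight`, `exp (-δ)` from `E`, and `1 - δ` from the `k` truncations; together they leave
-- at least `1 - 6δ`.
theorem gaussWeight_le_lintegral_pattern (h : SizeConditions n k) (hf : f.Involutive)
    (hg : g.Involutive) (hf0 : ∀ i, f i ≠ i) {S : Finset (Fin n)} (hS : S ∈ alternatingSets f g)
    (hSk : S.card = k) (hx : x ∈ quasirandomSet f) (hx0 : ∀ i, 0 ≤ x i) :
    ENNReal.ofReal ((1 - 6 * (n : ℝ) ^ (-(1 / 3) : ℝ)) * Real.exp (1 / 2)) * gaussWeight S x ≤
      ∫⁻ y, (∏ t, patternWeight f g S x t (y t)) * ∏ p : FreePair f g,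
        freeProb (x p.1.1) (x p.1.2) (extend x y p.1.1) (extend x y p.1.2)
        ∂(Measure.pi fun _ => unitLaw) := by
  have hnp := h.cast_pos
  have hr0 : 0 < Real.sqrt n := Real.sqrt_pos.2 hnp
  have hrn : Real.sqrt n ^ 2 = n := Real.sq_sqrt hnp.le
  have hl := h.log_ge
  have hT := card_moved hf hg hS
  rw [hSk] at hT
  obtain ⟨hs1, hs2⟩ := sum_bounds_of_mem_quasirandomSet h hx
  have hδ0 := h.rpow_pos
  have hδ1 := h.rpow_le
  have hsq := h.sq_mul_le
  have hm2 := h.sq_le_div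
  have hm3 := h.sq_le
  have hδexp := h.rpow_eq_exp
  set δ := (n : ℝ) ^ (-(1 / 3) : ℝ) with hδ
  have hkr : (k : ℝ) ≤ Real.exp (Real.log n) := by
    rw [Real.exp_log hnp]
    have h1 := h.sqrt_ge
    have hk0 : (0 : ℝ) ≤ k := Nat.cast_nonneg k
    have h2 : (k : ℝ) + 1 ≤ Real.sqrt n := by nlinarith
    nlinarith
  set r := Real.sqrt n with hr
  set m := Real.log n ^ 2 / r with hm
  have hxm : ∀ i, x i ≤ m := hx.2.1
  have hm0 : 0 ≤ m := by positivity
  have hk0 : (0 : ℝ) ≤ k := Nat.cast_nonneg k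
  obtain ⟨hD, -⟩ := stabilityWeight_quasirandom hf hf0 hx0 hxm (by linarith) (by linarith)
    hx.2.2.1 hx.2.2.2
  set s := ∑ i, x i with hs
  have hs0 : 0 < s := by linarith
  have hrm : r * m = Real.log n ^ 2 := by rw [hm]; field_simp
  have hE : ∀ d, 0 ≤ d → d ≤ (moved f g).card * m →
      (1 + 14 * m ^ 2) * (s * d + d ^ 2) ≤ s * d + δ := by
    intro d hd0 hd
    rw [hT] at hd
    push_cast at hd
    have h1 : s * d ≤ 4 * k * Real.log n ^ 2 := by
      calc s * d ≤ (2 * r) * (2 * k * m) := mul_le_mul hs2 hd hd0 (by positivity)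
        _ = 4 * k * (r * m) := by ring
        _ = _ := by rw [hrm]
    have h2 : d ^ 2 ≤ 4 * ((1 + (k : ℝ)) ^ 2 * m ^ 2) := by
      calc d ^ 2 ≤ (2 * k * m) ^ 2 := pow_le_pow_left₀ hd0 hd 2
        _ = 4 * ((k : ℝ) ^ 2 * m ^ 2) := by ring
        _ ≤ _ := by gcongr; linarith
    have h3 : m ^ 2 * (s * d) ≤ 4 * (δ / 100) := by
      calc m ^ 2 * (s * d) ≤ m ^ 2 * (4 * k * Real.log n ^ 2) :=
            mul_le_mul_of_nonneg_left h1 (sq_nonneg _)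
        _ = 4 * (k * (Real.log n ^ 2 * m ^ 2)) := by ring
        _ ≤ 4 * ((1 + (k : ℝ)) ^ 2 * (Real.log n ^ 2 * m ^ 2)) := by
            gcongr; nlinarith
        _ ≤ _ := by linarith
    have h4 : m ^ 2 * d ^ 2 ≤ 1 * d ^ 2 :=
      mul_le_mul_of_nonneg_right (by linarith) (sq_nonneg _)
    linarith
  have hmain := le_lintegral_pattern hf hg hm0 (by linarith) hx0 hxm hS hs0 hE
  refine le_trans ?_ hmain
  have hsm : 15 * Real.log n ≤ s * m := by
    have : r / 2 * m ≤ s * m := mul_le_mul_of_nonneg_right hs1 hm0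
    nlinarith
  set e := Real.exp (-(s * m)) with he
  have he1 : e ≤ 1 := by
    rw [he, Real.exp_le_one_iff, neg_nonpos]; positivity
  -- Since `s * m ≥ log² n / 2 ≥ 15 log n`, the truncation error `e` is at most `n^(-15)`, while `k
  -- ≤ n`.
  have hke : k * e ≤ δ := by
    calc k * e ≤ Real.exp (Real.log n) * Real.exp (-(15 * Real.log n)) := by
          refine mul_le_mul hkr (Real.exp_le_exp.2 (by linarith)) (Real.exp_pos _).le
            (Real.exp_pos _).le
      _ ≤ _ := by
          rw [← Real.exp_add, hδexp]
          exact Real.exp_le_exp.2 (by linarith)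
  have hpow : 1 - δ ≤ (1 - e) ^ k := by
    have hb := one_add_mul_le_pow (a := -e) (by linarith) k
    rw [← sub_eq_add_neg 1 e] at hb
    linarith
  have hreal : (1 - 6 * δ) * Real.exp (1 / 2) * ((s ^ k)⁻¹ * Real.exp (-s ^ 2 / 2)) ≤
      stabilityWeight f x * Real.exp (-δ) * ((1 - e) / s) ^ k := by
    set B := Real.exp (1 / 2) * Real.exp (-s ^ 2 / 2) with hB
    have hB0 : 0 < B := by positivity
    have h1 : 1 - 6 * δ ≤ Real.exp (-(4 * δ)) * Real.exp (-δ) * (1 - δ) := by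
      have h2 := Real.add_one_le_exp (-(5 * δ))
      have h3 : Real.exp (-(4 * δ)) * Real.exp (-δ) = Real.exp (-(5 * δ)) := by
        rw [← Real.exp_add]; congr 1; ring
      rw [h3]
      nlinarith [mul_le_mul_of_nonneg_right h2 (show 0 ≤ 1 - δ by linarith)]
    calc _ = (1 - 6 * δ) * (B * (s ^ k)⁻¹) := by rw [hB]; ring
      _ ≤ (Real.exp (-(4 * δ)) * Real.exp (-δ) * (1 - δ)) * (B * (s ^ k)⁻¹) :=
          mul_le_mul_of_nonneg_right h1 (by positivity)
      _ = (Real.exp (-(4 * δ)) * B) * Real.exp (-δ) * ((1 - δ) * (s ^ k)⁻¹) := by ring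
      _ ≤ stabilityWeight f x * Real.exp (-δ) * ((1 - e) ^ k * (s ^ k)⁻¹) := by
          refine mul_le_mul (mul_le_mul_of_nonneg_right hD (Real.exp_pos _).le)
            (mul_le_mul_of_nonneg_right hpow (by positivity)) ?_ ?_
          · exact mul_nonneg (by linarith) (by positivity)
          · exact mul_nonneg (le_trans (by positivity) hD) (Real.exp_pos _).le
      _ = _ := by rw [div_pow]; ring
  rw [gaussWeight_eq_mul S hx0 (mul_nonneg (by linarith) (Real.exp_pos _).le), hSk]
  conv_rhs => rw [mul_comm (∏ i ∈ S, ENNReal.ofReal (x i)), ← mul_assoc]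
  refine mul_le_mul' ?_ le_rfl
  rw [← ENNReal.ofReal_pow (div_nonneg (by linarith) hs0.le), ← ENNReal.ofReal_mul]
  · exact ENNReal.ofReal_le_ofReal hreal
  · exact mul_nonneg (le_trans (by positivity) hD) (Real.exp_pos _).le

end Pointwise

/-! ### Integrating the Gaussian weight over the quasirandom set. -/

section Integration

open scoped ENNReal

variable {n k : ℕ} {f g : Fin n → Fin n}

theorem measurable_freeProb (u v : ℝ) : Measurable fun q : ℝ × ℝ => freeProb u v q.1 q.2 := by
  unfold freeProb
  refine Measurable.lintegral_prod_right' (f := fun r : (ℝ × ℝ) × ℝ =>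
    ∫⁻ b, {q : ℝ × ℝ | (u < q.1 ∨ v < q.2) ∧ (r.1.1 < q.1 ∨ r.1.2 < q.2)}.indicator 1 (r.2, b)
      ∂unitLaw) ?_
  refine Measurable.lintegral_prod_right' (f := fun r : ((ℝ × ℝ) × ℝ) × ℝ =>
    {q : ℝ × ℝ | (u < q.1 ∨ v < q.2) ∧ (r.1.1.1 < q.1 ∨ r.1.1.2 < q.2)}.indicator 1
      (r.1.2, r.2)) ?_
  have h (F G : ((ℝ × ℝ) × ℝ) × ℝ → ℝ) (hF : Measurable F) (hG : Measurable G) :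
      MeasurableSet {r | F r < G r} := measurableSet_lt hF hG
  have hs : MeasurableSet {r : ((ℝ × ℝ) × ℝ) × ℝ |
      (u < r.1.2 ∨ v < r.2) ∧ (r.1.1.1 < r.1.2 ∨ r.1.1.2 < r.2)} :=
    ((h (fun _ => u) (fun r => r.1.2) (by fun_prop) (by fun_prop)).union
      (h (fun _ => v) (fun r => r.2) (by fun_prop) (by fun_prop))).inter
      ((h (fun r => r.1.1.1) (fun r => r.1.2) (by fun_prop) (by fun_prop)).union
      (h (fun r => r.1.1.2) (fun r => r.2) (by fun_prop) (by fun_prop)))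
  exact (measurable_one (α := ℝ≥0∞) (β := ((ℝ × ℝ) × ℝ) × ℝ)).indicator hs

theorem measurable_extend (x : Fin n → ℝ) (i : Fin n) :
    Measurable fun y : Moved f g → ℝ => extend x y i := by
  unfold extend
  split_ifs
  · exact measurable_pi_apply _
  · exact measurable_const

theorem lintegral_sum_pattern (x : Fin n → ℝ) :
    ∫⁻ y, (∑ S ∈ alternatingSets f g, ∏ t, patternWeight f g S x t (y t)) *
        ∏ p : FreePair f g, freeProb (x p.1.1) (x p.1.2) (extend x y p.1.1) (extend x y p.1.2)
        ∂(Measure.pi fun _ => unitLaw) =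
      ∑ S ∈ alternatingSets f g, ∫⁻ y, (∏ t, patternWeight f g S x t (y t)) *
        ∏ p : FreePair f g, freeProb (x p.1.1) (x p.1.2) (extend x y p.1.1) (extend x y p.1.2)
        ∂(Measure.pi fun _ => unitLaw) := by
  simp_rw [Finset.sum_mul]
  refine lintegral_finsetSum _ fun S _ => ?_
  refine Measurable.mul ?_ ?_
  · exact Finset.measurable_prod _ fun t _ =>
      (measurable_patternWeight f g S x t).comp (measurable_pi_apply t)
  · exact Finset.measurable_prod _ fun p _ => (measurable_freeProb _ _).comp
      ((measurable_extend x _).prodMk (measurable_extend x _))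

theorem setLIntegral_unitLaw_le_halfLine (A : Set (Fin n → ℝ)) (F : (Fin n → ℝ) → ℝ≥0∞) :
    ∫⁻ x in A, F x ∂(Measure.pi fun _ => unitLaw) ≤
      ∫⁻ x in A, F x ∂(Measure.pi fun _ => halfLine) := by
  rw [pi_unitLaw]
  exact lintegral_mono' (Measure.restrict_mono le_rfl Measure.restrict_le_self) le_rfl

theorem setLIntegral_gaussWeight_le (hn : 0 < n) (S : Finset (Fin n)) (A : Set (Fin n → ℝ)) :
    ∫⁻ x in A, gaussWeight S x ∂(Measure.pi fun _ => unitLaw) ≤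
      ENNReal.ofReal (((n : ℝ) ^ S.card)⁻¹) * gaussMass n := by
  refine (setLIntegral_unitLaw_le_halfLine _ _).trans ?_
  refine (setLIntegral_le_lintegral _ _).trans ?_
  rw [lintegral_gaussWeight hn]
  exact mul_le_mul' (ENNReal.ofReal_le_ofReal (factorial_div_factorial_le hn _)) le_rfl

theorem SizeConditions.sq_div_le (h : SizeConditions n k) :
    (k : ℝ) ^ 2 / n ≤ (n : ℝ) ^ (-(1 / 3) : ℝ) := by
  have h1 := h.sq_mul_le
  have hl := h.log_ge
  have hn := h.cast_pos
  rw [div_pow, Real.sq_sqrt hn.le] at h1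
  have h2 : (k : ℝ) ^ 2 / n ≤ (1 + (k : ℝ)) ^ 2 * ((Real.log n ^ 2) ^ 2 / n) := by
    rw [div_eq_mul_one_div]
    refine mul_le_mul (by gcongr; linarith) ?_ (by positivity) (by positivity)
    exact div_le_div_of_nonneg_right (one_le_pow₀ (one_le_pow₀ (by linarith))) hn.le
  linarith [h.rpow_pos]

/-- Total mass minus the mass of the complement: `3001δ` is `3000δ` for the complement plus `k²/n ≤
δ` from the factorial ratio. -/
theorem le_setLIntegral_gaussWeight (h : SizeConditions n k) {S : Finset (Fin n)}
    (hS : S.card = k) (hf : f.Involutive) (hf0 : ∀ i, f i ≠ i) :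
    ENNReal.ofReal (((n : ℝ) ^ k)⁻¹ * (1 - 3001 * (n : ℝ) ^ (-(1 / 3) : ℝ))) * gaussMass n ≤
      ∫⁻ x in quasirandomSet f, gaussWeight S x ∂(Measure.pi fun _ => unitLaw) := by
  have hn := h.pos
  have hl := h.log_ge
  have hG := measurableSet_quasirandomSet f
  have hm1 : Real.log n ^ 2 / Real.sqrt n ≤ 1 := by
    have h1 := h.sq_le_div
    have h2 := h.rpow_le
    by_contra! h3
    nlinarith
  have hset : ∫⁻ x in quasirandomSet f, gaussWeight S x ∂(Measure.pi fun _ => unitLaw) =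
      ∫⁻ x in quasirandomSet f, gaussWeight S x ∂(Measure.pi fun _ => halfLine) := by
    -- Quasirandom points satisfy `x i ≤ 1`, so restricting to the cube loses nothing.
    rw [pi_unitLaw, Measure.restrict_restrict hG]
    refine setLIntegral_congr ?_
    filter_upwards [ae_pi_nonneg (fun _ : Fin n => halfLine) fun _ => ae_halfLine_nonneg] with x hx
    refine propext ⟨fun hq => hq.1, fun hq => ⟨hq, fun i _ => ⟨hx i, ?_⟩⟩⟩
    exact (hq.2.1 i).trans hm1
  rw [hset]
  have hc := lintegral_gaussWeight_compl_quasirandomSet_le (by linarith) S ?_ ?_ hf hf0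
  rotate_left
  · rw [hS]
    refine le_trans ?_ h.sqrt_ge
    nlinarith
  · rw [hS]; exact h.card_le
  have htot := lintegral_gaussWeight hn S
  rw [← lintegral_add_compl _ hG] at htot
  have hδ := h.rpow_pos
  have hδ1 := h.rpow_le
  have hsq := h.sq_div_le
  rw [hS] at hc htot
  set δ := (n : ℝ) ^ (-(1 / 3) : ℝ)
  have hfin : ENNReal.ofReal (3000 * δ * ((n : ℝ) ^ k)⁻¹) * gaussMass n ≠ ∞ :=
    ENNReal.mul_ne_top ENNReal.ofReal_ne_top (gaussMass_ne_top hn)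
  -- Adding the finite bound for the complement to both sides avoids truncated subtraction.
  refine (ENNReal.add_le_add_iff_right hfin).1 ?_
  refine le_trans ?_ (add_le_add le_rfl hc)
  have hp : 0 ≤ ((n : ℝ) ^ k)⁻¹ := by positivity
  rw [htot, ← add_mul, ← ENNReal.ofReal_add (mul_nonneg hp (by linarith)) (by positivity)]
  refine mul_le_mul' (ENNReal.ofReal_le_ofReal ?_) le_rfl
  refine le_trans ?_ (le_factorial_div_factorial hn k)
  calc _ = ((n : ℝ) ^ k)⁻¹ * (1 - δ) := by ring
    _ ≤ _ := mul_le_mul_of_nonneg_left (by linarith) hp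

end Integration

/-! ### Numerator, denominator and quotient. -/

section Probability

open scoped ENNReal

variable {n : ℕ} {M M₁ : KSubgraph n}

theorem prefLaw_stable_inter_quasirandom_le (hM : M.IsPerfectMatching)
    (hM₁ : M₁.IsPerfectMatching) (h : SizeConditions n (M.edgeSet \ M₁.edgeSet).ncard) :
    prefLaw n (stableEvent hM₁ ∩ stableEvent hM ∩ quasirandomEvent hM) ≤
      ENNReal.ofReal (2 ^ numCycles M M₁ * ((n : ℝ) ^ (M.edgeSet \ M₁.edgeSet).ncard)⁻¹ *
        (Real.exp (5 * (n : ℝ) ^ (-(1 / 3) : ℝ)) * Real.exp (1 / 2))) * gaussMass n := by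
  set k := (M.edgeSet \ M₁.edgeSet).ncard with hk
  set c := Real.exp (5 * (n : ℝ) ^ (-(1 / 3) : ℝ)) * Real.exp (1 / 2) with hc
  have hc0 : 0 ≤ c := by positivity
  have hG := measurableSet_quasirandomSet (partner hM)
  refine (prefLaw_stable_inter hM hM₁ hG).trans_le ?_
  calc _ ≤ ∫⁻ x in quasirandomSet (partner hM),
        ∑ S ∈ alternatingSets (partner hM) (partner hM₁), ENNReal.ofReal c * gaussWeight S x
        ∂(Measure.pi fun _ => unitLaw) := by
        refine setLIntegral_mono_ae' hG ?_
        filter_upwards [ae_pi_unitLaw (Fin n)] with x hx hxG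
        rw [lintegral_sum_pattern]
        exact Finset.sum_le_sum fun S hS => lintegral_pattern_le_gaussWeight h
          (partner_involutive hM) (partner_involutive hM₁) (fun i => (ne_partner hM i).symm) hS
          (card_of_mem_alternatingSets hM hM₁ hS) hxG fun i => (hx i).1
    _ = ∑ S ∈ alternatingSets (partner hM) (partner hM₁), ENNReal.ofReal c *
          ∫⁻ x in quasirandomSet (partner hM), gaussWeight S x ∂(Measure.pi fun _ => unitLaw) := by
        rw [lintegral_finsetSum _ fun S _ => (measurable_gaussWeight S).const_mul _]
        exact Finset.sum_congr rfl fun S _ => lintegral_const_mul _ (measurable_gaussWeight S)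
    _ ≤ ∑ S ∈ alternatingSets (partner hM) (partner hM₁), ENNReal.ofReal c *
          (ENNReal.ofReal (((n : ℝ) ^ k)⁻¹) * gaussMass n) := by
        refine Finset.sum_le_sum fun S hS => mul_le_mul' le_rfl ?_
        rw [hk, ← card_of_mem_alternatingSets hM hM₁ hS]
        exact setLIntegral_gaussWeight_le h.pos S _
    _ = _ := by
        rw [Finset.sum_const, card_alternatingSets_partner, nsmul_eq_mul, ← mul_assoc, ← mul_assoc,
          ← ENNReal.ofReal_natCast, ← ENNReal.ofReal_mul (by positivity),
          ← ENNReal.ofReal_mul (by positivity)]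
        congr 2
        push_cast
        ring

/-- `3007 = 6 + 3001`: the pointwise loss and the loss in the integration. -/
theorem le_prefLaw_stable_inter_quasirandom (hM : M.IsPerfectMatching)
    (hM₁ : M₁.IsPerfectMatching) (h : SizeConditions n (M.edgeSet \ M₁.edgeSet).ncard) :
    ENNReal.ofReal (2 ^ numCycles M M₁ * ((n : ℝ) ^ (M.edgeSet \ M₁.edgeSet).ncard)⁻¹ *
        ((1 - 3007 * (n : ℝ) ^ (-(1 / 3) : ℝ)) * Real.exp (1 / 2))) * gaussMass n ≤
      prefLaw n (stableEvent hM₁ ∩ stableEvent hM ∩ quasirandomEvent hM) := by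
  have hδ0 := h.rpow_pos
  have hδ1 := h.rpow_le
  have hlow (S : Finset (Fin n)) (hS : S.card = (M.edgeSet \ M₁.edgeSet).ncard) :=
    le_setLIntegral_gaussWeight h hS (partner_involutive hM) (fun i => (ne_partner hM i).symm)
  have hpt (S : Finset (Fin n)) (hS : S ∈ alternatingSets (partner hM) (partner hM₁))
      (x : Fin n → ℝ) (hx : x ∈ quasirandomSet (partner hM)) (hx0 : ∀ i, 0 ≤ x i) :=
    gaussWeight_le_lintegral_pattern h (partner_involutive hM) (partner_involutive hM₁)
      (fun i => (ne_partner hM i).symm) hS (card_of_mem_alternatingSets hM hM₁ hS) hx hx0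
  set k := (M.edgeSet \ M₁.edgeSet).ncard with hk
  set δ := (n : ℝ) ^ (-(1 / 3) : ℝ) with hδ
  set c := (1 - 6 * δ) * Real.exp (1 / 2) with hc
  have hc0 : 0 ≤ c := mul_nonneg (by linarith) (Real.exp_pos _).le
  have hG := measurableSet_quasirandomSet (partner hM)
  refine le_trans ?_ (prefLaw_stable_inter hM hM₁ hG).ge
  calc _ ≤ ∑ S ∈ alternatingSets (partner hM) (partner hM₁), ENNReal.ofReal c *
          (ENNReal.ofReal (((n : ℝ) ^ k)⁻¹ * (1 - 3001 * δ)) * gaussMass n) := by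
        rw [Finset.sum_const, card_alternatingSets_partner, nsmul_eq_mul]
        conv_rhs => rw [← mul_assoc, ← mul_assoc]
        refine mul_le_mul' ?_ le_rfl
        rw [← ENNReal.ofReal_natCast, ← ENNReal.ofReal_mul (by positivity),
          ← ENNReal.ofReal_mul (by positivity)]
        refine ENNReal.ofReal_le_ofReal ?_
        push_cast
        have hd : (1 - 3007 * δ) * Real.exp (1 / 2) ≤ c * (1 - 3001 * δ) := by
          rw [hc, mul_right_comm]
          refine mul_le_mul_of_nonneg_right ?_ (Real.exp_pos _).le
          nlinarith
        calc _ ≤ 2 ^ numCycles M M₁ * ((n : ℝ) ^ k)⁻¹ * (c * (1 - 3001 * δ)) :=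
              mul_le_mul_of_nonneg_left hd (by positivity)
          _ = _ := by ring
    _ ≤ ∑ S ∈ alternatingSets (partner hM) (partner hM₁), ENNReal.ofReal c *
          ∫⁻ x in quasirandomSet (partner hM), gaussWeight S x ∂(Measure.pi fun _ => unitLaw) :=
        Finset.sum_le_sum fun S hS => mul_le_mul' le_rfl
          (hlow S (card_of_mem_alternatingSets hM hM₁ hS))
    _ = ∫⁻ x in quasirandomSet (partner hM),
        ∑ S ∈ alternatingSets (partner hM) (partner hM₁), ENNReal.ofReal c * gaussWeight S x
        ∂(Measure.pi fun _ => unitLaw) := by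
        rw [lintegral_finsetSum _ fun S _ => (measurable_gaussWeight S).const_mul _]
        exact Finset.sum_congr rfl fun S _ => (lintegral_const_mul _ (measurable_gaussWeight S)).symm
    _ ≤ _ := by
        refine setLIntegral_mono_ae' hG ?_
        filter_upwards [ae_pi_unitLaw (Fin n)] with x hx hxG
        rw [lintegral_sum_pattern]
        exact Finset.sum_le_sum fun S hS => hpt S hS x hxG fun i => (hx i).1

theorem numCycles_self : numCycles M M = 0 := by
  have h : {c : (M.spanningCoe ∆ M.spanningCoe).ConnectedComponent | c.supp.Nontrivial} = ∅ := by
    refine Set.eq_empty_iff_forall_notMem.2 fun c hc => ?_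
    obtain ⟨a, ha, b, hb, hab⟩ := hc
    have hr := SimpleGraph.ConnectedComponent.exact (ha.trans hb.symm)
    rw [symmDiff_self] at hr
    exact hab (SimpleGraph.reachable_bot.1 hr)
  rw [numCycles, h, Set.ncard_empty]

theorem le_prefLaw_stableEvent (hM : M.IsPerfectMatching) (h : SizeConditions n 0) :
    ENNReal.ofReal ((1 - 3007 * (n : ℝ) ^ (-(1 / 3) : ℝ)) * Real.exp (1 / 2)) * gaussMass n ≤
      prefLaw n (stableEvent hM) := by
  have h1 := le_prefLaw_stable_inter_quasirandom hM hM (by simpa using h)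
  simp only [numCycles_self, Set.sdiff_self, Set.ncard_empty, pow_zero, inv_one, one_mul] at h1
  exact h1.trans (measure_mono fun X hX => hX.1.2)

/-- The integral formula with `M₁ = M` has no moved points. Off the quasirandom set only the global
bound on `stabilityWeight` is available; its constant `exp (9/4)` is harmless next to the small mass
of the complement. -/
theorem prefLaw_stableEvent_compl_quasirandom_le (hM : M.IsPerfectMatching)
    (h : SizeConditions n 0) :
    prefLaw n (stableEvent hM ∩ (quasirandomEvent hM)ᶜ) ≤
      ENNReal.ofReal (Real.exp (9 / 4) * (3000 * (n : ℝ) ^ (-(1 / 3) : ℝ))) * gaussMass n := by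
  have hG := measurableSet_quasirandomSet (partner hM)
  have hf := partner_involutive hM
  have hf0 (i : Fin n) : partner hM i ≠ i := (ne_partner hM i).symm
  have hrep := prefLaw_stable_inter hM hM hG.compl
  rw [Set.inter_self] at hrep
  refine hrep.trans_le ?_
  have hS : alternatingSets (partner hM) (partner hM) = {∅} := by
    ext S; simp [mem_alternatingSets, moved]
  have hemp : IsEmpty (Moved (partner hM) (partner hM)) := ⟨fun t => by simpa [moved] using t.2⟩
  calc _ ≤ ∫⁻ x in (quasirandomSet (partner hM))ᶜ, ENNReal.ofReal (Real.exp (9 / 4)) *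
        gaussWeight ∅ x ∂(Measure.pi fun _ => unitLaw) := by
        refine setLIntegral_mono_ae' hG.compl ?_
        filter_upwards [ae_pi_unitLaw (Fin n)] with x hx _
        rw [hS, gaussWeight_empty, ← ENNReal.ofReal_mul (Real.exp_pos _).le]
        have hb : ∀ y : Moved (partner hM) (partner hM) → ℝ, _ := fun y =>
          prod_freeProb_le hf hf hx (y := y) fun t => hemp.elim t
        calc _ ≤ ∫⁻ _, ENNReal.ofReal (stabilityWeight (partner hM) x)
                ∂(Measure.pi fun _ : Moved (partner hM) (partner hM) => unitLaw) := by
              refine lintegral_mono fun y => ?_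
              simpa [stabilityWeight] using hb y
          _ = ENNReal.ofReal (stabilityWeight (partner hM) x) := by simp
          _ ≤ _ := ENNReal.ofReal_le_ofReal
              (stabilityWeight_le_global hf hf0 (fun i => (hx i).1) fun i => (hx i).2)
    _ ≤ ENNReal.ofReal (Real.exp (9 / 4)) * ∫⁻ x in (quasirandomSet (partner hM))ᶜ,
        gaussWeight ∅ x ∂(Measure.pi fun _ => halfLine) := by
        rw [lintegral_const_mul _ (measurable_gaussWeight _)]
        exact mul_le_mul' le_rfl (setLIntegral_unitLaw_le_halfLine _ _)
    _ ≤ _ := by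
        have hc := lintegral_gaussWeight_compl_quasirandomSet_le (by linarith [h.log_ge])
          (∅ : Finset (Fin n)) (by simp) (by simpa using h.rpow_pos.le) hf hf0
        rw [Finset.card_empty, pow_zero, inv_one, mul_one] at hc
        rw [ENNReal.ofReal_mul (Real.exp_pos _).le, mul_assoc]
        exact mul_le_mul' le_rfl hc

theorem prefLaw_stableEvent_le (hM : M.IsPerfectMatching) (h : SizeConditions n 0) :
    prefLaw n (stableEvent hM) ≤ ENNReal.ofReal
      (Real.exp (5 * (n : ℝ) ^ (-(1 / 3) : ℝ)) * Real.exp (1 / 2) +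
        Real.exp (9 / 4) * (3000 * (n : ℝ) ^ (-(1 / 3) : ℝ))) * gaussMass n := by
  have h1 := prefLaw_stable_inter_quasirandom_le hM hM (by simpa using h)
  simp only [numCycles_self, Set.sdiff_self, Set.ncard_empty, pow_zero, inv_one, one_mul,
    Set.inter_self] at h1
  have h2 := prefLaw_stableEvent_compl_quasirandom_le hM h
  have hδ := h.rpow_pos
  rw [ENNReal.ofReal_add (by positivity) (by positivity), add_mul]
  refine le_trans ?_ (add_le_add h1 h2)
  refine le_trans (measure_mono fun X hX => ?_) (measure_union_le _ _)
  by_cases hq : X ∈ quasirandomEvent hM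
  · exact Or.inl ⟨hX, hq⟩
  · exact Or.inr ⟨hX, hq⟩

instance : IsProbabilityMeasure (prefLaw n) := by
  have : IsProbabilityMeasure ((volume : Measure ℝ).restrict (Set.Icc 0 1)) := ⟨by simp⟩
  unfold prefLaw; infer_instance

/-- In units of `exp (1/2) * Z`, the numerator lies between `q (1 - 3007δ)` and `q (1 + 10δ)`, and
the denominator between `1 - 3007δ` and `1 + 27010δ`, where `27010 = 10 + 9 * 3000`. The constant
31000 exceeds `3007 + 27010`. -/
theorem abs_div_sub_le {δ Z N D q : ℝ} (hδ0 : 0 < δ) (hδ1 : δ ≤ 1 / 20000) (hZ : 0 < Z)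
    (hq : 0 ≤ q) (hN1 : q * ((1 - 3007 * δ) * Real.exp (1 / 2)) * Z ≤ N)
    (hN2 : N ≤ q * (Real.exp (5 * δ) * Real.exp (1 / 2)) * Z)
    (hD1 : (1 - 3007 * δ) * Real.exp (1 / 2) * Z ≤ D)
    (hD2 : D ≤ (Real.exp (5 * δ) * Real.exp (1 / 2) + Real.exp (9 / 4) * (3000 * δ)) * Z) :
    |D⁻¹ * N - q| ≤ 31000 * δ * q := by
  have hW : 0 < Real.exp (1 / 2) * Z := by positivity
  have he : Real.exp (5 * δ) ≤ 1 + 10 * δ := by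
    have h1 := Real.abs_exp_sub_one_le (x := 5 * δ) (by rw [abs_of_pos (by linarith)]; linarith)
    rw [abs_of_pos (show 0 < 5 * δ by linarith)] at h1
    linarith [(abs_le.1 h1).2]
  have he2 : Real.exp (9 / 4) ≤ 9 * Real.exp (1 / 2) := by
    have h1 : Real.exp (9 / 4) ≤ Real.exp 2 * Real.exp (1 / 2) := by
      rw [← Real.exp_add]; exact Real.exp_le_exp.2 (by norm_num)
    have h2 : Real.exp 2 = Real.exp 1 ^ 2 := by rw [← Real.exp_nat_mul]; norm_num
    have h3 : Real.exp 1 ^ 2 ≤ 9 := by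
      have := Real.exp_one_lt_d9
      have := Real.exp_pos 1
      nlinarith
    rw [h2] at h1
    exact h1.trans (mul_le_mul_of_nonneg_right h3 (Real.exp_pos _).le)
  set W := Real.exp (1 / 2) * Z with hWdef
  have hN1' : q * ((1 - 3007 * δ) * W) ≤ N := by rw [hWdef]; linarith
  have hN2' : N ≤ q * ((1 + 10 * δ) * W) := by
    refine hN2.trans ?_
    calc _ = q * (Real.exp (5 * δ) * W) := by rw [hWdef]; ring
      _ ≤ _ := mul_le_mul_of_nonneg_left (mul_le_mul_of_nonneg_right he hW.le) hq
  have hD1' : (1 - 3007 * δ) * W ≤ D := by rw [hWdef]; linarith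
  have hD2' : D ≤ (1 + 27010 * δ) * W := by
    refine hD2.trans ?_
    have h1 : Real.exp (5 * δ) * Real.exp (1 / 2) ≤ (1 + 10 * δ) * Real.exp (1 / 2) :=
      mul_le_mul_of_nonneg_right he (Real.exp_pos _).le
    have h2 : Real.exp (9 / 4) * (3000 * δ) ≤ 9 * Real.exp (1 / 2) * (3000 * δ) :=
      mul_le_mul_of_nonneg_right he2 (by linarith)
    calc _ ≤ ((1 + 10 * δ) * Real.exp (1 / 2) + 9 * Real.exp (1 / 2) * (3000 * δ)) * Z :=
          mul_le_mul_of_nonneg_right (add_le_add h1 h2) hZ.le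
      _ = _ := by rw [hWdef]; ring
  have hD0 : 0 < D := lt_of_lt_of_le (mul_pos (by linarith) hW) hD1'
  have hqW : 0 ≤ q * W := mul_nonneg hq hW.le
  rw [abs_le, inv_mul_eq_div, neg_le_sub_iff_le_add, sub_le_iff_le_add]
  constructor
  · rw [← sub_le_iff_le_add, le_div_iff₀ hD0]
    -- The bound `δ ≤ 1/20000` does not make this factor nonnegative; when it is negative the lower
    -- bound is trivial.
    rcases le_total 0 (1 - 31000 * δ) with hs | hs
    · calc (q - 31000 * δ * q) * D = q * (1 - 31000 * δ) * D := by ring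
        _ ≤ q * (1 - 31000 * δ) * ((1 + 27010 * δ) * W) :=
            mul_le_mul_of_nonneg_left hD2' (mul_nonneg hq hs)
        _ = (q * W) * ((1 - 31000 * δ) * (1 + 27010 * δ)) := by ring
        _ ≤ (q * W) * (1 - 3007 * δ) := by
            refine mul_le_mul_of_nonneg_left ?_ hqW
            nlinarith
        _ ≤ N := by linarith
    · refine le_trans ?_ (le_trans (mul_nonneg hq (mul_nonneg (by linarith) hW.le)) hN1')
      calc (q - 31000 * δ * q) * D = -(q * D * -(1 - 31000 * δ)) := by ring
        _ ≤ 0 := neg_nonpos.2 (mul_nonneg (mul_nonneg hq hD0.le) (by linarith))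
  · rw [div_le_iff₀ hD0]
    calc N ≤ q * ((1 + 10 * δ) * W) := hN2'
      _ = (q * W) * (1 + 10 * δ) := by ring
      _ ≤ (q * W) * ((1 + 31000 * δ) * (1 - 3007 * δ)) := by
          refine mul_le_mul_of_nonneg_left ?_ hqW
          nlinarith
      _ = q * (1 + 31000 * δ) * ((1 - 3007 * δ) * W) := by ring
      _ ≤ q * (1 + 31000 * δ) * D :=
          mul_le_mul_of_nonneg_left hD1' (mul_nonneg hq (by linarith))
      _ = _ := by ring

theorem abs_cond_stableEvent_sub_le (hM : M.IsPerfectMatching) (hM₁ : M₁.IsPerfectMatching)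
    (h : SizeConditions n (M.edgeSet \ M₁.edgeSet).ncard) :
    |((prefLaw n)[|stableEvent hM]).real (stableEvent hM₁ ∩ quasirandomEvent hM) -
        2 ^ numCycles M M₁ * ((n : ℝ) ^ (M.edgeSet \ M₁.edgeSet).ncard)⁻¹| ≤
      31000 * (n : ℝ) ^ (-(1 / 3) : ℝ) *
        (2 ^ numCycles M M₁ * ((n : ℝ) ^ (M.edgeSet \ M₁.edgeSet).ncard)⁻¹) := by
  have hn1 := prefLaw_stable_inter_quasirandom_le hM hM₁ h
  have hn2 := le_prefLaw_stable_inter_quasirandom hM hM₁ h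
  have hd1 := prefLaw_stableEvent_le hM h.mono
  have hd2 := le_prefLaw_stableEvent hM h.mono
  have hδ0 := h.rpow_pos
  have hδ1 := h.rpow_le
  have hZ0 := gaussMass_ne_zero h.pos
  have hZ1 := gaussMass_ne_top h.pos
  have hset : stableEvent hM ∩ (stableEvent hM₁ ∩ quasirandomEvent hM) =
      stableEvent hM₁ ∩ stableEvent hM ∩ quasirandomEvent hM := by
    rw [← Set.inter_assoc, Set.inter_comm (stableEvent hM)]
  rw [Measure.real, cond_apply (measurableSet_stableEvent hM), hset, ENNReal.toReal_mul,
    ENNReal.toReal_inv]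
  have hup {a : ℝ} {A : Set (OffDiag n → ℝ)} (ha : 0 ≤ a)
      (hA : prefLaw n A ≤ ENNReal.ofReal a * gaussMass n) :
      (prefLaw n A).toReal ≤ a * (gaussMass n).toReal := by
    have := ENNReal.toReal_mono (ENNReal.mul_ne_top ENNReal.ofReal_ne_top hZ1) hA
    rwa [ENNReal.toReal_mul, ENNReal.toReal_ofReal ha] at this
  have hlo {a : ℝ} {A : Set (OffDiag n → ℝ)} (ha : 0 ≤ a)
      (hA : ENNReal.ofReal a * gaussMass n ≤ prefLaw n A) :
      a * (gaussMass n).toReal ≤ (prefLaw n A).toReal := by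
    have := ENNReal.toReal_mono (measure_ne_top _ _) hA
    rwa [ENNReal.toReal_mul, ENNReal.toReal_ofReal ha] at this
  have hc : 0 ≤ (1 - 3007 * (n : ℝ) ^ (-(1 / 3) : ℝ)) * Real.exp (1 / 2) :=
    mul_nonneg (by linarith) (Real.exp_pos _).le
  exact abs_div_sub_le hδ0 hδ1 (ENNReal.toReal_pos hZ0 hZ1) (by positivity)
    (hlo (mul_nonneg (by positivity) hc) hn2) (hup (by positivity) hn1) (hlo hc hd2)
    (hup (by positivity) hd1)

/-- Put `y = n^(1/60)`, so that `n^(1/4)`, `n^(1/3)` and `√n` become `y^15`, `y^20` and `y^30`,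
while `log n ≤ y/40` eventually. In the fourth condition, `k² log⁶ n / n` is of order at most `y^(30
+ 6 - 60) = y^(-24)`, below `y^(-20)`. -/
theorem eventually_sizeConditions : ∀ᶠ n : ℕ in Filter.atTop, ∀ k : ℕ,
    (k : ℝ) ≤ (n : ℝ) ^ (1 / 4 : ℝ) → SizeConditions n k := by
  have hlog : ∀ᶠ x : ℝ in Filter.atTop, 30 ≤ Real.log x :=
    Real.tendsto_log_atTop.eventually_ge_atTop 30
  have hsmall : ∀ᶠ x : ℝ in Filter.atTop, Real.log x ≤ 1 / 40 * x ^ (1 / 60 : ℝ) := by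
    have := (isLittleO_log_rpow_atTop (show (0 : ℝ) < 1 / 60 by norm_num)).bound
      (show (0 : ℝ) < 1 / 40 by norm_num)
    filter_upwards [this, hlog, Filter.eventually_ge_atTop 0] with x h1 h2 h3
    rwa [Real.norm_of_nonneg (by linarith), Real.norm_of_nonneg (Real.rpow_nonneg h3 _)] at h1
  have hcast := tendsto_natCast_atTop_atTop (R := ℝ)
  filter_upwards [hcast.eventually hlog, hcast.eventually hsmall, Filter.eventually_ge_atTop 1]
    with n h1 h2 h3 k hk
  have hn0 : (0 : ℝ) < n := by exact_mod_cast h3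
  have hk0 : (0 : ℝ) ≤ k := Nat.cast_nonneg k
  set y := (n : ℝ) ^ (1 / 60 : ℝ) with hy
  have hy40 : 1200 ≤ y := by linarith
  have hy0 : 0 < y := by linarith
  have hpow (a : ℕ) : y ^ a = (n : ℝ) ^ ((a : ℝ) / 60) := by
    rw [hy, ← Real.rpow_mul_natCast hn0.le]; congr 1; ring
  have hk15 : (k : ℝ) ≤ y ^ 15 := by rw [hpow]; convert hk using 2; norm_num
  have hn60 : (n : ℝ) = y ^ 60 := by rw [hpow]; norm_num
  have hsqrt : Real.sqrt n = y ^ 30 := by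
    rw [hn60, show y ^ 60 = (y ^ 30) ^ 2 by ring, Real.sqrt_sq (by positivity)]
  have hthird : (n : ℝ) ^ (-(1 / 3) : ℝ) = (y ^ 20)⁻¹ := by
    rw [hpow, ← Real.rpow_neg hn0.le]; congr 1; norm_num
  have hy1 : ∀ a : ℕ, 1 ≤ y ^ a := fun a => one_le_pow₀ (by linarith)
  have hk1 : 1 + (k : ℝ) ≤ 2 * y ^ 15 := by linarith [hy1 15]
  have hl0 : 0 ≤ Real.log n := by linarith
  refine ⟨h1, ?_, ?_, ?_⟩
  · rw [hsqrt]
    calc 20 * ((k : ℝ) + 1) * Real.log n ≤ 20 * (2 * y ^ 15) * (1 / 40 * y) := by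
          gcongr; linarith
      _ = y ^ 16 * 1 := by ring
      _ ≤ y ^ 16 * y ^ 14 := mul_le_mul_of_nonneg_left (hy1 14) (by positivity)
      _ = _ := by ring
  · rw [hthird, hn60, div_le_iff₀ (by positivity)]
    calc 8 * (k : ℝ) ≤ y * y ^ 15 := mul_le_mul (by linarith) hk15 hk0 hy0.le
      _ ≤ (y * y ^ 15) * y ^ 24 := le_mul_of_one_le_right (by positivity) (hy1 24)
      _ = _ := by field_simp
  · rw [hthird, hsqrt]
    calc (1 + (k : ℝ)) ^ 2 * Real.log n ^ 2 * (Real.log n ^ 2 / y ^ 30) ^ 2 ≤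
          (2 * y ^ 15) ^ 2 * (1 / 40 * y) ^ 2 * ((1 / 40 * y) ^ 2 / y ^ 30) ^ 2 := by
          gcongr
      _ = 4 / 40 ^ 6 * (y ^ 24)⁻¹ := by field_simp; ring
      _ ≤ 4 / 40 ^ 6 * (y ^ 20)⁻¹ := by
          refine mul_le_mul_of_nonneg_left (inv_anti₀ (by positivity) ?_) (by norm_num)
          exact pow_le_pow_right₀ (by linarith) (by norm_num)
      _ ≤ _ := by
          rw [div_eq_mul_inv, mul_comm]
          exact mul_le_mul_of_nonneg_left (by norm_num) (by positivity)

end Probability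

end StableRoommates

theorem mainTheorem2 :
    ∃ (C : ℝ) (K N : ℕ), ∀ n : ℕ, N ≤ n →
      ∀ (M M₁ : (⊤ : SimpleGraph (Fin n)).Subgraph)
        (hM : M.IsPerfectMatching) (hM₁ : M₁.IsPerfectMatching),
        ((M.edgeSet ∆ M₁.edgeSet).ncard : ℝ) ≤ (n : ℝ) ^ (1 / 4 : ℝ) →
        |((StableRoommates.prefLaw n)[|StableRoommates.stableEvent hM]).real
              (StableRoommates.stableEvent hM₁ ∩ StableRoommates.quasirandomEvent hM)
            - 2 ^ StableRoommates.numCycles M M₁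
                * ((n : ℝ) ^ (M.edgeSet \ M₁.edgeSet).ncard)⁻¹|
          ≤ C * Real.log n ^ K * (n : ℝ) ^ (-(1 / 3) : ℝ)
              * (2 ^ StableRoommates.numCycles M M₁
                * ((n : ℝ) ^ (M.edgeSet \ M₁.edgeSet).ncard)⁻¹) := by
  obtain ⟨N, hN⟩ := Filter.eventually_atTop.1 StableRoommates.eventually_sizeConditions
  -- `K = 0` is possible: the logarithms are absorbed by the room between `k ≤ n^(1/4)` and the
  -- error `n^(-1/3)`.
  refine ⟨31000, 0, N, fun n hn M M₁ hM hM₁ h => ?_⟩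
  rw [pow_zero, mul_one]
  refine StableRoommates.abs_cond_stableEvent_sub_le hM hM₁ (hN n hn _ (le_trans ?_ h))
  exact_mod_cast Set.ncard_le_ncard (fun e he => Or.inl he) (Set.toFinite _)
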